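/- Let $(R,\mathfrak m)$ be an excellent Noetherian local ring of dimension $2$ which is unmixed, i.e. $\dim R/\mathfrak p=\dim R$ for every associated prime $\mathfrak p$ of $R$. Let $x,y$ be a system of parameters of $R$ and $Q=(x,y)$. Write $\ell$ for length, $H=H^1_{\mathfrak m}(R)$ for the first local cohomology module, and let $e_0(Q),e_1(Q),e_2(Q)\in\mathbb Z$ be the Hilbert coefficients of $Q$, so that $$\ell(R/Q^{n+1})=e_0(Q)\binom{n+2}{2}-e_1(Q)\binom{n+1}{1}+e_2(Q)\qquad (n\gg 0).$$ Let $$Q^{\lim}=\bigcup_{n\ge 0}\,(x^{n+1},y^{n+1}):_R (xy)^n$$ be the limit closure of $Q$. Then these coefficients exist, all lengths below are finite, and: (1) $\displaystyle e_0(Q)-\ell(R/Q^{\lim})=\ell\bigl(H/QH\bigr).$ (2) If $x$ is superficial for $Q$, i.e. there is an integer $c\ge 0$ such that $(Q^{n+1}:x)\cap Q^c=Q^n$ for all $n\ge c$, then $$e_0(Q)-\ell(R/Q^{\lim})+e_1(Q)=\ell\bigl(H/QH\bigr)-\ell\bigl(H/xH\bigr).$$ (3) For every such $Q$ (whether or not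 $x$ is superficial), $e_0(Q)-\ell(R/Q^{\lim})+e_1(Q)\le 0.$ (4) If $QH=0$, then $x,y$ is a standard system of parameters, i.e. $\ell(R/Q)-e_0(Q)=\ell(R/(x^2,y^2))-e_0((x^2,y^2))$, and $e_0(Q)-\ell(R/Q^{\lim})+e_1(Q)=0.$ -/

import Mathlib

noncomputable section

universe u v

open IsLocalRing

/-- The length of an `R`-module as an integer (meaningful for modules of finite length; the value
is `0` otherwise, so finiteness is always asserted separately). -/
def lengthInt (R : Type u) [CommRing R] (M : Type v) [AddCommGroup M] [Module R M] : ℤ :=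
  ((Module.length R M).toNat : ℤ)

/-! ### Excellent rings -/

/-- A ring is catenary if any two saturated chains of primes with the same end points have
the same length. (Over a Noetherian ring every chain between two primes has bounded length.) -/
def IsCatenaryRing (A : Type u) [CommRing A] : Prop :=
  ∀ s t : RelSeries {pq : PrimeSpectrum A × PrimeSpectrum A | pq.1 ⋖ pq.2},
    s.head = t.head → s.last = t.last → s.length = t.length

/-- A ring homomorphism `A → B` is regular if it is flat with geometrically regular fibres:
for every prime `q` of `A` and every finite extension `L` of `κ(q)`, the ring
`L ⊗ (κ(q) ⊗ B)` is regular. -/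
structure IsRegularAlgebra (A B : Type u) [CommRing A] [CommRing B] [Algebra A B] : Prop where
  flat : Module.Flat A B
  fiber_regular : ∀ (q : Ideal A) [q.IsPrime] (L : Type u) [Field L] [Algebra q.ResidueField L]
    [Module.Finite q.ResidueField L],
    IsRegularRing (TensorProduct q.ResidueField L (q.Fiber B))

/-- Excellent rings: Noetherian, universally catenary, G-ring and J-2. -/
structure IsExcellentRing (R : Type u) [CommRing R] : Prop where
  noetherian : IsNoetherianRing R
  universallyCatenary : ∀ (B : Type u) [CommRing B] [Algebra R B] [Algebra.FiniteType R B],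
    IsCatenaryRing B
  gRing : ∀ (p : Ideal R) [p.IsPrime],
    IsRegularAlgebra (Localization.AtPrime p)
      (AdicCompletion (maximalIdeal (Localization.AtPrime p)) (Localization.AtPrime p))
  jTwo : ∀ (B : Type u) [CommRing B] [Algebra R B] [Algebra.FiniteType R B],
    IsOpen {p : PrimeSpectrum B | IsRegularLocalRing (Localization.AtPrime p.asIdeal)}

/-! ### Unmixed rings, parameters, limit closure, superficial elements -/

/-- `R` is unmixed if `dim R/p = dim R` for every associated prime `p` of `R`. -/
def IsUnmixedRing (R : Type u) [CommRing R] : Prop :=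
  ∀ p ∈ associatedPrimes R R, ringKrullDim (R ⧸ p) = ringKrullDim R

/-- `x₁, …, x_d` is a system of parameters of the local ring `R`: `d = dim R` and the ideal
`(x₁, …, x_d)` is primary to the maximal ideal. -/
def IsSystemOfParameters {R : Type u} [CommRing R] [IsLocalRing R] {d : ℕ} (x : Fin d → R) :
    Prop :=
  ringKrullDim R = d ∧ (Ideal.span (Set.range x)).radical = maximalIdeal R

lemma limitClosure_step {R : Type u} [CommRing R] {d : ℕ} (x : Fin d → R) {a : R} {n : ℕ}
    (h : a * (∏ i, x i) ^ n ∈ Ideal.span (Set.range fun i => x i ^ (n + 1))) :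
    a * (∏ i, x i) ^ (n + 1) ∈ Ideal.span (Set.range fun i => x i ^ (n + 1 + 1)) := by
  rw [pow_succ, ← mul_assoc]
  generalize a * (∏ i, x i) ^ n = b at h ⊢
  induction h using Submodule.span_induction with
  | mem z hz =>
    obtain ⟨i, rfl⟩ := hz
    obtain ⟨c, hc⟩ := Finset.dvd_prod_of_mem x (Finset.mem_univ i)
    rw [hc, ← mul_assoc, ← pow_succ]
    exact Ideal.mul_mem_right _ _ (Ideal.subset_span ⟨i, rfl⟩)
  | zero => simp
  | add z w _ _ hz hw => rw [add_mul]; exact add_mem hz hw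
  | smul r z _ hz => rw [smul_eq_mul, mul_assoc]; exact Ideal.mul_mem_left _ _ hz

lemma limitClosure_mono {R : Type u} [CommRing R] {d : ℕ} (x : Fin d → R) {a : R} {n m : ℕ}
    (hnm : n ≤ m) (h : a * (∏ i, x i) ^ n ∈ Ideal.span (Set.range fun i => x i ^ (n + 1))) :
    a * (∏ i, x i) ^ m ∈ Ideal.span (Set.range fun i => x i ^ (m + 1)) := by
  induction m, hnm using Nat.le_induction with
  | base => exact h
  | succ k _ ih => exact limitClosure_step x ih

/-- The limit closure `⋃ₙ (x₁ⁿ⁺¹, …, x_dⁿ⁺¹) : (x₁ ⋯ x_d)ⁿ`. -/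
def limitClosure {R : Type u} [CommRing R] {d : ℕ} (x : Fin d → R) : Ideal R where
  carrier := {a | ∃ n : ℕ, a * (∏ i, x i) ^ n ∈ Ideal.span (Set.range fun i => x i ^ (n + 1))}
  add_mem' := by
    rintro a b ⟨n, hn⟩ ⟨m, hm⟩
    refine ⟨max n m, ?_⟩
    rw [add_mul]
    exact add_mem (limitClosure_mono x (le_max_left n m) hn)
      (limitClosure_mono x (le_max_right n m) hm)
  zero_mem' := ⟨0, by simp⟩
  smul_mem' := by
    rintro r a ⟨n, hn⟩
    exact ⟨n, by rw [smul_eq_mul, mul_assoc]; exact Ideal.mul_mem_left _ _ hn⟩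

/-- `x ∈ I` is superficial for `I` if for some `c`, `(Iⁿ⁺¹ : x) ∩ I^c = Iⁿ` for all `n ≥ c`. -/
def IsSuperficial {R : Type u} [CommRing R] (I : Ideal R) (x : R) : Prop :=
  x ∈ I ∧ ∃ c : ℕ, ∀ n ≥ c, (I ^ (n + 1)).colon {x} ⊓ I ^ c = I ^ n

/-! ### Hilbert coefficients -/

/-- `e₀, …, e_d` are the coefficients of the Hilbert–Samuel polynomial of `I` in degree `d`:
for all large `n`, `R/Iⁿ⁺¹` has finite length equal to `∑ᵢ (-1)ⁱ eᵢ (n+d-i choose d-i)`. -/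
def HasHilbertCoeffs {R : Type u} [CommRing R] (I : Ideal R) (d : ℕ) (e : ℕ → ℤ) : Prop :=
  ∀ᶠ n : ℕ in Filter.atTop, IsFiniteLength R (R ⧸ I ^ (n + 1)) ∧
    lengthInt R (R ⧸ I ^ (n + 1)) =
      ∑ i ∈ Finset.range (d + 1), (-1) ^ i * e i * ((n + d - i).choose (d - i) : ℤ)

/-- The Krull dimension of `R` as a natural number. -/
def dimNat (R : Type u) [CommRing R] : ℕ := ((ringKrullDim R).unbotD 0).toNat

open Classical in
/-- The `i`-th Hilbert coefficient `eᵢ(I)`, for `i ≤ dim R`. -/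
def hilbertCoeff {R : Type u} [CommRing R] (I : Ideal R) (i : ℕ) : ℤ :=
  if h : ∃ e : ℕ → ℤ, HasHilbertCoeffs I (dimNat R) e then h.choose i else 0

/-- A system of parameters is standard if
`ℓ(R/(x₁, …, x_d)) - e₀(x₁, …, x_d) = ℓ(R/(x₁², …, x_d²)) - e₀(x₁², …, x_d²)`. -/
def IsStandardParameters {R : Type u} [CommRing R] {d : ℕ} (x : Fin d → R) : Prop :=
  lengthInt R (R ⧸ Ideal.span (Set.range x)) - hilbertCoeff (Ideal.span (Set.range x)) 0 =
    lengthInt R (R ⧸ Ideal.span (Set.range fun i => x i ^ 2)) -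
      hilbertCoeff (Ideal.span (Set.range fun i => x i ^ 2)) 0

/-- The first local cohomology module `H¹_𝔪(R)`. -/
abbrev H1m (R : Type u) [CommRing R] [IsLocalRing R] : ModuleCat.{u} R :=
  (localCohomology (maximalIdeal R) 1).obj (ModuleCat.of R R)

/-- The quotient module `H¹_𝔪(R) / I H¹_𝔪(R)`. -/
abbrev H1mQuot (R : Type u) [CommRing R] [IsLocalRing R] (I : Ideal R) : Type u :=
  H1m R ⧸ (I • ⊤ : Submodule R (H1m R))

end

/-! Let S be the ideal transform of R: the elements of the total quotient ring that a power of x and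
a power of y both carry into R. Unmixedness makes x regular on R, and then H¹_𝔪(R) ≅ S/R
(`nonempty_localCohomology_one_equiv`), while x, y is a regular sequence on S and Q^lim = QS ∩ R
(`limitClosure_eq_comap`).

Suppose S/R has finite length. Regularity gives ℓ(S/QⁿS) = C(n+1,2) ℓ(S/QS), so e₀ = ℓ(S/QS), and QS
⊆ R + QS ⊆ S yields (1). The rest of the Hilbert function is q(n) = ℓ(QⁿS/QⁿR). Multiplication by x
gives q(n+1) + k(n) = q(n) + ℓ(H/xH) with k decreasing, so q is eventually linear with slope −e₁ =
ℓ(H/xH) − k(∞); superficiality forces k(∞) = 0, which is (2). The associated graded module of S is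
polynomial over S/QS, hence q(n) ≥ (n+1) ℓ(H/QH), which is (3). If QH = 0 this is an equality, and
it gives (4), applied also to x², y². All this is `exists_hilbertCoeffs` and `main_of_finite`.

Excellence serves to bound S: some power of x maps S into R. Over a domain of dimension two,
universal catenarity makes S integral (`isIntegral_of_pow_smul_mem`). If S were unbounded, S/R would
contain a nonzero x-divisible chain, that is, an element f of the x-adic completion with all f/xⁿ⁺¹
integral modulo a prime; since formal fibres are reduced, f can be kept nonzero there, and this is
impossible (`dvd_of_isIntegral_div`). The bound is then rephrased as `SaturationBounded`, a
condition on modules that passes through filtrations, and is carried from the domains R/p to R by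
dévissage (`saturationBounded_quotient`). -/

noncomputable section

open IsLocalRing CategoryTheory Limits

namespace LocalCohomologyOne

/-! ### Ext¹ through cocycles on a projective resolution. -/

section ExtClass

variable {R : Type u} [CommRing R] {X X' : ModuleCat.{u} R}

/-- The cochain complex of linear maps from a chain complex into a module. -/
abbrev homComplex (P : ChainComplex (ModuleCat.{u} R) ℕ) (Y : ModuleCat.{u} R) :
    CochainComplex (ModuleCat.{u} R) ℕ :=
  P.linearYonedaObj R Y

/-- Precomposition with a chain map. -/
def homComplexMap {P P' : ChainComplex (ModuleCat.{u} R) ℕ} (φ : P ⟶ P') (Y : ModuleCat.{u} R) :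
    homComplex P' Y ⟶ homComplex P Y :=
  (HomologicalComplex.unopFunctor _ _).map
    ((((linearYoneda R (ModuleCat.{u} R)).obj Y).rightOp.mapHomologicalComplex _).map φ).op

/-- Two naturality squares pasted together: one for left derived objects, one for homology in the
opposite category. `glue` fixes the shape of the pasting. -/
lemma isoExt_inv_naturality (P : ProjectiveResolution X) (P' : ProjectiveResolution X')
    (u : X ⟶ X') (φ : P.complex ⟶ P'.complex)
    (comm : φ.f 0 ≫ P'.π.f 0 = P.π.f 0 ≫ u) (n : ℕ) (Y : ModuleCat.{u} R) :
    (P'.isoExt (R := R) n Y).inv ≫ ((Ext R (ModuleCat.{u} R) n).map u.op).app Y =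
      HomologicalComplex.homologyMap (homComplexMap φ Y) n ≫ (P.isoExt (R := R) n Y).inv := by
  have glue : ∀ {A B C A' B' C' : ModuleCat.{u} R} (a : A ⟶ B) (b : B ⟶ C) (m : C ⟶ C')
      (a' : A' ⟶ B') (b' : B' ⟶ C') (k : B ⟶ B') (l : A ⟶ A'),
      b ≫ m = k ≫ b' → a ≫ k = l ≫ a' → (a ≫ b) ≫ m = l ≫ a' ≫ b' := by
    intro A B C A' B' C' a b m a' b' k l h₁ h₂
    rw [Category.assoc, h₁, ← Category.assoc, h₂, Category.assoc]
  exact glue _ _ _ _ _ _ _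
    (congrArg Quiver.Hom.unop (ProjectiveResolution.isoLeftDerivedObj_hom_naturality u P P' φ comm
      ((linearYoneda R (ModuleCat.{u} R)).obj Y).rightOp n))
    (congrArg Quiver.Hom.unop
      (HomologicalComplex.homologyOp_hom_naturality (homComplexMap φ Y) n))

/-- The map from cocycles in degree one to the first cohomology module. -/
def cocycleClass (K : CochainComplex (ModuleCat.{u} R) ℕ) :
    LinearMap.ker (K.d 1 2).hom →ₗ[R] K.homology 1 :=
  (K.liftCycles (ModuleCat.ofHom (LinearMap.ker (K.d 1 2).hom).subtype) 2 (by simp)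
      (by ext z; exact z.2) ≫ K.homologyπ 1).hom

lemma exists_cycle (K : CochainComplex (ModuleCat.{u} R) ℕ) (f : LinearMap.ker (K.d 1 2).hom) :
    ∃ z : K.cycles 1, K.iCycles 1 z = f.1 ∧ cocycleClass K f = K.homologyπ 1 z := by
  refine ⟨(K.liftCycles (ModuleCat.ofHom (LinearMap.ker (K.d 1 2).hom).subtype) 2 (by simp)
      (by ext z; exact z.2)) f, ?_, rfl⟩
  rw [← ModuleCat.comp_apply, HomologicalComplex.liftCycles_i]
  rfl

lemma iCycles_injective (K : CochainComplex (ModuleCat.{u} R) ℕ) :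
    Function.Injective (K.iCycles 1) :=
  (ModuleCat.mono_iff_injective (K.iCycles 1)).1 inferInstance

lemma cocycleClass_surjective (K : CochainComplex (ModuleCat.{u} R) ℕ) :
    Function.Surjective (cocycleClass K) := by
  intro e
  obtain ⟨z, rfl⟩ := (ModuleCat.epi_iff_surjective (K.homologyπ 1)).1 inferInstance e
  refine ⟨⟨K.iCycles 1 z, ?_⟩, ?_⟩
  · rw [LinearMap.mem_ker, ← ModuleCat.comp_apply]
    simp
  · obtain ⟨z', h₁, h₂⟩ := exists_cycle K ⟨K.iCycles 1 z, by
      rw [LinearMap.mem_ker, ← ModuleCat.comp_apply]; simp⟩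
    rw [h₂, iCycles_injective K h₁]

lemma cocycleClass_eq_zero_iff (K : CochainComplex (ModuleCat.{u} R) ℕ)
    (f : LinearMap.ker (K.d 1 2).hom) :
    cocycleClass K f = 0 ↔ ∃ g : K.X 0, K.d 0 1 g = f.1 := by
  obtain ⟨z, hz, hE⟩ := exists_cycle K f
  have hex : (ShortComplex.mk (K.toCycles 0 1) (K.homologyπ 1) (by simp)).Exact :=
    ShortComplex.exact_of_g_is_cokernel _ (K.homologyIsCokernel 0 1 (by simp))
  have h2 := (ShortComplex.moduleCat_exact_iff _).1 hex z
  rw [hE, ← hz]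
  constructor
  · intro h
    obtain ⟨g, hg⟩ := h2 h
    refine ⟨g, ?_⟩
    rw [← hg]
    change _ = K.iCycles 1 ((K.toCycles 0 1) g)
    rw [← ModuleCat.comp_apply, HomologicalComplex.toCycles_i]
  · rintro ⟨g, hg⟩
    have : z = K.toCycles 0 1 g := by
      apply iCycles_injective
      rw [← hg, ← ModuleCat.comp_apply, HomologicalComplex.toCycles_i]
    rw [this, ← ModuleCat.comp_apply, HomologicalComplex.toCycles_comp_homologyπ]
    rfl

lemma homologyMap_cocycleClass {K K' : CochainComplex (ModuleCat.{u} R) ℕ} (ψ : K' ⟶ K)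
    (f' : LinearMap.ker (K'.d 1 2).hom) (f : LinearMap.ker (K.d 1 2).hom)
    (hf : f.1 = ψ.f 1 f'.1) :
    HomologicalComplex.homologyMap ψ 1 (cocycleClass K' f') = cocycleClass K f := by
  obtain ⟨z, hz, hE⟩ := exists_cycle K f
  obtain ⟨z', hz', hE'⟩ := exists_cycle K' f'
  have hc : HomologicalComplex.cyclesMap ψ 1 z' = z := by
    apply iCycles_injective
    rw [hz, ← ModuleCat.comp_apply, HomologicalComplex.cyclesMap_i, ModuleCat.comp_apply, hz', hf]
  rw [hE, hE', ← hc, ← ModuleCat.comp_apply, HomologicalComplex.homologyπ_naturality,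
    ModuleCat.comp_apply]

/-- The map from cocycles on a projective resolution to the first extension module. -/
def extClass (P : ProjectiveResolution X) (Y : ModuleCat.{u} R) :
    LinearMap.ker ((homComplex P.complex Y).d 1 2).hom →ₗ[R]
      ((Ext R (ModuleCat.{u} R) 1).obj (Opposite.op X)).obj Y :=
  (P.isoExt (R := R) 1 Y).inv.hom ∘ₗ cocycleClass (homComplex P.complex Y)

lemma extClass_surjective (P : ProjectiveResolution X) (Y : ModuleCat.{u} R) :
    Function.Surjective (extClass P Y) :=
  ((ModuleCat.epi_iff_surjective (P.isoExt (R := R) 1 Y).inv).1 inferInstance).comp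
    (cocycleClass_surjective _)

lemma extClass_eq_zero_iff (P : ProjectiveResolution X) (Y : ModuleCat.{u} R)
    (f : LinearMap.ker ((homComplex P.complex Y).d 1 2).hom) :
    extClass P Y f = 0 ↔ ∃ g : P.complex.X 0 ⟶ Y, P.complex.d 1 0 ≫ g = f.1 := by
  refine Iff.trans (map_eq_zero_iff (P.isoExt (R := R) 1 Y).inv.hom ?_)
    (cocycleClass_eq_zero_iff _ f)
  exact (ModuleCat.mono_iff_injective (P.isoExt (R := R) 1 Y).inv).1 inferInstance

lemma extClass_naturality (P : ProjectiveResolution X) (P' : ProjectiveResolution X')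
    (u : X ⟶ X') (φ : P.complex ⟶ P'.complex)
    (comm : φ.f 0 ≫ P'.π.f 0 = P.π.f 0 ≫ u) (Y : ModuleCat.{u} R)
    (f' : LinearMap.ker ((homComplex P'.complex Y).d 1 2).hom)
    (f : LinearMap.ker ((homComplex P.complex Y).d 1 2).hom)
    (hf : (f.1 : P.complex.X 1 ⟶ Y) = φ.f 1 ≫ (f'.1 : P'.complex.X 1 ⟶ Y)) :
    ((Ext R (ModuleCat.{u} R) 1).map u.op).app Y (extClass P' Y f') = extClass P Y f := by
  have h := ConcreteCategory.congr_hom (isoExt_inv_naturality P P' u φ comm 1 Y)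
    (cocycleClass _ f')
  refine h.trans ?_
  exact congrArg (P.isoExt (R := R) 1 Y).inv.hom (homologyMap_cocycleClass _ f' f hf)

end ExtClass
-- First local cohomology as the ideal transform modulo R.
section Transform

variable {R : Type u} [CommRing R]

/-- The elements `s` of the total quotient ring such that `xⁿ s` and `yⁿ s` lie in `R`
for some `n`. -/
def idealTransform (x y : R) : Submodule R (FractionRing R) where
  carrier := {s | ∃ n : ℕ, x ^ n • s ∈ (1 : Submodule R (FractionRing R)) ∧
    y ^ n • s ∈ (1 : Submodule R (FractionRing R))}
  add_mem' := by
    rintro a b ⟨n, h₁, h₂⟩ ⟨m, h₃, h₄⟩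
    refine ⟨n + m, ?_, ?_⟩
    · rw [smul_add]
      refine add_mem ?_ ?_
      · rw [pow_add, mul_comm, mul_smul]; exact Submodule.smul_mem _ _ h₁
      · rw [pow_add, mul_smul]; exact Submodule.smul_mem _ _ h₃
    · rw [smul_add]
      refine add_mem ?_ ?_
      · rw [pow_add, mul_comm, mul_smul]; exact Submodule.smul_mem _ _ h₂
      · rw [pow_add, mul_smul]; exact Submodule.smul_mem _ _ h₄
  zero_mem' := ⟨0, by simp, by simp⟩
  smul_mem' := by
    rintro r a ⟨n, h₁, h₂⟩
    exact ⟨n, by rw [smul_comm]; exact Submodule.smul_mem _ _ h₁,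
      by rw [smul_comm]; exact Submodule.smul_mem _ _ h₂⟩

lemma one_le_idealTransform (x y : R) : 1 ≤ idealTransform x y := fun s hs =>
  ⟨0, by simpa using hs, by simpa using hs⟩

/-- The quotient of the ideal transform by `R`. -/
abbrev TransformQuotient (x y : R) : Type u :=
  idealTransform x y ⧸ (1 : Submodule R (FractionRing R)).submoduleOf (idealTransform x y)

lemma transformQuotient_mk_eq_zero {x y : R} (s : idealTransform x y) :
    (Submodule.Quotient.mk s : TransformQuotient x y) = 0 ↔
      (s : FractionRing R) ∈ (1 : Submodule R (FractionRing R)) := by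
  rw [Submodule.Quotient.mk_eq_zero]; rfl

lemma smul_fractionRing_injective {x : R} (hx : x ∈ nonZeroDivisors R) {s t : FractionRing R}
    (h : x • s = x • t) : s = t := by
  rw [Algebra.smul_def, Algebra.smul_def] at h
  exact (IsLocalization.map_units (FractionRing R) (⟨x, hx⟩ : nonZeroDivisors R)).mul_left_cancel h

lemma exists_smul_eq {x : R} (hx : x ∈ nonZeroDivisors R) (s : FractionRing R) :
    ∃ t : FractionRing R, x • t = s := by
  obtain ⟨u, hu⟩ := IsLocalization.map_units (FractionRing R) (⟨x, hx⟩ : nonZeroDivisors R)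
  refine ⟨(↑u⁻¹ : FractionRing R) * s, ?_⟩
  rw [Algebra.smul_def]
  change _ = algebraMap R (FractionRing R) x at hu
  rw [← hu]
  simp

variable {x y : R} {t : ℕ} {J : Ideal R}

/-- Linear maps defined on the kernel of a map onto a module killed by powers of `x` and `y`
extend to the ideal transform. -/
lemma exists_extension (hx : x ∈ nonZeroDivisors R) {P₀ P₁ X : Type u} [AddCommGroup P₀] [AddCommGroup P₁] [AddCommGroup X]
    [Module R P₀] [Module R P₁] [Module R X] (d : P₁ →ₗ[R] P₀) (π : P₀ →ₗ[R] X)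
    (hexact : Function.Exact d π) (hxX : ∀ z : X, x ^ t • z = 0) (hyX : ∀ z : X, y ^ t • z = 0)
    (f : P₁ →ₗ[R] R) (hf : LinearMap.ker d ≤ LinearMap.ker f) :
    ∃ g : P₀ →ₗ[R] idealTransform x y,
      ∀ q, (g (d q) : FractionRing R) = algebraMap R (FractionRing R) (f q) := by
  have hxt : x ^ t ∈ nonZeroDivisors R := pow_mem hx t
  have key : ∀ p : P₀, ∀ q, d q = x ^ t • p → ∀ q', d q' = y ^ t • p →
      y ^ t • f q = x ^ t • f q' := by
    intro p q hq q' hq'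
    rw [← map_smul, ← map_smul, ← sub_eq_zero, ← map_sub]
    apply hf
    rw [LinearMap.mem_ker, map_sub, map_smul, map_smul, hq, hq', smul_comm, sub_self]
  -- The value at p is forced to be f(q)/xᵗ, where d q = xᵗ p. By `key`, multiplying it by yᵗ gives
  -- f(q'), so it lies in the ideal transform.
  have hex : ∀ p, ∃ s : idealTransform x y, ∀ q, d q = x ^ t • p →
      x ^ t • (s : FractionRing R) = algebraMap R (FractionRing R) (f q) := by
    intro p
    obtain ⟨q, hq⟩ := (hexact (x ^ t • p)).1 (by rw [map_smul, hxX])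
    obtain ⟨q', hq'⟩ := (hexact (y ^ t • p)).1 (by rw [map_smul, hyX])
    obtain ⟨s, hs⟩ := exists_smul_eq hxt (algebraMap R (FractionRing R) (f q))
    have hs' : y ^ t • s = algebraMap R (FractionRing R) (f q') := by
      apply smul_fractionRing_injective hxt
      rw [smul_comm, hs, Algebra.smul_def, Algebra.smul_def, ← map_mul, ← map_mul]
      exact congrArg _ (key p q hq q' hq')
    refine ⟨⟨s, t, ?_, ?_⟩, ?_⟩
    · rw [hs]; exact Submodule.algebraMap_mem _
    · rw [hs']; exact Submodule.algebraMap_mem _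
    · intro q₂ hq₂
      change x ^ t • s = _
      rw [hs]
      congr 1
      rw [← sub_eq_zero, ← map_sub]
      apply hf
      rw [LinearMap.mem_ker, map_sub, hq, hq₂, sub_self]
  choose g hg using hex
  have hlift : ∀ p, ∃ q, d q = x ^ t • p := fun p => (hexact (x ^ t • p)).1 (by rw [map_smul, hxX])
  refine ⟨⟨⟨g, ?_⟩, ?_⟩, ?_⟩
  · intro p p'
    obtain ⟨q, hq⟩ := hlift p
    obtain ⟨q', hq'⟩ := hlift p'
    apply Subtype.ext
    apply smul_fractionRing_injective hxt
    rw [hg (p + p') (q + q') (by rw [map_add, hq, hq', smul_add]), map_add, map_add,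
      Submodule.coe_add, smul_add, hg p q hq, hg p' q' hq']
  · intro r p
    obtain ⟨q, hq⟩ := hlift p
    apply Subtype.ext
    apply smul_fractionRing_injective hxt
    rw [hg (r • p) (r • q) (by rw [map_smul, hq, smul_comm]), RingHom.id_apply,
      Submodule.coe_smul, smul_comm, hg p q hq, map_smul, smul_eq_mul, map_mul, Algebra.smul_def]
  · intro q
    apply smul_fractionRing_injective hxt
    change x ^ t • (g (d q) : FractionRing R) = _
    rw [hg (d q) (x ^ t • q) (by rw [map_smul]), map_smul, smul_eq_mul, map_mul, Algebra.smul_def]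

/-- Morphisms `f : P₁ → R` and `g : P₀ → idealTransform x y` related by `g ∘ d = f`. -/
def IsConnecting (P : ChainComplex (ModuleCat.{u} R) ℕ) (f : P.X 1 ⟶ ModuleCat.of R R)
    (g : P.X 0 →ₗ[R] idealTransform x y) : Prop :=
  ∀ q : P.X 1, (g ((P.d 1 0).hom q) : FractionRing R) = algebraMap R (FractionRing R) (f.hom q)

/-- The graph of the connecting homomorphism between `Ext¹(R/J, R)` and the quotient of the
ideal transform by `R`. -/
def connectingGraph (x y : R) (P : ProjectiveResolution (ModuleCat.of R (R ⧸ J))) :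
    Submodule R ((((Ext R (ModuleCat.{u} R) 1).obj (Opposite.op (ModuleCat.of R (R ⧸ J)))).obj
      (ModuleCat.of R R)) × TransformQuotient x y) where
  carrier := {eh | ∃ (f : LinearMap.ker ((homComplex P.complex (ModuleCat.of R R)).d 1 2).hom)
    (g : P.complex.X 0 →ₗ[R] idealTransform x y), extClass P _ f = eh.1 ∧
      IsConnecting P.complex f.1 g ∧
      ∀ p, (P.π.f 0).hom p = (1 : R ⧸ J) → Submodule.Quotient.mk (g p) = eh.2}
  add_mem' := by
    rintro ⟨e, h⟩ ⟨e', h'⟩ ⟨f, g, h₁, h₂, h₃⟩ ⟨f', g', h₁', h₂', h₃'⟩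
    refine ⟨f + f', g + g', by rw [map_add, h₁, h₁']; rfl, fun q => ?_, fun p hp => ?_⟩
    · have := congrArg₂ (· + ·) (h₂ q) (h₂' q)
      simp only [← map_add] at this
      exact this
    · exact congrArg₂ (· + ·) (h₃ p hp) (h₃' p hp)
  zero_mem' := ⟨0, 0, by simp, fun q => (map_zero (algebraMap R (FractionRing R))).symm,
    fun p hp => rfl⟩
  smul_mem' := by
    rintro r ⟨e, h⟩ ⟨f, g, h₁, h₂, h₃⟩
    refine ⟨r • f, r • g, by rw [map_smul, h₁]; rfl, fun q => ?_, fun p hp => ?_⟩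
    · have := congrArg (r • ·) (h₂ q)
      refine this.trans ?_
      rw [Algebra.smul_def, ← map_mul]
      rfl
    · exact congrArg (r • ·) (h₃ p hp)

section Graph

variable (P : ProjectiveResolution (ModuleCat.of R (R ⧸ J)))

lemma exact_d_π : Function.Exact (P.complex.d 1 0).hom (P.π.f 0).hom :=
  (ShortComplex.ShortExact.moduleCat_exact_iff_function_exact _).1 P.exact₀

lemma exact_d_d : Function.Exact (P.complex.d 2 1).hom (P.complex.d 1 0).hom :=
  (ShortComplex.ShortExact.moduleCat_exact_iff_function_exact _).1 (P.exact_succ 0)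

lemma exists_lift_one : ∃ p, (P.π.f 0).hom p = (1 : R ⧸ J) :=
  (ModuleCat.epi_iff_surjective (P.π.f 0)).1 inferInstance (1 : R ⧸ J)

lemma mk_eq_mk_of_isConnecting {f : P.complex.X 1 ⟶ ModuleCat.of R R}
    {g : P.complex.X 0 →ₗ[R] idealTransform x y} (hfg : IsConnecting P.complex f g)
    {p p' : P.complex.X 0} (h : (P.π.f 0).hom p = (P.π.f 0).hom p') :
    (Submodule.Quotient.mk (g p) : TransformQuotient x y) = Submodule.Quotient.mk (g p') := by
  rw [← sub_eq_zero, ← Submodule.Quotient.mk_sub, transformQuotient_mk_eq_zero, ← map_sub]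
  obtain ⟨q, hq⟩ := (exact_d_π P (p - p')).1 (by rw [map_sub, h, sub_self])
  rw [← hq, hfg]
  exact Submodule.algebraMap_mem _

lemma smul_quotient_eq_zero {a : R} (ha : a ∈ J) (z : R ⧸ J) : a • z = 0 := by
  obtain ⟨z, rfl⟩ := Ideal.Quotient.mk_surjective z
  rw [Algebra.smul_def, Ideal.Quotient.algebraMap_eq, ← map_mul, Ideal.Quotient.eq_zero_iff_mem]
  exact Ideal.mul_mem_right _ _ ha

lemma exists_mem_connectingGraph (hx : x ∈ nonZeroDivisors R) (hxJ : x ^ t ∈ J) (hyJ : y ^ t ∈ J)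
    (e : ((Ext R (ModuleCat.{u} R) 1).obj (Opposite.op (ModuleCat.of R (R ⧸ J)))).obj
      (ModuleCat.of R R)) : ∃ h, (e, h) ∈ connectingGraph x y P := by
  obtain ⟨f, rfl⟩ := extClass_surjective P _ e
  obtain ⟨g, hg⟩ := exists_extension (y := y) (t := t) hx (P.complex.d 1 0).hom (P.π.f 0).hom
    (exact_d_π P) (smul_quotient_eq_zero hxJ) (smul_quotient_eq_zero hyJ)
    (ModuleCat.Hom.hom (f.1 : P.complex.X 1 ⟶ ModuleCat.of R R)) (by
      intro q hq
      obtain ⟨w, rfl⟩ := (exact_d_d P q).1 hq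
      exact ConcreteCategory.congr_hom (show P.complex.d 2 1 ≫ f.1 = 0 from f.2) w)
  obtain ⟨p, hp⟩ := exists_lift_one P
  exact ⟨Submodule.Quotient.mk (g p), f, g, rfl, hg, fun p' hp' =>
    mk_eq_mk_of_isConnecting P hg (hp'.trans hp.symm)⟩

/-- If f = g' ∘ d, then g and g' agree after multiplication by xᵗ, because xᵗ P₀ lies in the image
of d. As xᵗ is regular, g takes values in R. -/
lemma eq_zero_of_mem_connectingGraph_left (hx : x ∈ nonZeroDivisors R) (hxJ : x ^ t ∈ J)
    {h : TransformQuotient x y} (hh : (0, h) ∈ connectingGraph x y P) : h = 0 := by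
  obtain ⟨f, g, h₁, h₂, h₃⟩ := hh
  obtain ⟨g', hg'⟩ := (extClass_eq_zero_iff P _ f).1 h₁
  obtain ⟨p, hp⟩ := exists_lift_one P
  refine (h₃ p hp).symm.trans ((transformQuotient_mk_eq_zero _).2 ?_)
  obtain ⟨q, hq⟩ := (exact_d_π P (x ^ t • p)).1 (by
    rw [map_smul]; exact smul_quotient_eq_zero hxJ _)
  suffices (g p : FractionRing R) = algebraMap R (FractionRing R) (g'.hom p) by
    rw [this]; exact Submodule.algebraMap_mem _
  apply smul_fractionRing_injective (pow_mem hx t)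
  have e₁ : x ^ t • (g p : FractionRing R) = g (x ^ t • p) := by rw [map_smul]; rfl
  rw [e₁, ← hq, h₂, ← hg', Algebra.smul_def, ← map_mul]
  congr 1
  change g'.hom ((P.complex.d 1 0).hom q) = _
  rw [hq, map_smul]
  rfl

/-- P₀ is generated by a lift p₀ of 1 modulo the image of d. If g(p₀) lies in R, so does every value
of g, and g itself is a cochain with coboundary f. -/
lemma eq_zero_of_mem_connectingGraph_right
    {e : ((Ext R (ModuleCat.{u} R) 1).obj (Opposite.op (ModuleCat.of R (R ⧸ J)))).obj
      (ModuleCat.of R R)} (hh : (e, (0 : TransformQuotient x y)) ∈ connectingGraph x y P) :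
    e = 0 := by
  obtain ⟨f, g, rfl, h₂, h₃⟩ := hh
  rw [extClass_eq_zero_iff]
  obtain ⟨p₀, hp₀⟩ := exists_lift_one P
  have hmem : ∀ p, (g p : FractionRing R) ∈ LinearMap.range (Algebra.linearMap R (FractionRing R)) := by
    intro p
    rw [← Submodule.one_eq_range, ← transformQuotient_mk_eq_zero]
    obtain ⟨r, hr⟩ := Ideal.Quotient.mk_surjective ((P.π.f 0).hom p : R ⧸ J)
    have : (P.π.f 0).hom p = (P.π.f 0).hom (r • p₀) := by
      rw [map_smul, hp₀]
      refine hr.symm.trans ?_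
      change _ = r • (1 : R ⧸ J)
      rw [Algebra.smul_def, mul_one]; rfl
    rw [mk_eq_mk_of_isConnecting P h₂ this, map_smul, Submodule.Quotient.mk_smul, h₃ p₀ hp₀,
      smul_zero]
  have hinj : Function.Injective (Algebra.linearMap R (FractionRing R)) :=
    IsFractionRing.injective R (FractionRing R)
  refine ⟨ModuleCat.ofHom ((LinearEquiv.ofInjective _ hinj).symm.toLinearMap ∘ₗ
    (((idealTransform x y).subtype ∘ₗ g).codRestrict _ hmem)), ?_⟩
  refine ModuleCat.hom_ext (LinearMap.ext fun q => hinj ?_)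
  refine Eq.trans ?_ (h₂ q)
  exact congrArg Subtype.val ((LinearEquiv.ofInjective _ hinj).apply_symm_apply
    ⟨(g ((P.complex.d 1 0).hom q) : FractionRing R), hmem _⟩)

/-- An element killed by J is a map R/J → S/R. Projectivity of P₀ lifts it to g : P₀ → S, and g ∘ d
then takes values in R. -/
lemma exists_mem_connectingGraph_right (h : TransformQuotient x y) (hJ : ∀ a ∈ J, a • h = 0) :
    ∃ e, (e, h) ∈ connectingGraph x y P := by
  let hmap : (R ⧸ J) →ₗ[R] TransformQuotient x y :=
    Submodule.liftQ J (LinearMap.toSpanSingleton R _ h) (fun a ha => by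
      rw [LinearMap.mem_ker, LinearMap.toSpanSingleton_apply, hJ a ha])
  have hproj : Module.Projective R (P.complex.X 0) :=
    (IsProjective.iff_projective (P.complex.X 0)).2 (P.projective 0)
  obtain ⟨g, hg⟩ := Module.projective_lifting_property
    (Submodule.mkQ ((1 : Submodule R (FractionRing R)).submoduleOf (idealTransform x y)))
    (hmap ∘ₗ (P.π.f 0).hom) (Submodule.mkQ_surjective _)
  have hg' : ∀ p, (Submodule.Quotient.mk (g p) : TransformQuotient x y) = hmap ((P.π.f 0).hom p) :=
    fun p => LinearMap.congr_fun hg p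
  have hinj : Function.Injective (Algebra.linearMap R (FractionRing R)) :=
    IsFractionRing.injective R (FractionRing R)
  have hmem : ∀ q, (g ((P.complex.d 1 0).hom q) : FractionRing R) ∈
      LinearMap.range (Algebra.linearMap R (FractionRing R)) := by
    intro q
    rw [← Submodule.one_eq_range, ← transformQuotient_mk_eq_zero, hg']
    exact (congrArg hmap ((exact_d_π P).apply_apply_eq_zero q)).trans (map_zero hmap)
  let f : P.complex.X 1 ⟶ ModuleCat.of R R := ModuleCat.ofHom
    ((LinearEquiv.ofInjective _ hinj).symm.toLinearMap ∘ₗ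
      (((idealTransform x y).subtype ∘ₗ g ∘ₗ (P.complex.d 1 0).hom).codRestrict _ hmem))
  have hf : ∀ q, algebraMap R (FractionRing R) (f.hom q) = g ((P.complex.d 1 0).hom q) := fun q =>
    congrArg Subtype.val ((LinearEquiv.ofInjective _ hinj).apply_symm_apply
      ⟨(g ((P.complex.d 1 0).hom q) : FractionRing R), hmem _⟩)
  have hf0 : P.complex.d 2 1 ≫ f = 0 := by
    refine ModuleCat.hom_ext (LinearMap.ext fun q => hinj ?_)
    refine (hf _).trans ?_
    have := (exact_d_d P).apply_apply_eq_zero q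
    change (g ((P.complex.d 1 0).hom ((P.complex.d 2 1).hom q)) : FractionRing R) = _
    rw [this]
    simp
  refine ⟨extClass P _ ⟨f, hf0⟩, ⟨f, hf0⟩, g, rfl, fun q => (hf q).symm, fun p hp => ?_⟩
  · rw [hg', hp]
    exact one_smul R h

lemma connectingGraph_naturality {J' : Ideal R}
    (P' : ProjectiveResolution (ModuleCat.of R (R ⧸ J')))
    (w : ModuleCat.of R (R ⧸ J) ⟶ ModuleCat.of R (R ⧸ J')) (hw : w.hom (1 : R ⧸ J) = (1 : R ⧸ J'))
    {e : ((Ext R (ModuleCat.{u} R) 1).obj (Opposite.op (ModuleCat.of R (R ⧸ J')))).obj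
      (ModuleCat.of R R)} {h : TransformQuotient x y} (hh : (e, h) ∈ connectingGraph x y P') :
    (((Ext R (ModuleCat.{u} R) 1).map w.op).app _ e, h) ∈ connectingGraph x y P := by
  obtain ⟨f, g, rfl, h₂, h₃⟩ := hh
  let φ := ProjectiveResolution.lift w P P'
  have comm : φ.f 0 ≫ P'.π.f 0 = P.π.f 0 ≫ w := ProjectiveResolution.lift_commutes_zero w P P'
  have hd : ∀ i j, φ.f i ≫ P'.complex.d i j = P.complex.d i j ≫ φ.f j := fun i j => φ.comm i j
  refine ⟨⟨φ.f 1 ≫ (f.1 : P'.complex.X 1 ⟶ _), ?_⟩, g ∘ₗ (φ.f 0).hom, ?_, fun q => ?_, fun p hp => ?_⟩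
  · have key : ∀ f₀ : P'.complex.X 1 ⟶ ModuleCat.of R R, P'.complex.d 2 1 ≫ f₀ = 0 →
        P.complex.d 2 1 ≫ φ.f 1 ≫ f₀ = 0 := by
      intro f₀ hf₀
      rw [← Category.assoc, ← hd, Category.assoc, hf₀, comp_zero]
    exact key f.1 f.2
  · exact (extClass_naturality P P' w φ comm _ f _ rfl).symm
  · change (g ((P.complex.d 1 0 ≫ φ.f 0).hom q) : FractionRing R) = _
    rw [← hd]
    exact h₂ _
  · refine h₃ _ ?_
    change (φ.f 0 ≫ P'.π.f 0).hom p = _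
    rw [comm]
    change w.hom ((P.π.f 0).hom p) = _
    rw [hp, hw]

end Graph

/-- The connecting map `Ext¹(R/J, R) → S/R`, with `S` the ideal transform. -/
lemma exists_connectingMap (hx : x ∈ nonZeroDivisors R) (hxJ : x ^ t ∈ J) (hyJ : y ^ t ∈ J)
    (P : ProjectiveResolution (ModuleCat.of R (R ⧸ J))) :
    ∃ Φ : ((Ext R (ModuleCat.{u} R) 1).obj (Opposite.op (ModuleCat.of R (R ⧸ J)))).obj
      (ModuleCat.of R R) →ₗ[R] TransformQuotient x y,
      ∀ e h, (e, h) ∈ connectingGraph x y P ↔ Φ e = h := by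
  have huniq : ∀ e h h', (e, h) ∈ connectingGraph x y P → (e, h') ∈ connectingGraph x y P →
      h = h' := by
    intro e h h' hh hh'
    have := sub_mem hh hh'
    rw [Prod.mk_sub_mk, sub_self] at this
    exact sub_eq_zero.1 (eq_zero_of_mem_connectingGraph_left P hx hxJ this)
  choose Φ hΦ using exists_mem_connectingGraph P hx hxJ hyJ
  refine ⟨⟨⟨Φ, fun a b => ?_⟩, fun r a => ?_⟩, fun e h => ⟨fun hh => ?_, ?_⟩⟩
  · exact huniq _ _ _ (hΦ _) (add_mem (hΦ a) (hΦ b))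
  · exact huniq _ _ _ (hΦ _) (Submodule.smul_mem _ r (hΦ a))
  · exact huniq _ _ _ (hΦ _) hh
  · rintro rfl
    exact hΦ e

/-- The first local cohomology module of `R` is the quotient of the ideal transform by `R`. -/
theorem nonempty_localCohomology_one_equiv (I : Ideal R) (hx : x ∈ nonZeroDivisors R)
    (hxI : x ∈ I) (hyI : y ∈ I) (hI : ∀ n : ℕ, ∃ t : ℕ, I ^ t ≤ Ideal.span {x ^ n, y ^ n}) :
    Nonempty ((localCohomology I 1).obj (ModuleCat.of R R) ≃ₗ[R] TransformQuotient x y) := by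
  let D := localCohomology.diagram (localCohomology.idealPowersDiagram I) 1
  let Y := ModuleCat.of R R
  let ev := (evaluation (ModuleCat.{u} R) (ModuleCat.{u} R)).obj Y
  have hD : HasColimit D := localCohomology.hasColimitDiagram.{u, 0} _ 1
  let hc : IsColimit (ev.mapCocone (colimit.cocone D)) :=
    isColimitOfPreserves ev (colimit.isColimit D)
  let res : ∀ t : ℕ, ProjectiveResolution (ModuleCat.of R (R ⧸ I ^ t)) := fun t =>
    ProjectiveResolution.of _
  choose Φ hΦ using fun t : ℕ => exists_connectingMap (t := t) (J := I ^ t) (y := y) hx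
    (Ideal.pow_mem_pow hxI t) (Ideal.pow_mem_pow hyI t) (res t)
  let c : Cocone (D ⋙ ev) :=
    { pt := ModuleCat.of R (TransformQuotient x y)
      ι :=
        { app := fun t => ModuleCat.ofHom (Φ t.unop.unop)
          naturality := by
            intro t t' w
            refine ModuleCat.hom_ext (LinearMap.ext fun e => ?_)
            have h₁ := (hΦ t.unop.unop e _).2 rfl
            exact (hΦ t'.unop.unop _ _).1 (connectingGraph_naturality (res _) (res _)
              ((localCohomology.ringModIdeals (localCohomology.idealPowersDiagram I)).map w.unop)
              rfl h₁) } }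
  have hfac : ∀ (t : ℕ) (e), hc.desc c ((ev.mapCocone (colimit.cocone D)).ι.app
      (Opposite.op (Opposite.op t)) e) = Φ t e := fun t e =>
    ConcreteCategory.congr_hom (hc.fac c (Opposite.op (Opposite.op t))) e
  refine ⟨LinearEquiv.ofBijective (hc.desc c).hom ⟨?_, ?_⟩⟩
  · rw [injective_iff_map_eq_zero]
    intro z hz
    have hcof : IsCofiltered ℕᵒᵖ := isCofiltered_op_of_isFiltered ℕ
    have hfil : IsFiltered (ℕᵒᵖ)ᵒᵖ := isFiltered_op_of_isCofiltered ℕᵒᵖ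
    have hpres : PreservesFilteredColimitsOfSize.{0, 0} (forget (ModuleCat.{u} R)) :=
      preservesFilteredColimitsOfSize_shrink.{0, u, 0, u} _
    have hpres' : PreservesColimit (D ⋙ ev) (forget (ModuleCat.{u} R)) :=
      (hpres.preserves_filtered_colimits (ℕᵒᵖ)ᵒᵖ).preservesColimit
    -- In a filtered colimit z comes from a single stage t, where `Φ t` is injective.
    obtain ⟨⟨⟨t⟩⟩, e, rfl⟩ := Concrete.isColimit_exists_rep _ hc z
    have h0 : Φ t e = 0 := (hfac t e).symm.trans hz
    have : e = 0 := eq_zero_of_mem_connectingGraph_right (res t) ((hΦ t e 0).2 h0)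
    rw [this, map_zero]
  · intro h
    obtain ⟨s, rfl⟩ := Submodule.Quotient.mk_surjective _ h
    obtain ⟨n, hn₁, hn₂⟩ := s.2
    obtain ⟨t, ht⟩ := hI n
    -- The class of s is killed by xⁿ and yⁿ, hence by Iᵗ, so it is already hit from Ext¹(R/Iᵗ, R).
    obtain ⟨e, he⟩ := exists_mem_connectingGraph_right (res t)
      (Submodule.Quotient.mk s : TransformQuotient x y) (by
        intro a ha
        obtain ⟨b, c, rfl⟩ := Ideal.mem_span_pair.1 (ht ha)
        rw [← Submodule.Quotient.mk_smul, transformQuotient_mk_eq_zero, Submodule.coe_smul,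
          add_smul, mul_smul, mul_smul]
        exact add_mem (Submodule.smul_mem _ _ hn₁) (Submodule.smul_mem _ _ hn₂))
    exact ⟨_, (hfac t e).trans ((hΦ t e _).1 he)⟩

end Transform
end LocalCohomologyOne
end

noncomputable section

open IsLocalRing

/-! ### Lengths of subquotients. -/

namespace RelativeLength

variable {R : Type u} [CommRing R] {M : Type v} [AddCommGroup M] [Module R M]
  {M' : Type*} [AddCommGroup M'] [Module R M']

/-- The length of `B / A ⊓ B`. -/
def relLength (A B : Submodule R M) : ℕ∞ := Module.length R (B ⧸ A.submoduleOf B)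

/-- The two conditions say exactly that f induces an isomorphism B/A ≅ B'/A'. Most comparisons of
lengths below come from here, with f multiplication by x or by a power of y. -/
lemma relLength_eq_of_map (f : M →ₗ[R] M') {A B : Submodule R M} {A' B' : Submodule R M'}
    (hB : B' = B.map f ⊔ A') (hA : A = B ⊓ A'.comap f) : relLength A B = relLength A' B' := by
  have hf : ∀ b ∈ B, f b ∈ B' := fun b hb => by
    rw [hB]; exact Submodule.mem_sup_left (Submodule.mem_map_of_mem hb)
  let g : B →ₗ[R] B' ⧸ A'.submoduleOf B' := (A'.submoduleOf B').mkQ ∘ₗ f.restrict hf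
  have hg : Function.Surjective g := by
    intro z
    obtain ⟨⟨z, hz⟩, rfl⟩ := Submodule.mkQ_surjective _ z
    have hz' := hz
    rw [hB] at hz'
    obtain ⟨w, hw, a, ha, rfl⟩ := Submodule.mem_sup.1 hz'
    obtain ⟨b, hb, rfl⟩ := hw
    refine ⟨⟨b, hb⟩, (Submodule.Quotient.eq _).2 ?_⟩
    change f b - (f b + a) ∈ A'
    simpa using ha
  have hk : LinearMap.ker g = A.submoduleOf B := by
    ext ⟨b, hb⟩
    rw [LinearMap.mem_ker]
    change (A'.submoduleOf B').mkQ _ = 0 ↔ b ∈ A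
    rw [Submodule.mkQ_apply, Submodule.Quotient.mk_eq_zero, hA]
    exact ⟨fun h => ⟨hb, h⟩, fun h => h.2⟩
  unfold relLength
  rw [← hk]
  exact (LinearMap.quotKerEquivOfSurjective g hg).length_eq

lemma relLength_add {A B C : Submodule R M} (hAB : A ≤ B) (hBC : B ≤ C) :
    relLength A C = relLength A B + relLength B C := by
  let f : (B ⧸ A.submoduleOf B) →ₗ[R] (C ⧸ A.submoduleOf C) :=
    Submodule.mapQ _ _ (Submodule.inclusion hBC) (fun _ hb => hb)
  let g : (C ⧸ A.submoduleOf C) →ₗ[R] (C ⧸ B.submoduleOf C) :=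
    Submodule.mapQ _ _ LinearMap.id (fun _ hb => hAB hb)
  refine Module.length_eq_add_of_exact f g ?_ ?_ ?_
  · rw [injective_iff_map_eq_zero]
    intro z hz
    obtain ⟨z, rfl⟩ := Submodule.mkQ_surjective _ z
    exact (Submodule.Quotient.mk_eq_zero _).2 ((Submodule.Quotient.mk_eq_zero (A.submoduleOf C)).1 hz : (z : M) ∈ A)
  · intro z
    obtain ⟨z, rfl⟩ := Submodule.mkQ_surjective _ z
    exact ⟨Submodule.Quotient.mk z, rfl⟩
  · intro z
    obtain ⟨z, rfl⟩ := Submodule.mkQ_surjective _ z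
    constructor
    · intro hz
      exact ⟨Submodule.Quotient.mk ⟨z, ((Submodule.Quotient.mk_eq_zero (B.submoduleOf C)).1 hz : (z : M) ∈ B)⟩, rfl⟩
    · rintro ⟨w, hw⟩
      obtain ⟨w, rfl⟩ := Submodule.mkQ_surjective _ w
      have h : (w : M) - z ∈ A := (Submodule.Quotient.eq (A.submoduleOf C)).1 hw
      have h2 := sub_mem w.2 (hAB h)
      rw [sub_sub_cancel] at h2
      exact (Submodule.Quotient.mk_eq_zero _).2 h2

lemma relLength_self (A : Submodule R M) : relLength A A = 0 := by
  unfold relLength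
  rw [Module.length_eq_zero_iff]
  exact Submodule.Quotient.subsingleton_iff.2 (Submodule.submoduleOf_self A)

lemma relLength_top (A : Submodule R M) : relLength A ⊤ = Module.length R (M ⧸ A) := by
  refine (Submodule.Quotient.equiv _ _ Submodule.topEquiv ?_).length_eq
  ext m
  simp only [Submodule.mem_map]
  exact ⟨by rintro ⟨⟨a, _⟩, ha, rfl⟩; exact ha, fun h => ⟨⟨m, trivial⟩, h, rfl⟩⟩

end RelativeLength

/-! ### Powers of Q = (x, y) acting on a module where x, y is a regular pair. -/

namespace ParameterPair

open RelativeLength Pointwise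

variable {R : Type u} [CommRing R] {S : Type v} [AddCommGroup S] [Module R S]

/-- `x, y` is a (weakly) regular sequence on `S`, expressed through elements. -/
structure IsRegularPair (x y : R) (S : Type v) [AddCommGroup S] [Module R S] : Prop where
  smul_eq_zero : ∀ s : S, x • s = 0 → s = 0
  exists_of_smul_eq : ∀ s t : S, x • s = y • t → ∃ v, t = x • v

lemma IsRegularPair.pow {x y : R} (h : IsRegularPair x y S) (n : ℕ) : IsRegularPair x (y ^ n) S := by
  refine ⟨h.1, ?_⟩
  induction n with
  | zero => intro s t hst; exact ⟨s, by simpa using hst.symm⟩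
  | succ n ih =>
    intro s t hst
    rw [pow_succ', mul_smul] at hst
    obtain ⟨v, hv⟩ := h.2 _ _ hst
    obtain ⟨w, hw⟩ := ih v t hv.symm
    exact ⟨w, hw⟩

/-- The only relations between x and yⁿ are the Koszul ones; the injectivity checks below all rest
on this. -/
lemma IsRegularPair.exists_of_smul_eq_pow {x y : R} (h : IsRegularPair x y S) (n : ℕ) {s t : S}
    (hst : x • s = y ^ n • t) : ∃ v, t = x • v ∧ s = y ^ n • v := by
  obtain ⟨v, rfl⟩ := (h.pow n).2 s t hst
  refine ⟨v, rfl, ?_⟩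
  rw [← sub_eq_zero]
  apply h.1
  rw [smul_sub, hst, smul_comm, sub_self]

variable {x y : R} (N : Submodule R S)

lemma mem_span_pair_smul {N : Submodule R S} {s : S} :
    s ∈ Ideal.span {x, y} • N ↔ ∃ a ∈ N, ∃ b ∈ N, s = x • a + y • b := by
  rw [Ideal.span_insert, Submodule.sup_smul, Submodule.mem_sup,
    Submodule.ideal_span_singleton_smul, Submodule.ideal_span_singleton_smul]
  simp only [Submodule.mem_smul_pointwise_iff_exists]
  constructor
  · rintro ⟨_, ⟨a, ha, rfl⟩, _, ⟨b, hb, rfl⟩, rfl⟩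
    exact ⟨a, ha, b, hb, rfl⟩
  · rintro ⟨a, ha, b, hb, rfl⟩
    exact ⟨_, ⟨a, ha, rfl⟩, _, ⟨b, hb, rfl⟩, rfl⟩

lemma left_smul_mem {N : Submodule R S} {n : ℕ} {s : S} (hs : s ∈ Ideal.span {x, y} ^ n • N) :
    x • s ∈ Ideal.span {x, y} ^ (n + 1) • N := by
  rw [pow_succ', mul_smul]
  exact Submodule.smul_mem_smul (Ideal.subset_span (by simp)) hs

lemma right_smul_mem {N : Submodule R S} {n : ℕ} {s : S} (hs : s ∈ Ideal.span {x, y} ^ n • N) :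
    y • s ∈ Ideal.span {x, y} ^ (n + 1) • N := by
  rw [pow_succ', mul_smul]
  exact Submodule.smul_mem_smul (Ideal.subset_span (by simp)) hs

lemma right_pow_smul_mem {N : Submodule R S} (n : ℕ) {s : S} (hs : s ∈ N) :
    y ^ n • s ∈ Ideal.span {x, y} ^ n • N :=
  Submodule.smul_mem_smul (Ideal.pow_mem_pow (Ideal.subset_span (by simp)) n) hs

lemma span_pair_pow_succ_smul_le (N : Submodule R S) (n : ℕ) :
    Ideal.span {x, y} ^ (n + 1) • N ≤ Ideal.span {x, y} ^ n • N :=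
  Submodule.smul_mono_left (Ideal.pow_le_pow_right n.le_succ)

/-- Among the monomials of degree n + 1 only yⁿ⁺¹ is not divisible by x. Each step from n to n + 1
thus consists of x times the previous piece and one new copy carried by yⁿ⁺¹. -/
lemma mem_span_pair_pow_succ_smul {N : Submodule R S} (n : ℕ) {s : S} :
    s ∈ Ideal.span {x, y} ^ (n + 1) • N ↔
      ∃ a ∈ Ideal.span {x, y} ^ n • N, ∃ b ∈ N, s = x • a + y ^ (n + 1) • b := by
  constructor
  · induction n generalizing s with
    | zero =>
      intro hs
      simpa [mem_span_pair_smul] using hs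
    | succ n ih =>
      intro hs
      rw [pow_succ', mul_smul, mem_span_pair_smul] at hs
      obtain ⟨a, ha, b, hb, rfl⟩ := hs
      obtain ⟨b', hb', b'', hb'', rfl⟩ := ih hb
      refine ⟨a + y • b', add_mem ha (right_smul_mem hb'), b'', hb'', ?_⟩
      rw [smul_add, smul_add, smul_smul, smul_smul, smul_smul, mul_comm y x, pow_succ' y (n + 1),
        add_assoc]
  · rintro ⟨a, ha, b, hb, rfl⟩
    exact add_mem (left_smul_mem ha) (right_pow_smul_mem _ hb)

lemma ideal_smul_mono (I : Ideal R) {A B : Submodule R S} (h : A ≤ B) : I • A ≤ I • B :=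
  Submodule.smul_mono le_rfl h

lemma mem_map_lsmul {a : R} {A : Submodule R S} {s : S} :
    s ∈ A.map (LinearMap.lsmul R S a) ↔ ∃ t ∈ A, a • t = s := Iff.rfl

/-- The submodule of all `v` with `x • v ∈ N`. -/
def colonLeft (x : R) (N : Submodule R S) : Submodule R S := N.comap (LinearMap.lsmul R S x)

/-- The submodule of all `v` with `x • v ∈ N` and `y ^ (n + 1) • v ∈ (x, y) ^ n • N`. -/
def colonBoth (x y : R) (N : Submodule R S) (n : ℕ) : Submodule R S :=
  colonLeft x N ⊓ (Ideal.span {x, y} ^ n • N).comap (LinearMap.lsmul R S (y ^ (n + 1)))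

/-- This monotonicity makes the defect in the recursion for the Hilbert function stabilise. -/
lemma colonBoth_mono (x y : R) (N : Submodule R S) : Monotone (colonBoth x y N) := by
  refine monotone_nat_of_le_succ fun n => inf_le_inf_left _ fun v hv => ?_
  have := right_smul_mem (x := x) (y := y) (show y ^ (n + 1) • v ∈ _ from hv)
  rw [smul_smul, ← pow_succ'] at this
  exact this

/-- The kernel of multiplication by `x` from `QⁿS / QⁿN` to `Qⁿ⁺¹S / Qⁿ⁺¹N`. -/
def mulKernel (x y : R) (N : Submodule R S) (n : ℕ) : Submodule R S :=
  Ideal.span {x, y} ^ n • ⊤ ⊓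
    (Ideal.span {x, y} ^ (n + 1) • N).comap (LinearMap.lsmul R S x)

lemma le_mulKernel (n : ℕ) : Ideal.span {x, y} ^ n • N ≤ mulKernel x y N n :=
  le_inf (ideal_smul_mono _ le_top) fun _ hs => left_smul_mem hs

/-- Multiplication by yⁿ⁺¹ maps (N : x) onto the kernel modulo QⁿN: if x s = x q + yⁿ⁺¹ m with q ∈
QⁿN, the Koszul relation gives s − q = yⁿ⁺¹ v and m = x v. -/
lemma relLength_mulKernel (h : IsRegularPair x y S) (n : ℕ) :
    relLength (Ideal.span {x, y} ^ n • N) (mulKernel x y N n) =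
      relLength (colonBoth x y N n) (colonLeft x N) := by
  refine (relLength_eq_of_map (LinearMap.lsmul R S (y ^ (n + 1))) ?_ rfl).symm
  apply le_antisymm
  · rintro s ⟨-, hs⟩
    obtain ⟨q, hq, m, hm, hs⟩ := (mem_span_pair_pow_succ_smul n).1 hs
    have hs' : x • (s - q) = y ^ (n + 1) • m := by
      rw [smul_sub, sub_eq_iff_eq_add, add_comm]; exact hs
    obtain ⟨v, rfl, hv⟩ := h.exists_of_smul_eq_pow _ hs'
    rw [← sub_add_cancel s q, hv]
    exact Submodule.add_mem_sup (mem_map_lsmul.2 ⟨v, hm, rfl⟩) hq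
  · refine sup_le ?_ (le_mulKernel N n)
    rintro _ ⟨v, hv, rfl⟩
    refine ⟨span_pair_pow_succ_smul_le _ _ (right_pow_smul_mem _ trivial), ?_⟩
    change x • y ^ (n + 1) • v ∈ Ideal.span {x, y} ^ (n + 1) • N
    rw [smul_comm]
    exact right_pow_smul_mem _ hv

/-- The first summand is the image of multiplication by x from QⁿS/QⁿN. Its cokernel Qⁿ⁺¹S/(xQⁿS +
Qⁿ⁺¹N) is identified with S/(N + xS) through yⁿ⁺¹. -/
lemma relLength_span_pow_succ (h : IsRegularPair x y S) (n : ℕ) :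
    relLength (Ideal.span {x, y} ^ (n + 1) • N) (Ideal.span {x, y} ^ (n + 1) • ⊤) =
      relLength (mulKernel x y N n) (Ideal.span {x, y} ^ n • ⊤) +
        relLength (N ⊔ (⊤ : Submodule R S).map (LinearMap.lsmul R S x)) ⊤ := by
  rw [relLength_add (B := (Ideal.span {x, y} ^ n • (⊤ : Submodule R S)).map (LinearMap.lsmul R S x) ⊔
    Ideal.span {x, y} ^ (n + 1) • N) le_sup_right]
  · congr 1
    · exact (relLength_eq_of_map (LinearMap.lsmul R S x) rfl rfl).symm
    · refine (relLength_eq_of_map (LinearMap.lsmul R S (y ^ (n + 1))) ?_ ?_).symm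
      · apply le_antisymm
        · intro s hs
          obtain ⟨a, ha, b, -, rfl⟩ := (mem_span_pair_pow_succ_smul n).1 hs
          rw [add_comm (x • a)]
          exact Submodule.add_mem_sup ⟨b, trivial, rfl⟩ (Submodule.mem_sup_left ⟨a, ha, rfl⟩)
        · refine sup_le ?_ (sup_le ?_ (ideal_smul_mono _ le_top))
          · rintro _ ⟨b, -, rfl⟩
            exact right_pow_smul_mem _ trivial
          · rintro _ ⟨b, hb, rfl⟩
            exact left_smul_mem hb
      · apply le_antisymm
        · refine sup_le ?_ ?_
          · intro m hm
            exact ⟨trivial, Submodule.mem_sup_right (right_pow_smul_mem _ hm)⟩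
          · rintro _ ⟨s, -, rfl⟩
            refine ⟨trivial, Submodule.mem_sup_left ⟨y ^ (n + 1) • s,
              span_pair_pow_succ_smul_le _ _ (right_pow_smul_mem _ trivial), ?_⟩⟩
            exact smul_comm _ _ _
        · rintro s ⟨-, hs⟩
          obtain ⟨_, ⟨a, ha, rfl⟩, b, hb, hab⟩ := Submodule.mem_sup.1 hs
          obtain ⟨q, hq, m, hm, rfl⟩ := (mem_span_pair_pow_succ_smul n).1 hb
          change x • a + (x • q + y ^ (n + 1) • m) = y ^ (n + 1) • s at hab
          have hs' : x • (a + q) = y ^ (n + 1) • (s - m) := by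
            rw [smul_sub, ← hab, smul_add]; abel
          obtain ⟨v, hv, -⟩ := h.exists_of_smul_eq_pow _ hs'
          rw [← sub_add_cancel s m, hv, add_comm]
          exact Submodule.add_mem_sup hm ⟨v, trivial, rfl⟩
  · refine sup_le ?_ (ideal_smul_mono _ le_top)
    rintro _ ⟨b, hb, rfl⟩
    exact left_smul_mem hb

/-- The associated graded module of S is (S/QS)[X, Y], whose degree n part consists of n + 1 copies.
N = 0 gives the Hilbert function of S; N = R gives the lower bound behind the inequality for e₁. -/
lemma relLength_graded (h : IsRegularPair x y S) (n : ℕ) :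
    relLength (Ideal.span {x, y} ^ n • N ⊔ Ideal.span {x, y} ^ (n + 1) • ⊤)
        (Ideal.span {x, y} ^ n • ⊤) =
      (n + 1 : ℕ) * relLength (N ⊔ Ideal.span {x, y} • ⊤) ⊤ := by
  induction n with
  | zero => simp
  | succ n ih =>
    rw [relLength_add (B := (Ideal.span {x, y} ^ n • (⊤ : Submodule R S)).map (LinearMap.lsmul R S x) ⊔
      (Ideal.span {x, y} ^ (n + 1) • N ⊔ Ideal.span {x, y} ^ (n + 1 + 1) • ⊤)) le_sup_right]
    · push_cast
      rw [add_mul _ (1 : ℕ∞), one_mul]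
      congr 1
      · have ih' := ih
        push_cast at ih'
        rw [← ih']
        refine (relLength_eq_of_map (LinearMap.lsmul R S x) rfl ?_).symm
        apply le_antisymm
        · refine sup_le (le_inf (ideal_smul_mono _ le_top) fun s hs => ?_)
            (le_inf (span_pair_pow_succ_smul_le _ _) fun s hs => ?_)
          · exact Submodule.mem_sup_left (left_smul_mem hs)
          · exact Submodule.mem_sup_right (left_smul_mem hs)
        · rintro s ⟨-, hs⟩
          obtain ⟨b, hb, c, hc, hbc⟩ := Submodule.mem_sup.1 hs
          obtain ⟨q, hq, m, hm, rfl⟩ := (mem_span_pair_pow_succ_smul n).1 hb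
          obtain ⟨s', hs', s'', -, rfl⟩ := (mem_span_pair_pow_succ_smul (n + 1)).1 hc
          change _ = x • s at hbc
          have e : x • (s - q - s') = y ^ (n + 1) • (m + y • s'') := by
            rw [smul_sub, smul_sub, ← hbc, smul_add, smul_smul (y ^ (n + 1)), ← pow_succ]; abel
          obtain ⟨v, -, hv⟩ := h.exists_of_smul_eq_pow _ e
          have : s = q + (s' + y ^ (n + 1) • v) := by rw [← hv]; abel
          rw [this]
          exact Submodule.add_mem_sup hq (add_mem hs' (right_pow_smul_mem _ trivial))
      · refine (relLength_eq_of_map (LinearMap.lsmul R S (y ^ (n + 1))) ?_ ?_).symm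
        · apply le_antisymm
          · intro s hs
            obtain ⟨a, ha, b, -, rfl⟩ := (mem_span_pair_pow_succ_smul n).1 hs
            rw [add_comm (x • a)]
            exact Submodule.add_mem_sup ⟨b, trivial, rfl⟩ (Submodule.mem_sup_left ⟨a, ha, rfl⟩)
          · refine sup_le ?_ (sup_le ?_ (sup_le (ideal_smul_mono _ le_top)
              (span_pair_pow_succ_smul_le _ _)))
            · rintro _ ⟨b, -, rfl⟩
              exact right_pow_smul_mem _ trivial
            · rintro _ ⟨b, hb, rfl⟩
              exact left_smul_mem hb
        · apply le_antisymm
          · refine sup_le ?_ ?_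
            · intro m hm
              exact ⟨trivial, Submodule.mem_sup_right
                (Submodule.mem_sup_left (right_pow_smul_mem _ hm))⟩
            · intro s hs
              obtain ⟨a, -, b, -, rfl⟩ := mem_span_pair_smul.1 hs
              refine ⟨trivial, ?_⟩
              rw [SetLike.mem_coe, Submodule.mem_comap, LinearMap.lsmul_apply, smul_add, smul_comm,
                smul_smul _ y, ← pow_succ]
              exact Submodule.add_mem_sup ⟨_, span_pair_pow_succ_smul_le _ _
                (right_pow_smul_mem _ trivial), rfl⟩
                (Submodule.mem_sup_right (right_pow_smul_mem _ trivial))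
          · rintro s ⟨-, hs⟩
            obtain ⟨_, ⟨a, ha, rfl⟩, bc, hbc, habc⟩ := Submodule.mem_sup.1 hs
            obtain ⟨b, hb, c, hc, rfl⟩ := Submodule.mem_sup.1 hbc
            obtain ⟨q, hq, m, hm, rfl⟩ := (mem_span_pair_pow_succ_smul n).1 hb
            obtain ⟨s', hs', s'', -, rfl⟩ := (mem_span_pair_pow_succ_smul (n + 1)).1 hc
            change x • a + _ = y ^ (n + 1) • s at habc
            have e : x • (a + q + s') = y ^ (n + 1) • (s - m - y • s'') := by
              rw [smul_sub, smul_sub, ← habc, smul_add, smul_add, smul_smul (y ^ (n + 1)),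
                ← pow_succ]
              abel
            obtain ⟨v, hv, -⟩ := h.exists_of_smul_eq_pow _ e
            have : s = m + (x • v + y • s'') := by rw [← hv]; abel
            rw [this]
            exact Submodule.add_mem_sup hm (mem_span_pair_smul.2 ⟨v, trivial, s'', trivial, rfl⟩)
    · refine sup_le ?_ (sup_le (ideal_smul_mono _ le_top)
        (span_pair_pow_succ_smul_le _ _))
      rintro _ ⟨b, hb, rfl⟩
      exact left_smul_mem hb

lemma relLength_pow (h : IsRegularPair x y S) (n : ℕ) :
    relLength (Ideal.span {x, y} ^ n • (⊤ : Submodule R S)) ⊤ =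
      ((n + 1).choose 2 : ℕ) * relLength (Ideal.span {x, y} • (⊤ : Submodule R S)) ⊤ := by
  induction n with
  | zero => simp [relLength_self]
  | succ n ih =>
    rw [relLength_add (span_pair_pow_succ_smul_le _ n) le_top, ih]
    have := relLength_graded ⊥ h n
    simp only [Submodule.smul_bot, bot_sup_eq] at this
    rw [this, ← add_mul]
    congr 1
    have : (n + 1 + 1).choose 2 = n + 1 + (n + 1).choose 2 := by
      rw [Nat.choose_succ_succ' (n + 1) 1, Nat.choose_one_right]
    rw [this]
    push_cast
    rfl

end ParameterPair

/-! ### Hilbert coefficients of Q from an embedding of R into S. -/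

namespace ParameterPair

open RelativeLength

section Hilbert

variable {R : Type u} [CommRing R]

/-- Second differences isolate e₀, after which first differences isolate e₁. Uniqueness is needed
because `hilbertCoeff` is defined by choice. -/
lemma hasHilbertCoeffs_two_unique {I : Ideal R} {e e' : ℕ → ℤ} (h : HasHilbertCoeffs I 2 e)
    (h' : HasHilbertCoeffs I 2 e') : e 0 = e' 0 ∧ e 1 = e' 1 := by
  obtain ⟨n, hn⟩ := Filter.eventually_atTop.1 (h.and h')
  have key : ∀ m ≥ n, (e 0 - e' 0) * ((m + 2).choose 2 : ℕ) - (e 1 - e' 1) * (m + 1) +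
      (e 2 - e' 2) = 0 := by
    intro m hm
    obtain ⟨⟨-, h₁⟩, -, h₂⟩ := hn m hm
    rw [h₁] at h₂
    simp [Finset.sum_range_succ] at h₂
    linarith
  have hc : ∀ m : ℕ, (m + 1 + 2).choose 2 = (m + 2).choose 2 + (m + 2) := by
    intro m
    rw [show m + 1 + 2 = (m + 2) + 1 from by ring, Nat.choose_succ_succ' (m + 2) 1,
      Nat.choose_one_right]
    ring
  have h₀ := key n le_rfl
  have h₁ := key (n + 1) (by omega)
  have h₂ := key (n + 1 + 1) (by omega)
  have c₁ := hc n
  have c₂ := hc (n + 1)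
  rw [c₂, c₁] at h₂
  rw [c₁] at h₁
  push_cast at h₀ h₁ h₂
  have z₀ : e 0 - e' 0 = 0 := by linear_combination h₂ - 2 * h₁ + h₀
  rw [z₀] at h₀ h₁
  have z₁ : e 1 - e' 1 = 0 := by linear_combination h₀ - h₁
  exact ⟨sub_eq_zero.1 z₀, sub_eq_zero.1 z₁⟩

lemma hilbertCoeff_spec {I : Ideal R} (hdim : ringKrullDim R = 2) {e : ℕ → ℤ}
    (h : HasHilbertCoeffs I 2 e) :
    HasHilbertCoeffs I 2 (hilbertCoeff I) ∧ hilbertCoeff I 0 = e 0 ∧ hilbertCoeff I 1 = e 1 := by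
  have hd : dimNat R = 2 := by rw [dimNat, hdim]; rfl
  have hex : ∃ e : ℕ → ℤ, HasHilbertCoeffs I (dimNat R) e := ⟨e, hd ▸ h⟩
  have h2 : HasHilbertCoeffs I 2 (hilbertCoeff I) := by
    have : hilbertCoeff I = hex.choose := by
      funext i
      rw [hilbertCoeff, dif_pos hex]
    rw [this]
    have hspec := hex.choose_spec
    generalize hex.choose = e' at hspec ⊢
    rwa [hd] at hspec
  exact ⟨h2, hasHilbertCoeffs_two_unique h2 h⟩

end Hilbert

variable {R : Type u} [CommRing R] {S : Type v} [AddCommGroup S] [Module R S]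
variable {x y : R} {N : Submodule R S}

lemma relLength_smul_range (j : R →ₗ[R] S) (hj : Function.Injective j) (I : Ideal R) :
    relLength (I • LinearMap.range j) (LinearMap.range j) = Module.length R (R ⧸ I) := by
  have hI : I • LinearMap.range j = Submodule.map j I := by
    rw [← Submodule.map_top, ← Submodule.map_smul'']
    congr 1
    simp
  rw [← relLength_top, hI]
  refine (relLength_eq_of_map j ?_ ?_).symm
  · rw [← Submodule.map_top]
    exact (sup_eq_left.2 (Submodule.map_mono le_top)).symm
  · rw [Submodule.comap_map_eq_of_injective hj, top_inf_eq]

/-- Two-term arithmetic progressions with bounded defect. -/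
lemma exists_linear_of_antitone (q k : ℕ → ℕ) (a : ℕ) (h : ∀ n, q (n + 1) + k n = q n + a)
    (hk : Antitone k) :
    ∃ (k₀ : ℕ) (c : ℤ) (n₀ : ℕ), ∀ n ≥ n₀, k n = k₀ ∧ (q n : ℤ) = ((a : ℤ) - k₀) * n + c := by
  obtain ⟨n₀, hn₀⟩ : ∃ n₀, ∀ n ≥ n₀, k n = k n₀ := by
    have hne : (Set.range k).Nonempty := ⟨_, 0, rfl⟩
    obtain ⟨n₀, hn₀⟩ := Nat.sInf_mem hne
    refine ⟨n₀, fun n hn => le_antisymm (hk hn) ?_⟩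
    rw [hn₀]
    exact Nat.sInf_le ⟨n, rfl⟩
  refine ⟨k n₀, q n₀ - ((a : ℤ) - k n₀) * n₀, n₀, fun n hn => ⟨hn₀ n hn, ?_⟩⟩
  induction n, hn using Nat.le_induction with
  | base => ring
  | succ n hn ih =>
    have h1 := h n
    rw [hn₀ n hn] at h1
    have h2 : (q (n + 1) : ℤ) + k n₀ = q n + a := by exact_mod_cast h1
    push_cast
    linear_combination h2 + ih

/-- The Hilbert function of the ideal `(x, y)` of `R` when `R` embeds into a module `S` on which
`x, y` is a regular sequence, with cokernel of finite length. -/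
theorem exists_hilbertCoeffs (h : IsRegularPair x y S) (j : R →ₗ[R] S)
    (hj : Function.Injective j) (hN : relLength (LinearMap.range j) ⊤ ≠ ⊤)
    (hR : ∀ n, Module.length R (R ⧸ Ideal.span {x, y} ^ n) ≠ ⊤) :
    ∃ e : ℕ → ℤ, HasHilbertCoeffs (Ideal.span {x, y}) 2 e ∧
      relLength (Ideal.span {x, y} • (⊤ : Submodule R S)) ⊤ ≠ ⊤ ∧
      e 0 = (relLength (Ideal.span {x, y} • (⊤ : Submodule R S)) ⊤).toNat ∧
      (relLength (LinearMap.range j ⊔ Ideal.span {x, y} • (⊤ : Submodule R S)) ⊤).toNat + e 1 ≤ 0 ∧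
      ((∀ᶠ n in Filter.atTop, mulKernel x y (LinearMap.range j) n ≤
          Ideal.span {x, y} ^ n • LinearMap.range j) →
        e 1 = - ((relLength (LinearMap.range j ⊔
          (⊤ : Submodule R S).map (LinearMap.lsmul R S x)) ⊤).toNat : ℤ)) ∧
      (Ideal.span {x, y} • (⊤ : Submodule R S) ≤ LinearMap.range j →
        e 1 = - ((relLength (LinearMap.range j ⊔
          Ideal.span {x, y} • (⊤ : Submodule R S)) ⊤).toNat : ℤ) ∧
        (Module.length R (R ⧸ Ideal.span {x, y})).toNat - e 0 =
          ((relLength (LinearMap.range j) ⊤).toNat : ℤ)) := by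
  set N := LinearMap.range j
  set Q := Ideal.span {x, y}
  have hle : ∀ n, Q ^ n • N ≤ N := fun n => Submodule.smul_le_right
  have hQle : ∀ n, Q ^ n • N ≤ Q ^ n • (⊤ : Submodule R S) := fun n => ideal_smul_mono _ le_top
  have eRN : ∀ n, relLength (Q ^ n • N) N = Module.length R (R ⧸ Q ^ n) := fun n =>
    relLength_smul_range j hj _
  have e1 : ∀ n, relLength (Q ^ n • N) ⊤ = relLength (Q ^ n • N) N + relLength N ⊤ := fun n =>
    relLength_add (hle n) le_top
  have e2 : ∀ n, relLength (Q ^ n • N) ⊤ = relLength (Q ^ n • N) (Q ^ n • ⊤) +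
      ((n + 1).choose 2 : ℕ) * relLength (Q • (⊤ : Submodule R S)) ⊤ := fun n => by
    rw [relLength_add (hQle n) le_top, relLength_pow h n]
  have ft : ∀ n, relLength (Q ^ n • N) ⊤ ≠ ⊤ := fun n => by
    rw [e1, eRN]; exact WithTop.add_ne_top.2 ⟨hR n, hN⟩
  have fq : ∀ n, relLength (Q ^ n • N) (Q ^ n • ⊤) ≠ ⊤ := fun n hn => ft n (by
    rw [e2, hn, top_add])
  have fe : relLength (Q • (⊤ : Submodule R S)) ⊤ ≠ ⊤ := fun hn => ft 1 (by
    rw [e2, hn]; simp)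
  have e3 : ∀ n, relLength (Q ^ n • N) (Q ^ n • ⊤) = relLength (colonBoth x y N n) (colonLeft x N) +
      relLength (mulKernel x y N n) (Q ^ n • ⊤) := fun n => by
    rw [relLength_add (le_mulKernel N n) inf_le_left, relLength_mulKernel N h n]
  have e4 : ∀ n, relLength (Q ^ (n + 1) • N) (Q ^ (n + 1) • ⊤) =
      relLength (mulKernel x y N n) (Q ^ n • ⊤) +
        relLength (N ⊔ (⊤ : Submodule R S).map (LinearMap.lsmul R S x)) ⊤ := fun n =>
    relLength_span_pow_succ N h n
  have fk : ∀ n, relLength (colonBoth x y N n) (colonLeft x N) ≠ ⊤ := fun n hn => fq n (by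
    rw [e3, hn, top_add])
  have fm : ∀ n, relLength (mulKernel x y N n) (Q ^ n • ⊤) ≠ ⊤ := fun n hn => fq n (by
    rw [e3, hn, add_top])
  have fa : relLength (N ⊔ (⊤ : Submodule R S).map (LinearMap.lsmul R S x)) ⊤ ≠ ⊤ := fun hn =>
    fq 1 (by rw [e4, hn, add_top])
  have e5 : ∀ n, relLength (Q ^ n • N) (Q ^ n • ⊤) =
      relLength (Q ^ n • N) (Q ^ n • N ⊔ Q ^ (n + 1) • ⊤) +
        (n + 1 : ℕ) * relLength (N ⊔ Q • ⊤) ⊤ := fun n => by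
    rw [relLength_add (B := Q ^ n • N ⊔ Q ^ (n + 1) • ⊤) le_sup_left
      (sup_le (hQle n) (span_pair_pow_succ_smul_le _ _)), relLength_graded N h n]
  have fs : ∀ n, relLength (Q ^ n • N) (Q ^ n • N ⊔ Q ^ (n + 1) • ⊤) ≠ ⊤ := fun n hn => fq n (by
    rw [e5, hn, top_add])
  have fg : relLength (N ⊔ Q • (⊤ : Submodule R S)) ⊤ ≠ ⊤ := fun hn => fq 0 (by
    rw [e5, hn]; simp)
  -- pass to natural numbers
  obtain ⟨q, hq⟩ : ∃ q : ℕ → ℕ, ∀ n, relLength (Q ^ n • N) (Q ^ n • ⊤) = q n :=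
    ⟨_, fun n => (ENat.natCast_toNat (fq n)).symm⟩
  obtain ⟨k, hk⟩ : ∃ k : ℕ → ℕ, ∀ n, relLength (colonBoth x y N n) (colonLeft x N) = k n :=
    ⟨_, fun n => (ENat.natCast_toNat (fk n)).symm⟩
  obtain ⟨w, hw⟩ : ∃ w : ℕ → ℕ, ∀ n, relLength (mulKernel x y N n) (Q ^ n • ⊤) = w n :=
    ⟨_, fun n => (ENat.natCast_toNat (fm n)).symm⟩
  obtain ⟨r, hr⟩ : ∃ r : ℕ → ℕ, ∀ n, relLength (Q ^ n • N) (Q ^ n • N ⊔ Q ^ (n + 1) • ⊤) = r n :=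
    ⟨_, fun n => (ENat.natCast_toNat (fs n)).symm⟩
  obtain ⟨l, hl⟩ : ∃ l : ℕ → ℕ, ∀ n, Module.length R (R ⧸ Q ^ n) = l n :=
    ⟨_, fun n => (ENat.natCast_toNat (hR n)).symm⟩
  obtain ⟨ε, hε⟩ : ∃ ε : ℕ, relLength (Q • (⊤ : Submodule R S)) ⊤ = ε :=
    ⟨_, (ENat.natCast_toNat fe).symm⟩
  obtain ⟨a, ha⟩ : ∃ a : ℕ, relLength (N ⊔ (⊤ : Submodule R S).map (LinearMap.lsmul R S x)) ⊤ = a :=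
    ⟨_, (ENat.natCast_toNat fa).symm⟩
  obtain ⟨g, hg⟩ : ∃ g : ℕ, relLength (N ⊔ Q • (⊤ : Submodule R S)) ⊤ = g :=
    ⟨_, (ENat.natCast_toNat fg).symm⟩
  obtain ⟨η, hη⟩ : ∃ η : ℕ, relLength N ⊤ = η := ⟨_, (ENat.natCast_toNat hN).symm⟩
  have i1 : ∀ n, l n + η = q n + (n + 1).choose 2 * ε := fun n => by
    have := (e1 n).symm.trans (e2 n)
    rw [eRN, hl, hη, hq, hε] at this
    exact_mod_cast this
  have i3 : ∀ n, q n = k n + w n := fun n => by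
    have := e3 n; rw [hq, hk, hw] at this; exact_mod_cast this
  have i4 : ∀ n, q (n + 1) = w n + a := fun n => by
    have := e4 n; rw [hq, hw, ha] at this; exact_mod_cast this
  have i5 : ∀ n, q n = r n + (n + 1) * g := fun n => by
    have := e5 n; rw [hq, hr, hg] at this; exact_mod_cast this
  have hmono : Antitone k := antitone_nat_of_succ_le fun n => by
    have hle : colonBoth x y N n ≤ colonBoth x y N (n + 1) := colonBoth_mono x y N n.le_succ
    have := relLength_add hle (inf_le_left : colonBoth x y N (n + 1) ≤ colonLeft x N)
    rw [hk, hk] at this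
    have h2 : (k (n + 1) : ℕ∞) ≤ k n := this ▸ le_add_self
    exact_mod_cast h2
  -- Eliminating w from `i3` and `i4` gives q(n+1) + k(n) = q(n) + a, so q(n) = (a − k₀) n + c for
  -- large n.
  obtain ⟨k₀, c, n₀, hlin⟩ := exists_linear_of_antitone q k a
    (fun n => by rw [i4, i3]; ring) hmono
  -- By `i1`, ℓ(R/Qⁿ⁺¹) = C(n+2,2) ε + q(n+1) − η, from which e₀ = ε, e₁ = k₀ − a and e₂ = c − η are
  -- read off.
  refine ⟨fun i => if i = 0 then (ε : ℤ) else if i = 1 then (k₀ : ℤ) - a else c - η, ?_, fe, ?_, ?_,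
    ?_, ?_⟩
  · refine Filter.eventually_atTop.2 ⟨n₀, fun n hn => ⟨Module.length_ne_top_iff.1 (hR _), ?_⟩⟩
    have h1 : (l (n + 1) : ℤ) + η = q (n + 1) + ((n + 1 + 1).choose 2 : ℕ) * ε := by
      exact_mod_cast i1 (n + 1)
    rw [(hlin (n + 1) (by omega)).2] at h1
    simp only [lengthInt, hl, ENat.toNat_natCast, Finset.sum_range_succ, Finset.sum_range_zero]
    simp
    push_cast at h1
    linear_combination h1
  · simp [hε]
  · simp only [hg, ENat.toNat_natCast]
    simp
    -- Since q(n) ≥ (n+1) g, the slope a − k₀ is at least g; a violation would already appear at an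
    -- n ≥ n₀ exceeding c.
    by_contra hcon
    push Not at hcon
    have key : ∀ n ≥ n₀, ((n : ℤ) + 1) * g ≤ ((a : ℤ) - k₀) * n + c := fun n hn => by
      rw [← (hlin n hn).2, i5 n]; push_cast
      have : (0 : ℤ) ≤ r n := by positivity
      linarith
    have h1 := key (n₀ + c.toNat + 1) (by omega)
    push_cast at h1
    have hc : c ≤ c.toNat := Int.self_le_toNat c
    have hpos : (0 : ℤ) ≤ n₀ + c.toNat + 1 := by positivity
    have hgn : (0 : ℤ) ≤ g := by positivity
    nlinarith
  · intro hev
    simp only [ha, ENat.toNat_natCast]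
    simp
    obtain ⟨n₁, hn₁⟩ := Filter.eventually_atTop.1 hev
    set n := max n₀ n₁
    have hkn := (hlin n (le_max_left _ _)).1
    -- A vanishing kernel means k(n) = 0, hence k₀ = 0 and e₁ = −a.
    have : relLength (Q ^ n • N) (mulKernel x y N n) = 0 := by
      rw [le_antisymm (hn₁ n (le_max_right _ _)) (le_mulKernel N n), relLength_self]
    rw [relLength_mulKernel N h n, hk, hkn] at this
    exact_mod_cast this
  · intro hQN
    -- Here Qⁿ⁺¹S ⊆ QⁿN, so q(n) = (n+1) g exactly: the slope is g, and `i1` at n = 1 gives the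
    -- remaining equality.
    have hr0 : ∀ n, r n = 0 := fun n => by
      have : Q ^ n • N ⊔ Q ^ (n + 1) • (⊤ : Submodule R S) = Q ^ n • N := by
        rw [sup_eq_left, pow_succ, mul_smul]
        exact ideal_smul_mono _ hQN
      have h2 := hr n
      rw [this, relLength_self] at h2
      exact_mod_cast h2.symm
    have hgη : g = η := by
      rw [sup_eq_left.2 hQN, hη] at hg
      exact_mod_cast hg.symm
    constructor
    · simp only [hg, ENat.toNat_natCast]
      simp
      have h1 := (hlin n₀ le_rfl).2
      have h2 := (hlin (n₀ + 1) (by omega)).2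
      rw [i5, hr0] at h1 h2
      push_cast at h1 h2
      linear_combination h2 - h1
    · have h1 := i1 1
      rw [i5, hr0] at h1
      have hl1 := hl 1
      rw [pow_one] at hl1
      rw [hl1, hη]
      simp
      norm_num at h1
      rw [← hgη] at h1 ⊢
      have : (l 1 : ℤ) + g = 2 * g + ε := by exact_mod_cast h1
      linear_combination this

end ParameterPair

/-! ### The ideal transform as S, and the theorem when S is finite over R. -/

namespace ParameterPair

open RelativeLength LocalCohomologyOne

lemma isFiniteLength_quotient_of_pow_le {R : Type u} [CommRing R] [IsLocalRing R]
    [IsNoetherianRing R] {I : Ideal R} {n : ℕ} (hI : maximalIdeal R ^ n ≤ I) :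
    Module.length R (R ⧸ I) ≠ ⊤ := by
  by_cases htop : I = ⊤
  · have : Subsingleton (R ⧸ I) := Ideal.Quotient.subsingleton_iff.2 htop
    simp
  have : IsArtinianRing (R ⧸ I) := by
    refine IsLocalRing.quotient_artinian_of_mem_minimalPrimes_of_isLocalRing I
      ⟨⟨inferInstance, le_maximalIdeal htop⟩, fun P hP _ => ?_⟩
    have := hP.1
    exact Ideal.IsPrime.le_of_pow_le (hI.trans hP.2)
  rw [Module.length_eq_of_surjective (R := R ⧸ I) (S := R) Ideal.Quotient.mk_surjective]
  exact Module.length_ne_top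

lemma length_ne_top_of_smul_eq_zero {R : Type u} [CommRing R] {I : Ideal R}
    (hI : Module.length R (R ⧸ I) ≠ ⊤) {M : Type v} [AddCommGroup M] [Module R M]
    [Module.Finite R M] (hM : ∀ a ∈ I, ∀ m : M, a • m = 0) : Module.length R M ≠ ⊤ := by
  obtain ⟨n, f, hf⟩ := Module.Finite.exists_fin' R M
  have hfl : IsFiniteLength R (Fin n → R ⧸ I) := by
    rw [← Module.length_ne_top_iff, Module.length_pi_of_fintype]
    rw [Finset.sum_const, nsmul_eq_mul]
    exact WithTop.mul_ne_top (ENat.natCast_ne_top _) hI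
  let g : (Fin n → R) →ₗ[R] (Fin n → R ⧸ I) := LinearMap.compLeft I.mkQ (Fin n)
  have hg : Function.Surjective g := fun z => by
    choose w hw using fun i => Submodule.mkQ_surjective I (z i)
    exact ⟨w, funext hw⟩
  have hker : LinearMap.ker g ≤ LinearMap.ker f := by
    intro w hw
    have hw' : ∀ i, w i ∈ I := fun i => by
      have := congrFun hw i
      exact (Submodule.Quotient.mk_eq_zero I).1 this
    rw [LinearMap.mem_ker, LinearMap.pi_apply_eq_sum_univ f w]
    exact Finset.sum_eq_zero fun i _ => hM _ (hw' i) _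
  let e := LinearMap.quotKerEquivOfSurjective g hg
  let f' : (Fin n → R ⧸ I) →ₗ[R] M := (LinearMap.ker g).liftQ f hker ∘ₗ e.symm.toLinearMap
  have hf' : Function.Surjective f' := fun m => by
    obtain ⟨w, rfl⟩ := hf m
    refine ⟨g w, ?_⟩
    have : e.symm (g w) = Submodule.Quotient.mk w := by
      rw [LinearEquiv.symm_apply_eq]; rfl
    change (LinearMap.ker g).liftQ f hker (e.symm (g w)) = _
    rw [this]
    rfl
  exact Module.length_ne_top_iff.2 (hfl.of_surjective hf')

section Transform

variable {R : Type u} [CommRing R] {x y : R}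

/-- The inclusion of `R` into its ideal transform. -/
def toTransform (x y : R) : R →ₗ[R] idealTransform x y :=
  (Algebra.linearMap R (FractionRing R)).codRestrict _ fun r =>
    one_le_idealTransform x y (Submodule.algebraMap_mem r)

lemma toTransform_injective (x y : R) : Function.Injective (toTransform x y) := fun _ _ h =>
  IsFractionRing.injective R (FractionRing R) (congrArg Subtype.val h)

lemma mem_range_toTransform {s : idealTransform x y} :
    s ∈ LinearMap.range (toTransform x y) ↔
      (s : FractionRing R) ∈ (1 : Submodule R (FractionRing R)) := by
  rw [Submodule.mem_one]
  exact ⟨fun ⟨r, hr⟩ => ⟨r, congrArg Subtype.val hr⟩, fun ⟨r, hr⟩ => ⟨r, Subtype.ext hr⟩⟩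

lemma range_toTransform (x y : R) : LinearMap.range (toTransform x y) =
    (1 : Submodule R (FractionRing R)).submoduleOf (idealTransform x y) :=
  Submodule.ext fun _ => mem_range_toTransform

/-- The fraction v = t/x satisfies x v = t and y v = s, so a power of x and a power of y carry it
into R, which is membership in the ideal transform. -/
lemma isRegularPair_idealTransform (hx : x ∈ nonZeroDivisors R) :
    IsRegularPair x y (idealTransform x y) := by
  refine ⟨fun s hs => Subtype.ext (smul_fractionRing_injective hx ?_), fun s t hst => ?_⟩
  · rw [Submodule.coe_zero, smul_zero]; exact congrArg Subtype.val hs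
  · have hst' : x • (s : FractionRing R) = y • (t : FractionRing R) := congrArg Subtype.val hst
    obtain ⟨v, hv⟩ := exists_smul_eq hx (t : FractionRing R)
    have hv' : y • v = s := by
      apply smul_fractionRing_injective hx
      rw [smul_comm, hv, hst']
    obtain ⟨n, hn, -⟩ := t.2
    obtain ⟨m, -, hm⟩ := s.2
    refine ⟨⟨v, n + m + 1, ?_, ?_⟩, Subtype.ext hv.symm⟩
    · rw [show n + m + 1 = m + n + 1 by ring, pow_succ, mul_smul, hv, pow_add, mul_smul]
      exact Submodule.smul_mem _ _ hn
    · rw [pow_succ, mul_smul, hv', pow_add, mul_smul]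
      exact Submodule.smul_mem _ _ hm

lemma IsRegularPair.pow_left {S : Type v} [AddCommGroup S] [Module R S]
    (h : IsRegularPair x y S) (n : ℕ) : IsRegularPair (x ^ n) y S := by
  have hreg : ∀ n : ℕ, ∀ s : S, x ^ n • s = 0 → s = 0 := by
    intro n
    induction n with
    | zero => intro s hs; simpa using hs
    | succ n ih => intro s hs; rw [pow_succ, mul_smul] at hs; exact h.1 _ (ih _ hs)
  refine ⟨hreg n, ?_⟩
  induction n with
  | zero => intro s t _; exact ⟨t, by simp⟩
  | succ n ih =>
    intro s t hst
    rw [pow_succ', mul_smul] at hst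
    obtain ⟨v, rfl⟩ := h.2 _ _ hst
    have : x ^ n • s = y • v := by
      rw [← sub_eq_zero]
      apply h.1
      rw [smul_sub, hst, smul_comm, sub_self]
    obtain ⟨w, rfl⟩ := ih _ _ this
    exact ⟨w, by rw [pow_succ', mul_smul]⟩

/-- The limit closure of `(x, y)` is the contraction of the extension of `(x, y)` to the ideal
transform. -/
lemma limitClosure_eq_comap (hx : x ∈ nonZeroDivisors R) :
    limitClosure ![x, y] = (Ideal.span {x, y} • (⊤ : Submodule R (idealTransform x y))).comap
      (toTransform x y) := by
  have hmem : ∀ a, a ∈ limitClosure ![x, y] ↔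
      ∃ n : ℕ, ∃ b c : R, a * (x * y) ^ n = b * x ^ (n + 1) + c * y ^ (n + 1) := by
    intro a
    change (∃ n : ℕ, a * (∏ i, ![x, y] i) ^ n ∈
      Ideal.span (Set.range fun i => ![x, y] i ^ (n + 1))) ↔ _
    refine exists_congr fun n => ?_
    have : (Set.range fun i => ![x, y] i ^ (n + 1)) = {x ^ (n + 1), y ^ (n + 1)} := by
      ext z; simp [Set.mem_range, Fin.exists_fin_two, eq_comm]
    rw [this, Ideal.mem_span_pair]
    simp [Fin.prod_univ_two, eq_comm]
  ext a
  rw [hmem, Submodule.mem_comap, mem_span_pair_smul]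
  have hreg := isRegularPair_idealTransform (y := y) hx
  have hinjx : ∀ s : idealTransform x y, ∀ n : ℕ, x ^ n • s = 0 → s = 0 := fun s n =>
    (hreg.pow_left n).1 s
  constructor
  · rintro ⟨n, b, c, h⟩
    -- Two Koszul relations, first for xⁿ and yⁿ⁺¹, then for x and yⁿ, strip off the factor (xy)ⁿ
    -- and leave a = x w + y v.
    have h' : x ^ n • (y ^ n • toTransform x y a - x • toTransform x y b) =
        y ^ (n + 1) • toTransform x y c := by
      simp only [← map_smul, ← map_sub, smul_eq_mul]
      congr 1
      linear_combination h
    obtain ⟨v, hv, hv'⟩ := (hreg.pow_left n).exists_of_smul_eq_pow _ h'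
    have h'' : x • toTransform x y b = y ^ n • (toTransform x y a - y • v) := by
      rw [smul_sub, smul_smul, ← pow_succ, ← hv']; abel
    obtain ⟨w, hw, -⟩ := hreg.exists_of_smul_eq_pow _ h''
    exact ⟨w, trivial, v, trivial, by rw [← hw]; abel⟩
  · rintro ⟨s, -, t, -, h⟩
    obtain ⟨n, -, hn⟩ := s.2
    obtain ⟨m, hm, -⟩ := t.2
    obtain ⟨b, hb⟩ := mem_range_toTransform.2 (show (↑(y ^ n • s) : FractionRing R) ∈ _ from hn)
    obtain ⟨c, hc⟩ := mem_range_toTransform.2 (show (↑(x ^ m • t) : FractionRing R) ∈ _ from hm)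
    -- Multiplying a = x s + y t by (xy)ⁿ⁺ᵐ exposes yⁿ s = b and xᵐ t = c, both in R; the cofactors
    -- are what is left over.
    refine ⟨n + m, b * y ^ m, c * x ^ n, toTransform_injective x y ?_⟩
    have e₁ : toTransform x y (a * (x * y) ^ (n + m)) = (x * y) ^ (n + m) • toTransform x y a := by
      rw [← map_smul, smul_eq_mul, mul_comm]
    have e₂ : toTransform x y (b * y ^ m * x ^ (n + m + 1) + c * x ^ n * y ^ (n + m + 1)) =
        (y ^ m * x ^ (n + m + 1)) • toTransform x y b +
          (x ^ n * y ^ (n + m + 1)) • toTransform x y c := by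
      rw [← map_smul, ← map_smul, ← map_add]; congr 1; simp only [smul_eq_mul]; ring
    rw [e₁, e₂, hb, hc, h, smul_add, smul_smul, smul_smul, smul_smul, smul_smul]
    congr 2 <;> ring

end Transform

section LocalRing

lemma range_pair {α : Type*} (a b : α) : Set.range ![a, b] = {a, b} := by
  rw [Matrix.range_cons, Matrix.range_cons, Matrix.range_empty, Set.union_empty]
  rfl

/-- Multiplication by xᵏ embeds S into R, so S is Noetherian. The submodules {s : yᵐ s ∈ R} then
increase to S and stabilise. -/
lemma exists_uniform_pow {R : Type u} [CommRing R] [IsNoetherianRing R] {x y : R} (hx : x ∈ nonZeroDivisors R)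
    (hfin : ∃ k : ℕ, ∀ s : idealTransform x y,
      x ^ k • s ∈ LinearMap.range (toTransform x y)) :
    Module.Finite R (idealTransform x y) ∧ ∃ k : ℕ, ∀ s : idealTransform x y,
      x ^ k • s ∈ LinearMap.range (toTransform x y) ∧
      y ^ k • s ∈ LinearMap.range (toTransform x y) := by
  obtain ⟨k, hk⟩ := hfin
  have hreg := (isRegularPair_idealTransform (y := y) hx).pow_left k
  let f : idealTransform x y →ₗ[R] LinearMap.range (toTransform x y) :=
    (LinearMap.lsmul R _ (x ^ k)).codRestrict _ hk
  have hf : Function.Injective f := by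
    rw [injective_iff_map_eq_zero]
    intro s hs
    exact hreg.1 s (congrArg Subtype.val hs)
  have hnoeth : IsNoetherian R (idealTransform x y) := isNoetherian_of_injective f hf
  have hfinite : Module.Finite R (idealTransform x y) := inferInstance
  refine ⟨hfinite, ?_⟩
  have hy : ∃ m : ℕ, ∀ s : idealTransform x y, y ^ m • s ∈ LinearMap.range (toTransform x y) := by
    let U : ℕ →o Submodule R (idealTransform x y) :=
      ⟨fun m => (LinearMap.range (toTransform x y)).comap (LinearMap.lsmul R _ (y ^ m)), by
        intro m m' hm s hs
        obtain ⟨d, rfl⟩ := Nat.exists_eq_add_of_le hm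
        change y ^ (m + d) • s ∈ LinearMap.range (toTransform x y)
        rw [add_comm, pow_add, mul_smul]
        exact Submodule.smul_mem _ _ hs⟩
    obtain ⟨m, hm⟩ := monotone_stabilizes_iff_noetherian.2 hnoeth U
    refine ⟨m, fun s => ?_⟩
    obtain ⟨n, -, hn⟩ := s.2
    have h₁ : s ∈ U n := mem_range_toTransform.2 hn
    have h₂ : s ∈ U (max m n) := U.2 (le_max_right _ _) h₁
    rw [← hm _ (le_max_left _ _)] at h₂
    exact h₂
  obtain ⟨m, hm⟩ := hy
  refine ⟨k + m, fun s => ⟨?_, ?_⟩⟩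
  · rw [add_comm, pow_add, mul_smul]; exact Submodule.smul_mem _ _ (hk s)
  · rw [pow_add, mul_smul]; exact Submodule.smul_mem _ _ (hm s)

/-- Lengths of quotients of the first local cohomology module in terms of the ideal transform. -/
lemma length_H1mQuot {R : Type u} [CommRing R] [IsLocalRing R] {x y : R} (e : H1m R ≃ₗ[R] TransformQuotient x y) (I : Ideal R) :
    Module.length R (H1mQuot R I) =
      relLength (LinearMap.range (toTransform x y) ⊔ I • ⊤) ⊤ := by
  have h₁ : Module.length R (H1mQuot R I) = Module.length R (TransformQuotient x y ⧸
      (I • ⊤ : Submodule R (TransformQuotient x y))) := by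
    refine (Submodule.Quotient.equiv _ _ e ?_).length_eq
    rw [Submodule.map_smul'', Submodule.map_top]
    exact congrArg (I • ·) (LinearMap.range_eq_top.2 e.surjective)
  rw [h₁, ← relLength_top, range_toTransform]
  refine (relLength_eq_of_map (Submodule.mkQ _) ?_ ?_).symm
  · rw [Submodule.map_top, Submodule.range_mkQ, top_sup_eq]
  · rw [top_inf_eq, ← Submodule.comap_map_mkQ, Submodule.map_smul'', Submodule.map_top,
      Submodule.range_mkQ]

variable {R : Type u} [CommRing R] [IsLocalRing R] [IsNoetherianRing R] {x y : R}

lemma exists_pow_maximalIdeal_le (hrad : (Ideal.span {x, y}).radical = maximalIdeal R) (n m : ℕ) :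
    ∃ t : ℕ, maximalIdeal R ^ t ≤ Ideal.span {x ^ n, y ^ n} ^ m := by
  refine Ideal.exists_pow_le_of_le_radical_of_fg ?_ (IsNoetherian.noetherian _)
  rcases eq_or_ne m 0 with rfl | hm
  · simp [Ideal.radical_top]
  rcases eq_or_ne n 0 with rfl | hn
  · simp [Ideal.radical_top, Ideal.span_singleton_one, Ideal.top_pow]
  rw [Ideal.radical_pow _ hm, ← hrad]
  refine (Ideal.radical_le_radical_iff).2 (Ideal.span_le.2 ?_)
  rintro z (rfl | rfl)
  · exact ⟨n, Ideal.subset_span (by simp)⟩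
  · exact ⟨n, Ideal.subset_span (by simp)⟩

lemma length_quotient_span_pow_ne_top (hrad : (Ideal.span {x, y}).radical = maximalIdeal R)
    (n m : ℕ) : Module.length R (R ⧸ Ideal.span {x ^ n, y ^ n} ^ m) ≠ ⊤ := by
  obtain ⟨t, ht⟩ := exists_pow_maximalIdeal_le hrad n m
  exact isFiniteLength_quotient_of_pow_le ht

/-- The main statement, assuming that the ideal transform is finite over `R`. -/
theorem main_of_finite (hdim : ringKrullDim R = 2)
    (hrad : (Ideal.span {x, y}).radical = maximalIdeal R)
    (hx : x ∈ nonZeroDivisors R)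
    (hfin : ∃ k : ℕ, ∀ s : idealTransform x y,
      x ^ k • s ∈ LinearMap.range (toTransform x y))
    (Q : Ideal R) (hQ : Q = Ideal.span {x, y}) :
    HasHilbertCoeffs Q 2 (hilbertCoeff Q) ∧
    IsFiniteLength R (R ⧸ limitClosure ![x, y]) ∧
    IsFiniteLength R (H1mQuot R Q) ∧
    hilbertCoeff Q 0 - lengthInt R (R ⧸ limitClosure ![x, y]) = lengthInt R (H1mQuot R Q) ∧
    (IsSuperficial Q x →
      IsFiniteLength R (H1mQuot R (Ideal.span {x})) ∧
      hilbertCoeff Q 0 - lengthInt R (R ⧸ limitClosure ![x, y]) + hilbertCoeff Q 1 =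
        lengthInt R (H1mQuot R Q) - lengthInt R (H1mQuot R (Ideal.span {x}))) ∧
    hilbertCoeff Q 0 - lengthInt R (R ⧸ limitClosure ![x, y]) + hilbertCoeff Q 1 ≤ 0 ∧
    (Q • (⊤ : Submodule R (H1m R)) = ⊥ →
      IsStandardParameters ![x, y] ∧
      hilbertCoeff Q 0 - lengthInt R (R ⧸ limitClosure ![x, y]) + hilbertCoeff Q 1 = 0) := by
  subst hQ
  set Q := Ideal.span {x, y} with hQdef
  have hxm : x ∈ maximalIdeal R := hrad ▸ Ideal.le_radical (Ideal.subset_span (by simp))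
  have hym : y ∈ maximalIdeal R := hrad ▸ Ideal.le_radical (Ideal.subset_span (by simp))
  obtain ⟨ε⟩ := nonempty_localCohomology_one_equiv (y := y) (maximalIdeal R) hx hxm hym
    (fun n => by simpa using exists_pow_maximalIdeal_le hrad n 1)
  have ε : H1m R ≃ₗ[R] TransformQuotient x y := ε
  obtain ⟨hfinite, k, hk⟩ := exists_uniform_pow hx hfin
  have hreg : IsRegularPair x y (idealTransform x y) := isRegularPair_idealTransform hx
  set j := toTransform x y
  have hj : Function.Injective j := toTransform_injective x y
  set N := LinearMap.range j
  have hRn : ∀ n, Module.length R (R ⧸ Q ^ n) ≠ ⊤ := fun n => by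
    have := length_quotient_span_pow_ne_top hrad 1 n
    rwa [pow_one, pow_one] at this
  have hkill : ∀ a ∈ Ideal.span {x ^ k, y ^ k}, ∀ s : idealTransform x y, a • s ∈ N := by
    intro a ha s
    obtain ⟨b, c, rfl⟩ := Ideal.mem_span_pair.1 ha
    rw [add_smul, mul_smul, mul_smul]
    exact add_mem (Submodule.smul_mem _ _ (hk s).1) (Submodule.smul_mem _ _ (hk s).2)
  have hNtop : relLength N ⊤ ≠ ⊤ := by
    rw [relLength_top]
    refine length_ne_top_of_smul_eq_zero (I := Ideal.span {x ^ k, y ^ k})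
      (by have := length_quotient_span_pow_ne_top hrad k 1; rwa [pow_one] at this) ?_
    intro a ha m
    obtain ⟨s, rfl⟩ := Submodule.Quotient.mk_surjective _ m
    rw [← Submodule.Quotient.mk_smul, Submodule.Quotient.mk_eq_zero]
    exact hkill a ha s
  have hsub : ∀ A : Submodule R (idealTransform x y), relLength (N ⊔ A) ⊤ ≠ ⊤ := fun A h => by
    have := relLength_add (le_sup_left : N ≤ N ⊔ A) le_top
    rw [h, add_top] at this
    exact hNtop this
  obtain ⟨e, he, hS, he0, he1, hsup, hzero⟩ := exists_hilbertCoeffs hreg j hj hNtop hRn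
  obtain ⟨hh, h0, h1⟩ := hilbertCoeff_spec hdim he
  -- the limit closure
  have hlim : Module.length R (R ⧸ limitClosure ![x, y]) =
      relLength (Q • (⊤ : Submodule R (idealTransform x y))) (N ⊔ Q • ⊤) := by
    rw [← relLength_top, limitClosure_eq_comap hx]
    refine relLength_eq_of_map j ?_ (top_inf_eq _).symm
    rw [Submodule.map_top]
  have hadd := relLength_add (le_sup_right : Q • (⊤ : Submodule R (idealTransform x y)) ≤ N ⊔ Q • ⊤)
    le_top
  have hHQ := length_H1mQuot ε Q
  have hHx := length_H1mQuot ε (Ideal.span {x})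
  have hxS : Ideal.span {x} • (⊤ : Submodule R (idealTransform x y)) =
      (⊤ : Submodule R (idealTransform x y)).map (LinearMap.lsmul R _ x) := by
    rw [Submodule.ideal_span_singleton_smul]; rfl
  have hlimtop : Module.length R (R ⧸ limitClosure ![x, y]) ≠ ⊤ := by
    rw [hlim]
    intro h
    rw [h, top_add] at hadd
    exact hS hadd
  -- As R/Q^lim ≅ (R + QS)/QS, the chain QS ⊆ R + QS ⊆ S cuts e₀ = ℓ(S/QS) into ℓ(R/Q^lim) and
  -- ℓ(H/QH).
  have hone : hilbertCoeff Q 0 - lengthInt R (R ⧸ limitClosure ![x, y]) =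
      lengthInt R (H1mQuot R Q) := by
    rw [h0, he0, lengthInt, lengthInt, hHQ, hlim, hadd, ENat.toNat_add (hlim ▸ hlimtop) (hsub _)]
    push_cast
    ring
  refine ⟨hh, Module.length_ne_top_iff.1 hlimtop, Module.length_ne_top_iff.1 (hHQ ▸ hsub _), hone,
    ?_, ?_, ?_⟩
  · rintro ⟨-, c, hc⟩
    refine ⟨Module.length_ne_top_iff.1 (hHx ▸ hsub _), ?_⟩
    rw [hone, h1, hsup ?_, lengthInt, lengthInt, hHx, hxS]
    · ring
    · obtain ⟨t, ht⟩ := exists_pow_maximalIdeal_le hrad k 1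
      have hQt : Q ^ t • (⊤ : Submodule R (idealTransform x y)) ≤ N := by
        refine Submodule.smul_le.2 fun a ha s _ => hkill a ?_ s
        have hQm : Q ≤ maximalIdeal R := hrad ▸ Ideal.le_radical
        simpa using ht (Ideal.pow_right_mono hQm t ha)
      -- For n ≥ c + t one has QⁿS ⊆ Q^c N. An element of `mulKernel` is thus a ring element of Q^c
      -- that x sends into Qⁿ⁺¹, and superficiality puts it in Qⁿ.
      refine Filter.eventually_atTop.2 ⟨c + t, fun n hn => ?_⟩
      rintro s ⟨hs₁, hs₂⟩
      have hNQ : ∀ (m : ℕ) (r : R), j r ∈ Q ^ m • N ↔ r ∈ Q ^ m := by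
        intro m r
        have : Q ^ m • N = Submodule.map j (Q ^ m) := by
          change Q ^ m • LinearMap.range j = _
          rw [← Submodule.map_top, ← Submodule.map_smul'']; congr 1; simp
        rw [this]
        exact ⟨fun ⟨r', hr', h⟩ => hj h ▸ hr', fun h => ⟨r, h, rfl⟩⟩
      have hs₃ : s ∈ Q ^ c • N := by
        have : Q ^ n • (⊤ : Submodule R (idealTransform x y)) ≤ Q ^ c • N := by
          refine le_trans (Submodule.smul_mono_left (Ideal.pow_le_pow_right hn)) ?_
          rw [pow_add, mul_smul]
          exact ideal_smul_mono _ hQt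
        exact this hs₁
      obtain ⟨r, rfl⟩ := (Submodule.smul_le_right : Q ^ c • N ≤ N) hs₃
      rw [hNQ] at hs₃ ⊢
      have hs₂' : j (x * r) ∈ Q ^ (n + 1) • N := by
        rw [← smul_eq_mul, map_smul]; exact hs₂
      rw [hNQ] at hs₂'
      rw [← hc n (by omega)]
      refine ⟨?_, hs₃⟩
      rw [SetLike.mem_coe, Submodule.mem_colon_singleton, smul_eq_mul, mul_comm]
      exact hs₂'
  · rw [hone, h1, lengthInt, hHQ]
    exact he1
  · intro hQH
    have hQN : Q • (⊤ : Submodule R (idealTransform x y)) ≤ N := by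
      have hQ' : Q • (⊤ : Submodule R (TransformQuotient x y)) = ⊥ := by
        have := congrArg (Submodule.map ε.toLinearMap) hQH
        rw [Submodule.map_smul'', Submodule.map_top, LinearEquiv.range, Submodule.map_bot] at this
        exact this
      refine Submodule.smul_le.2 fun a ha s _ => ?_
      have : a • (Submodule.Quotient.mk s : TransformQuotient x y) ∈
          Q • (⊤ : Submodule R (TransformQuotient x y)) := Submodule.smul_mem_smul ha trivial
      rw [hQ', Submodule.mem_bot, ← Submodule.Quotient.mk_smul, transformQuotient_mk_eq_zero] at this
      exact mem_range_toTransform.2 this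
    obtain ⟨hz1, hz2⟩ := hzero hQN
    refine ⟨?_, by rw [hone, h1, hz1, lengthInt, hHQ]; ring⟩
    -- the squares
    have hreg2 : IsRegularPair (x ^ 2) (y ^ 2) (idealTransform x y) := (hreg.pow_left 2).pow 2
    obtain ⟨e', he', -, -, -, -, hzero'⟩ := exists_hilbertCoeffs hreg2 j hj hNtop
      (fun n => length_quotient_span_pow_ne_top hrad 2 n)
    obtain ⟨-, h0', -⟩ := hilbertCoeff_spec hdim he'
    have hle : Ideal.span {x ^ 2, y ^ 2} ≤ Q := by
      refine Ideal.span_le.2 ?_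
      rintro z (rfl | rfl)
      · exact Ideal.pow_mem_of_mem _ (Ideal.subset_span (by simp)) 2 (by norm_num)
      · exact Ideal.pow_mem_of_mem _ (Ideal.subset_span (by simp)) 2 (by norm_num)
    obtain ⟨-, hz2'⟩ := hzero' ((Submodule.smul_mono_left hle).trans hQN)
    have r2 : (Set.range fun i => ![x, y] i ^ 2) = {x ^ 2, y ^ 2} := by
      ext z; simp [Set.mem_range, Fin.exists_fin_two, eq_comm]
    rw [IsStandardParameters, range_pair, r2, lengthInt, lengthInt, h0', ← hQdef, h0, hz2, hz2']

end LocalRing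

end ParameterPair

/-! ### Regular local rings are domains. -/

namespace IsRegularLocalRing

/-- A basis of the cotangent space modulo the nonzero class of x lifts, together with x, to
generators of the maximal ideal; in the quotient x drops out. -/
lemma spanFinrank_maximalIdeal_quotient_le {R : Type u} [CommRing R] [IsLocalRing R]
    [IsNoetherianRing R] {n : ℕ} {x : R}
    (hn : (maximalIdeal R).spanFinrank = n + 1) (hx : x ∈ maximalIdeal R)
    (hx2 : x ∉ maximalIdeal R ^ 2) [IsLocalRing (R ⧸ Ideal.span {x})] :
    (maximalIdeal (R ⧸ Ideal.span {x})).spanFinrank ≤ n := by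
  set xb : CotangentSpace R := (maximalIdeal R).toCotangent ⟨x, hx⟩ with hxb
  have hxb0 : xb ≠ 0 := fun h => hx2 (by rwa [hxb, Ideal.toCotangent_eq_zero] at h)
  set K := Submodule.span (ResidueField R) {xb} with hK
  have hfr : Module.finrank (ResidueField R) (CotangentSpace R ⧸ K) = n := by
    have h1 := Submodule.finrank_quotient_add_finrank K
    have h2 := finrank_span_singleton (K := ResidueField R) hxb0
    rw [← hK] at h2
    rw [h2, ← spanFinrank_maximalIdeal_eq_finrank_cotangentSpace,
      hn] at h1
    omega
  let b := Module.finBasisOfFinrankEq (ResidueField R) _ hfr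
  have hsurj : Function.Surjective fun z : maximalIdeal R =>
      K.mkQ ((maximalIdeal R).toCotangent z) :=
    (Submodule.mkQ_surjective K).comp (Ideal.toCotangent_surjective _)
  choose z hz using fun i => hsurj (b i)
  have hspan : Submodule.span R (insert ⟨x, hx⟩ (Set.range z)) = ⊤ := by
    rw [← CotangentSpace.span_image_eq_top_iff, Set.image_insert_eq, ← hxb]
    set A := Submodule.span (ResidueField R)
      (insert xb ((maximalIdeal R).toCotangent '' Set.range z)) with hA
    have hKA : K ≤ A := Submodule.span_mono (by simp)
    have hmap : A.map K.mkQ = ⊤ := by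
      rw [eq_top_iff, ← b.span_eq, Submodule.span_le]
      rintro _ ⟨i, rfl⟩
      exact ⟨_, Submodule.subset_span (Or.inr ⟨z i, ⟨i, rfl⟩, rfl⟩), hz i⟩
    have := Submodule.comap_map_mkQ K A
    rw [hmap, Submodule.comap_top, sup_eq_right.2 hKA] at this
    exact this.symm
  have hm : maximalIdeal R = Ideal.span (insert x (Set.range fun i => (z i : R))) := by
    have := congrArg (Submodule.map (maximalIdeal R).subtype) hspan
    rw [Submodule.map_top, Submodule.range_subtype, Submodule.map_span, Set.image_insert_eq,
      ← Set.range_comp] at this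
    exact this.symm
  have hq : maximalIdeal (R ⧸ Ideal.span {x}) =
      Ideal.span (Set.range fun i => Ideal.Quotient.mk (Ideal.span {x}) (z i)) := by
    have h1 : maximalIdeal (R ⧸ Ideal.span {x}) =
        (maximalIdeal R).map (Ideal.Quotient.mk (Ideal.span {x})) :=
      (map_maximalIdeal_of_surjective _ Ideal.Quotient.mk_surjective).symm
    rw [h1]
    refine (congrArg (Ideal.map (Ideal.Quotient.mk (Ideal.span {x}))) hm).trans ?_
    rw [Ideal.map_span, Set.image_insert_eq, ← Set.range_comp]
    apply le_antisymm
    · rw [Ideal.span_le, Set.insert_subset_iff]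
      refine ⟨?_, Ideal.subset_span⟩
      rw [Ideal.Quotient.eq_zero_iff_mem.2 (Ideal.mem_span_singleton_self x)]
      exact zero_mem _
    · exact Ideal.span_mono (Set.subset_insert _ _)
  rw [hq]
  refine (Submodule.spanFinrank_span_le_ncard_of_finite (Set.finite_range _)).trans ?_
  have := Set.ncard_image_le (f := fun i => Ideal.Quotient.mk (Ideal.span {x}) (z i : R))
    (Set.finite_univ (α := Fin n))
  simpa [Set.ncard_univ] using this

/-- Prime avoidance gives x ∈ 𝔪 outside 𝔪² and all minimal primes. The quotient by x is regular of
smaller dimension, so (x) is prime. A minimal prime P ⊆ (x) satisfies P = xP because x ∉ P, and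
Nakayama gives P = 0. -/
lemma isDomain_of_ringKrullDim_eq (n : ℕ) : ∀ (R : Type u) [CommRing R] [IsRegularLocalRing R],
    ringKrullDim R = n → IsDomain R := by
  induction n with
  | zero =>
    intro R _ _ hd
    have h := spanFinrank_maximalIdeal (R := R)
    rw [hd] at h
    have h0 : (maximalIdeal R).spanFinrank = 0 := by exact_mod_cast h
    rw [spanFinrank_maximalIdeal_eq_finrank_cotangentSpace,
      finrank_cotangentSpace_eq_zero_iff] at h0
    exact h0.isDomain
  | succ n ih =>
    intro R _ _ hd
    have h := spanFinrank_maximalIdeal (R := R)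
    rw [hd] at h
    have h0 : (maximalIdeal R).spanFinrank = n + 1 := by exact_mod_cast h
    have hfin : (minimalPrimes R).Finite := minimalPrimes.finite_of_isNoetherianRing R
    obtain ⟨x, hx, hx2, hxP⟩ : ∃ x ∈ maximalIdeal R, x ∉ maximalIdeal R ^ 2 ∧
        ∀ P ∈ minimalPrimes R, x ∉ P := by
      by_contra! hcon
      classical
      have hsub : ((maximalIdeal R : Ideal R) : Set R) ⊆
          ⋃ i ∈ (↑(insert (maximalIdeal R ^ 2) hfin.toFinset) : Set (Ideal R)), (id i : Ideal R) := by
        intro a ha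
        by_cases h2 : a ∈ maximalIdeal R ^ 2
        · exact Set.mem_biUnion (by simp) h2
        · obtain ⟨P, hP, haP⟩ := hcon a ha h2
          exact Set.mem_biUnion (by simp [hP]) haP
      -- Prime avoidance tolerates two ideals that need not be prime; both places are given to 𝔪².
      obtain ⟨I, hI, hmI⟩ := (Ideal.subset_union_prime (maximalIdeal R ^ 2) (maximalIdeal R ^ 2)
        (by
          intro i hi h1 _
          simp only [Finset.mem_insert, h1, Set.Finite.mem_toFinset, false_or] at hi
          exact hi.1.1)).1 hsub
      rw [Finset.mem_insert, Set.Finite.mem_toFinset] at hI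
      rcases hI with rfl | hI
      · have hb : maximalIdeal R = ⊥ :=
          Submodule.eq_bot_of_le_smul_of_le_jacobson_bot _ _ (IsNoetherian.noetherian _)
            (by rw [smul_eq_mul, ← sq]; exact hmI)
            (IsLocalRing.jacobson_eq_maximalIdeal _ bot_ne_top).ge
        rw [hb, Submodule.spanFinrank_bot] at h0
        omega
      · have hIm : I = maximalIdeal R :=
          le_antisymm (le_maximalIdeal hI.1.1.ne_top) hmI
        have hh : (maximalIdeal R).height = 0 := by
          rw [← hIm]
          have := hI.1.1
          exact Ideal.height_eq_zero_iff.2 hI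
        have := maximalIdeal_height_eq_ringKrullDim (R := R)
        rw [hh, hd] at this
        norm_cast at this
    have hne : Ideal.span {x} ≠ ⊤ := fun h =>
      (maximalIdeal.isMaximal R).ne_top (top_le_iff.1
        (h ▸ (Ideal.span_singleton_le_iff_mem _).2 hx))
    have : Nontrivial (R ⧸ Ideal.span {x}) := Ideal.Quotient.nontrivial_iff.2 hne
    have : IsLocalRing (R ⧸ Ideal.span {x}) :=
      IsLocalRing.of_surjective' (Ideal.Quotient.mk _) Ideal.Quotient.mk_surjective
    have hle := spanFinrank_maximalIdeal_quotient_le h0 hx hx2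
    have hdim : (n : WithBot ℕ∞) ≤ ringKrullDim (R ⧸ Ideal.span {x}) := by
      have := ringKrullDim_le_ringKrullDim_quotient_add_card {x}
        (by simpa [IsLocalRing.ringJacobson_eq_maximalIdeal] using hx)
      rw [hd] at this
      simp only [Finset.card_singleton, Nat.cast_add, Nat.cast_one] at this
      have e : (({x} : Finset R) : Set R) = {x} := Finset.coe_singleton x
      rw [e] at this
      exact (ENat.WithBot.add_le_add_one_right_iff).1 this
    have hreg : IsRegularLocalRing (R ⧸ Ideal.span {x}) :=
      of_spanFinrank_maximalIdeal_le _ (le_trans (by exact_mod_cast hle) hdim)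
    have hdom : IsDomain (R ⧸ Ideal.span {x}) := by
      refine ih _ (le_antisymm ?_ hdim)
      rw [← spanFinrank_maximalIdeal]
      exact_mod_cast hle
    have hprime : (Ideal.span {x}).IsPrime := (Ideal.Quotient.isDomain_iff_prime _).1 hdom
    obtain ⟨P, hP, hPx⟩ := Ideal.exists_minimalPrimes_le (bot_le (a := Ideal.span {x}))
    have hPp : P.IsPrime := hP.1.1
    have hPb : P = ⊥ := by
      refine Submodule.eq_bot_of_le_smul_of_le_jacobson_bot (maximalIdeal R) _
        (IsNoetherian.noetherian _) ?_ (IsLocalRing.jacobson_eq_maximalIdeal _ bot_ne_top).ge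
      intro a ha
      obtain ⟨r, rfl⟩ := Ideal.mem_span_singleton.1 (hPx ha)
      exact Submodule.smul_mem_smul hx ((hPp.mem_or_mem ha).resolve_left (hxP P hP))
    subst hPb
    exact IsDomain.of_bot_isPrime R

/-- A regular local ring is a domain. -/
lemma isDomain (R : Type u) [CommRing R] [h : IsRegularLocalRing R] : IsDomain R :=
  isDomain_of_ringKrullDim_eq _ R h.spanFinrank_maximalIdeal.symm

end IsRegularLocalRing

/-- A regular ring is reduced. -/
lemma IsRegularRing.isReduced (R : Type u) [CommRing R] [IsRegularRing R] : IsReduced R := by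
  refine isReduced_ofLocalizationMaximal R fun P hP => ?_
  have := IsRegularLocalRing.isDomain (Localization.AtPrime P)
  infer_instance

/-! ### Reducedness of formal fibres, expressed through sequences. -/

open TensorProduct in
/-- If `R → R^` is a regular homomorphism, then a Cauchy sequence whose square tends to zero
modulo a prime ideal tends to zero modulo that prime ideal. -/
lemma IsRegularAlgebra.mem_sup_pow_of_sq_mem {R : Type u} [CommRing R] [IsLocalRing R]
    [IsNoetherianRing R]
    (hreg : IsRegularAlgebra R (AdicCompletion (maximalIdeal R) R)) (p : Ideal R) [p.IsPrime]
    (w : ℕ → R) (hw : ∀ n, w (n + 1) - w n ∈ maximalIdeal R ^ n)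
    (hsq : ∀ n, w n ^ 2 ∈ p ⊔ maximalIdeal R ^ n) (n : ℕ) :
    w n ∈ p ⊔ maximalIdeal R ^ n := by
  set m := maximalIdeal R with hm
  let f : AdicCompletion.AdicCauchySequence m R := AdicCompletion.AdicCauchySequence.mk m R w
    (fun n => by
      rw [SModEq.sub_mem, ← neg_mem_iff, neg_sub]
      simpa using hw n)
  let z : AdicCompletion m R := AdicCompletion.mkₐ m f
  have hz : ∀ n, AdicCompletion.evalₐ m n z = Ideal.Quotient.mk _ (w n) := fun n =>
    AdicCompletion.evalₐ_mkₐ m n f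
  let ψ := AdicCompletion.ofTensorProductEquivOfFiniteNoetherian m (R ⧸ p)
  have hψ : ∀ g : AdicCompletion m R, ψ (g ⊗ₜ (1 : R ⧸ p)) =
      g • AdicCompletion.of m (R ⧸ p) 1 := fun g => rfl
  -- R̂ ⊗ R/p is the completion of R/p, so g ⊗ 1 vanishes exactly when all approximations of g do so
  -- modulo p + 𝔪ⁿ.
  have key : ∀ (g : AdicCompletion m R) (v : ℕ → R),
      (∀ n, AdicCompletion.evalₐ m n g = Ideal.Quotient.mk _ (v n)) →
      (g ⊗ₜ[R] (1 : R ⧸ p) = 0 ↔ ∀ n, v n ∈ p ⊔ m ^ n) := by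
    intro g v hv
    rw [← ψ.map_eq_zero_iff, hψ, AdicCompletion.ext_iff]
    refine forall_congr' fun n => ?_
    have h1 : (g • AdicCompletion.of m (R ⧸ p) 1).val n =
        Submodule.Quotient.mk (p := (m ^ n • ⊤ : Submodule R (R ⧸ p)))
          (Ideal.Quotient.mk p (v n)) := by
      rw [AdicCompletion.smul_eval, AdicCompletion.val_smul_eq_evalₐ_smul, hv]
      change v n • Submodule.Quotient.mk (p := (m ^ n • ⊤ : Submodule R (R ⧸ p))) 1 = _
      rw [← Submodule.Quotient.mk_smul]
      congr 1
      rw [Algebra.smul_def, mul_one]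
      rfl
    rw [h1, AdicCompletion.val_zero_apply, Submodule.Quotient.mk_eq_zero]
    have h3 : (m ^ n • ⊤ : Submodule R (R ⧸ p)) = Submodule.map (Submodule.mkQ p) (m ^ n) := by
      rw [← Submodule.range_mkQ p, LinearMap.range_eq_map, ← Submodule.map_smul'', smul_eq_mul,
        Ideal.mul_top]
    rw [h3, ← Submodule.comap_map_mkQ p]
    rfl
  have h0 : (z ^ 2) ⊗ₜ[R] (1 : R ⧸ p) = 0 :=
    (key (z ^ 2) (fun n => w n ^ 2) (fun n => by rw [map_pow, hz, map_pow])).2 hsq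
  refine (key z w hz).1 ?_ n
  -- Taking L = κ(p) in the definition shows that the fibre itself is regular, hence reduced.
  have hred : IsReduced (p.Fiber (AdicCompletion m R)) := by
    have h1 := hreg.fiber_regular p p.ResidueField
    have := IsRegularRing.of_ringEquiv
      (R := p.ResidueField ⊗[p.ResidueField] (p.Fiber (AdicCompletion m R)))
      (R' := p.Fiber (AdicCompletion m R))
      (Algebra.TensorProduct.lid p.ResidueField (p.Fiber (AdicCompletion m R))).toRingEquiv
    exact IsRegularRing.isReduced _
  have hflat := hreg.flat
  let ι : R ⧸ p →ₗ[R] p.ResidueField := (IsScalarTower.toAlgHom R (R ⧸ p) p.ResidueField).toLinearMap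
  have hι : Function.Injective ι := Ideal.injective_algebraMap_quotient_residueField p
  -- Flatness embeds R̂/pR̂ into the fibre over p, where z² = 0 implies z = 0.
  have hinj : Function.Injective (ι.lTensor (AdicCompletion m R)) :=
    Module.Flat.lTensor_preserves_injective_linearMap ι hι
  have hx : ∀ g : AdicCompletion m R, g ⊗ₜ[R] (1 : R ⧸ p) = 0 ↔
      ((1 : p.ResidueField) ⊗ₜ[R] g : p.Fiber (AdicCompletion m R)) = 0 := by
    intro g
    rw [← map_eq_zero_iff _ hinj, ← map_eq_zero_iff _ (TensorProduct.comm R _ _).injective]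
    simp [ι]
  have h2 : ((1 : p.ResidueField) ⊗ₜ[R] z : p.Fiber (AdicCompletion m R)) ^ 2 = 0 := by
    rw [Algebra.TensorProduct.tmul_pow, one_pow]
    exact (hx _).1 h0
  exact (hx z).2 ((pow_eq_zero_iff two_ne_zero).1 h2)

/-! ### Catenarity and integrality of the ideal transform. -/

namespace Polynomial

variable {A : Type u} [CommRing A] {K : Type v} [Field K] [Algebra A K]

/-- If `s` is a polynomial in `s⁻¹`, then `s` is integral. -/
lemma isIntegral_of_aeval_inv_eq {s : K} {g : A[X]} (h : aeval s⁻¹ g = s) : IsIntegral A s := by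
  by_cases hs : s = 0
  · rw [hs]; exact isIntegral_zero
  -- With d the degree of g, sᵈ g(s⁻¹) is the value at s of the reversed polynomial, so s = g(s⁻¹)
  -- becomes the monic equation sᵈ⁺¹ = g.reverse(s).
  refine ⟨X ^ (g.natDegree + 1) - g.reverse, monic_X_pow_sub ?_, ?_⟩
  · exact lt_of_le_of_lt (natDegree_le_iff_degree_le.1 (reverse_natDegree_le g))
      (by exact_mod_cast Nat.lt_succ_self _)
  · let : Invertible s⁻¹ := invertibleOfNonzero (inv_ne_zero hs)
    have h1 := eval₂_reverse_mul_pow (algebraMap A K) s⁻¹ g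
    rw [invOf_eq_inv, inv_inv, ← aeval_def s⁻¹ g, h] at h1
    rw [eval₂_sub, eval₂_X_pow, pow_succ, sub_eq_zero]
    nth_rw 2 [← h1]
    rw [mul_left_comm, ← mul_pow, mul_inv_cancel₀ hs, one_pow, mul_one]

variable [IsDomain A] [IsFractionRing A K]

lemma exists_C_mul_eq_of_aeval_eq_zero {t : K} {d e : A} (hd : d ≠ 0)
    (ht : algebraMap A K d * t = algebraMap A K e) {f : A[X]} (hf : aeval t f = 0) :
    ∃ r ≠ 0, ∃ g : A[X], C r * f = (C d * X - C e) * g := by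
  have hroot : (f.map (algebraMap A K)).IsRoot t := by
    rw [IsRoot.def, eval_map_algebraMap, hf]
  obtain ⟨g, hg⟩ := dvd_iff_isRoot.2 hroot
  obtain ⟨b, hb, hbg⟩ := IsLocalization.integerNormalization_spec (nonZeroDivisors A) g
  have hinj : Function.Injective (algebraMap A K) := IsFractionRing.injective A K
  refine ⟨b * d, mul_ne_zero (nonZeroDivisors.ne_zero hb) hd,
    IsLocalization.integerNormalization (nonZeroDivisors A) g, map_injective _ hinj ?_⟩
  rw [Polynomial.map_mul, Polynomial.map_mul, hbg, hg, algebra_compatible_smul K b g, smul_eq_C_mul]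
  simp only [Polynomial.map_sub, Polynomial.map_mul, map_C, map_X, ← ht, map_mul]
  ring

/-- The kernel has height one. P meets A only in 0, and r f = (dX − e) g replaces a nonzero f ∈ P by
g ∈ P of smaller degree unless dX − e ∈ P; so dX − e ∈ P, and it generates the kernel up to nonzero
constants. -/
lemma eq_ker_aeval_of_le {t : K} {P : Ideal A[X]} [P.IsPrime] (hP : P ≠ ⊥)
    (hle : P ≤ RingHom.ker (aeval (R := A) t)) : P = RingHom.ker (aeval (R := A) t) := by
  obtain ⟨e, d, hd, hed⟩ := IsFractionRing.div_surjective (A := A) t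
  have hd0 : d ≠ 0 := nonZeroDivisors.ne_zero hd
  have hinj : Function.Injective (algebraMap A K) := IsFractionRing.injective A K
  have hdK : algebraMap A K d ≠ 0 := (map_ne_zero_iff _ hinj).2 hd0
  have ht : algebraMap A K d * t = algebraMap A K e := by rw [← hed]; field_simp
  have hC : ∀ r : A, r ≠ 0 → C r ∉ P := fun r hr h => by
    have := hle h
    rw [RingHom.mem_ker, aeval_C] at this
    exact hr ((map_eq_zero_iff _ hinj).1 this)
  have hl : C d * X - C e ∈ P := by
    obtain ⟨f, hf, hf0⟩ := Submodule.exists_mem_ne_zero_of_ne_bot hP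
    induction hn : f.natDegree using Nat.strong_induction_on generalizing f with
    | _ n ih =>
      obtain ⟨r, hr, g, hg⟩ := exists_C_mul_eq_of_aeval_eq_zero hd0 ht (hle hf)
      have hmem : (C d * X - C e) * g ∈ P := hg ▸ P.mul_mem_left _ hf
      refine (Ideal.IsPrime.mem_or_mem ‹_› hmem).elim id fun hgP => ?_
      have hlin : C d * X - C e = C d * X + C (-e) := by rw [C_neg, sub_eq_add_neg]
      have hg0 : g ≠ 0 := by
        rintro rfl
        rw [mul_zero, mul_eq_zero, C_eq_zero] at hg
        tauto
      have hdeg := congrArg natDegree hg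
      rw [natDegree_C_mul hr, natDegree_mul (fun h => by
        have := congrArg natDegree h
        rw [hlin, natDegree_linear hd0] at this
        simp at this) hg0, hlin, natDegree_linear hd0] at hdeg
      exact ih _ (by omega) g hgP hg0 rfl
  refine le_antisymm hle fun h hh => ?_
  obtain ⟨r, hr, g, hg⟩ := exists_C_mul_eq_of_aeval_eq_zero hd0 ht hh
  exact (Ideal.IsPrime.mem_or_mem ‹_› (hg ▸ P.mul_mem_right g hl)).resolve_left (hC r hr)

end Polynomial

lemma Order.covBy_of_krullDim_le_three {α : Type*} [PartialOrder α] (h : Order.krullDim α ≤ 3)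
    {a b c d : α} (hab : a < b) (hbc : b < c) (hcd : c < d) : a ⋖ b ∧ b ⋖ c ∧ c ⋖ d := by
  have key : ∀ a b c d e : α, a < b → b < c → c < d → d < e → False := by
    intro a b c d e h1 h2 h3 h4
    let l : LTSeries α := ⟨4, ![a, b, c, d, e], fun i => by fin_cases i <;> assumption⟩
    have := (LTSeries.length_le_krullDim l).trans h
    have : (4 : WithBot ℕ∞) ≤ 3 := this
    norm_cast at this
  exact ⟨⟨hab, fun z h1 h2 => key _ _ _ _ _ h1 h2 hbc hcd⟩,
    ⟨hbc, fun z h1 h2 => key _ _ _ _ _ hab h1 h2 hcd⟩,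
    ⟨hcd, fun z h1 h2 => key _ _ _ _ _ hab hbc h1 h2⟩⟩

open Polynomial in
/-- Over a local domain of dimension two whose polynomial ring is catenary, an element of
the fraction field that is defined off the closed point is integral. -/
lemma isIntegral_of_pow_smul_mem {A : Type u} [CommRing A] [IsDomain A] [IsLocalRing A]
    [IsNoetherianRing A] (hdim : ringKrullDim A = 2) (hcat : IsCatenaryRing A[X])
    {K : Type v} [Field K] [Algebra A K] [IsFractionRing A K] {x y : A}
    (hrad : (Ideal.span {x, y}).radical = maximalIdeal A) {s : K} {n : ℕ} {a b : A}
    (ha : algebraMap A K a = algebraMap A K x ^ n * s)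
    (hb : algebraMap A K b = algebraMap A K y ^ n * s) : IsIntegral A s := by
  by_contra hs
  have hs0 : s ≠ 0 := by rintro rfl; exact hs isIntegral_zero
  set K0 : Ideal A[X] := RingHom.ker (aeval (R := A) s⁻¹) with hK0
  have hK0p : K0.IsPrime := RingHom.ker_isPrime _
  set N1 : Ideal A[X] := (maximalIdeal A).comap constantCoeff with hN1
  have hN1m : N1.IsMaximal :=
    Ideal.comap_isMaximal_of_surjective _ (fun a => ⟨C a, by simp⟩)
  have hxK : ∀ z a : A, algebraMap A K a = algebraMap A K z ^ n * s →
      C z ^ n ∈ K0 ⊔ Ideal.span {X} := by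
    intro z a hz
    have h1 : C z ^ n - C a * X ∈ K0 := by
      rw [hK0, RingHom.mem_ker]
      simp [hz, hs0]
    have h2 : C a * X ∈ Ideal.span {(X : A[X])} :=
      Ideal.mul_mem_left _ _ (Ideal.mem_span_singleton_self _)
    have := add_mem (Ideal.mem_sup_left (T := Ideal.span {(X : A[X])}) h1)
      (Ideal.mem_sup_right (S := K0) h2)
    simpa using this
  -- Modulo `K0`, xⁿ = a s⁻¹ and yⁿ = b s⁻¹ are multiples of X, so a prime over `K0` and X contains
  -- x and y, hence (𝔪, X) = `N1`.
  have hle : ∀ P : Ideal A[X], P.IsPrime → K0 ⊔ Ideal.span {X} ≤ P → N1 ≤ P := by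
    intro P hP hJ f hf
    have hm : maximalIdeal A ≤ P.comap C := by
      rw [← hrad]
      refine (Ideal.IsPrime.radical_le_iff inferInstance).2 (Ideal.span_le.2 ?_)
      rintro z (rfl | rfl)
      · exact hP.mem_of_pow_mem n (hJ (hxK _ a ha))
      · exact hP.mem_of_pow_mem n (hJ (hxK _ b hb))
    have hX : (X : A[X]) ∈ P := hJ (Ideal.mem_sup_right (Ideal.mem_span_singleton_self _))
    rw [← divX_mul_X_add f]
    exact add_mem (P.mul_mem_left _ hX) (hm hf)
  -- If s⁻¹ were a unit of A[s⁻¹], then s would be a polynomial in s⁻¹ and so integral.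
  have htop : K0 ⊔ Ideal.span {X} ≠ ⊤ := by
    intro h
    obtain ⟨k, hk, z, hz, hkz⟩ := Submodule.mem_sup.1 ((Ideal.eq_top_iff_one _).1 h)
    obtain ⟨g, rfl⟩ := Ideal.mem_span_singleton.1 hz
    refine hs (isIntegral_of_aeval_inv_eq (g := g) ?_)
    have := congrArg (aeval s⁻¹) hkz
    rw [map_add, (RingHom.mem_ker.1 hk : aeval s⁻¹ k = 0), map_mul, aeval_X, map_one,
      zero_add] at this
    exact ((inv_mul_eq_one₀ hs0).1 this).symm
  have hJN : K0 ⊔ Ideal.span {X} ≤ N1 := by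
    obtain ⟨M, hM, hJM⟩ := Ideal.exists_le_maximal _ htop
    rwa [hN1m.eq_of_le hM.ne_top (hle M hM.isPrime hJM)]
  have hXK : (X : A[X]) ∉ K0 := by
    rw [hK0, RingHom.mem_ker, aeval_X]
    exact inv_ne_zero hs0
  have hK0ne : K0 ≠ ⊥ := by
    intro h
    obtain ⟨e, d, hd, hed⟩ := IsFractionRing.div_surjective (A := A) s⁻¹
    have hd0 : d ≠ 0 := nonZeroDivisors.ne_zero hd
    have hdK : algebraMap A K d ≠ 0 := (map_ne_zero_iff _ (IsFractionRing.injective A K)).2 hd0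
    have : C d * X - C e ∈ K0 := by
      rw [hK0, RingHom.mem_ker]
      simp only [map_sub, map_mul, aeval_C, aeval_X, ← hed]
      field_simp
      simp
    rw [h, Ideal.mem_bot] at this
    have := congrArg (fun f => coeff f 1) this
    simp at this
    exact hd0 this
  -- `N1` is minimal over X modulo `K0`, so Krull's principal ideal theorem leaves no prime strictly
  -- between.
  have hbetween : ∀ P : Ideal A[X], P.IsPrime → K0 < P → P ≤ N1 → P = N1 := by
    intro P hP hKP hPN
    have : (N1.map (Ideal.Quotient.mk K0)).IsPrime :=
      Ideal.isPrime_map_quotientMk_of_isPrime (le_sup_left.trans hJN)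
    have : (P.map (Ideal.Quotient.mk K0)).IsPrime :=
      Ideal.isPrime_map_quotientMk_of_isPrime hKP.le
    have hmin : N1.map (Ideal.Quotient.mk K0) ∈
        (Ideal.span {Ideal.Quotient.mk K0 X}).minimalPrimes := by
      refine ⟨⟨inferInstance, ?_⟩, ?_⟩
      · rw [Ideal.span_singleton_le_iff_mem]
        exact Ideal.mem_map_of_mem _ (hJN (Ideal.mem_sup_right (Ideal.mem_span_singleton_self _)))
      · rintro q ⟨hq, hXq⟩ -
        rw [Ideal.map_le_iff_le_comap]
        refine hle _ (Ideal.comap_isPrime _ _) (sup_le ?_ ?_)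
        · intro k hk
          rw [Ideal.mem_comap, Ideal.Quotient.eq_zero_iff_mem.2 hk]
          exact zero_mem _
        · rw [Ideal.span_singleton_le_iff_mem] at hXq ⊢
          exact hXq
    have hht := Ideal.height_le_one_of_isPrincipal_of_mem_minimalPrimes _ _ hmin
    by_contra hne
    have hlt : P.map (Ideal.Quotient.mk K0) < N1.map (Ideal.Quotient.mk K0) := by
      refine lt_of_le_of_ne (Ideal.map_mono hPN) fun h => hne ?_
      rw [← Ideal.comap_map_mk hKP.le, h, Ideal.comap_map_mk (le_sup_left.trans hJN)]
    have h0 := (Ideal.height_le_iff (n := 1)).1 hht _ inferInstance hlt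
    rw [Nat.cast_one, Order.lt_one_iff, Ideal.height_eq_zero_iff,
      IsDomain.minimalPrimes_eq_singleton_bot, Set.mem_singleton_iff,
      Ideal.map_eq_bot_iff_le_ker, Ideal.mk_ker] at h0
    exact hKP.not_ge h0
  have hdim3 : ringKrullDim A[X] = 3 := by
    rw [Polynomial.ringKrullDim_of_isNoetherianRing, hdim]
    rfl
  obtain ⟨p1, hp1, h01, h1m⟩ : ∃ p1 : Ideal A, p1.IsPrime ∧ ⊥ < p1 ∧ p1 < maximalIdeal A := by
    obtain ⟨l, hl⟩ := Order.le_krullDim_iff.1 (hdim.ge : ((2 : ℕ) : WithBot ℕ∞) ≤ _)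
    obtain ⟨k, l, hstep⟩ := l
    obtain rfl : k = 2 := hl
    have h1 : l 0 < l 1 := hstep 0
    have h2 : l 1 < l 2 := hstep 1
    exact ⟨(l 1).asIdeal, (l 1).2, bot_le.trans_lt (show (l 0).asIdeal < _ from h1),
      lt_of_lt_of_le (show _ < (l 2).asIdeal from h2) (le_maximalIdeal (l 2).2.ne_top)⟩
  have hmapp : ∀ p : Ideal A, p.IsPrime → (p.map (C : A →+* A[X])).IsPrime := fun p _ =>
    Ideal.isPrime_map_C_of_isPrime
  have hlt : ∀ p q : Ideal A, p < q → p.map (C : A →+* A[X]) < q.map C := by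
    intro p q hpq
    refine lt_of_le_of_ne (Ideal.map_mono hpq.le) fun h => hpq.not_ge fun z hz => ?_
    have : C z ∈ p.map (C : A →+* A[X]) := h ▸ Ideal.mem_map_of_mem _ hz
    simpa using Ideal.mem_map_C_iff.1 this 0
  have hmN : (maximalIdeal A).map (C : A →+* A[X]) < N1 := by
    refine lt_of_le_of_ne (Ideal.map_le_iff_le_comap.2 fun z hz => by simpa [hN1] using hz)
      fun h => ?_
    have : (X : A[X]) ∈ (maximalIdeal A).map C := h ▸ (by simp [hN1])
    have := Ideal.mem_map_C_iff.1 this 1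
    simp at this
  let b0 : PrimeSpectrum A[X] := ⟨⊥, Ideal.isPrime_bot⟩
  let b1 : PrimeSpectrum A[X] := ⟨p1.map C, hmapp _ hp1⟩
  let b2 : PrimeSpectrum A[X] := ⟨(maximalIdeal A).map C, hmapp _ inferInstance⟩
  let b3 : PrimeSpectrum A[X] := ⟨N1, hN1m.isPrime⟩
  let k0 : PrimeSpectrum A[X] := ⟨K0, hK0p⟩
  have hb01 : b0 < b1 := by
    have := hlt ⊥ p1 h01
    rw [Ideal.map_bot] at this
    exact this
  obtain ⟨c1, c2, c3⟩ := Order.covBy_of_krullDim_le_three (hdim3.le) hb01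
    (show b1 < b2 from hlt _ _ h1m) (show b2 < b3 from hmN)
  have hKN : K0 < N1 := lt_of_le_of_ne (le_sup_left.trans hJN) fun h =>
    hXK (h ▸ hJN (Ideal.mem_sup_right (Ideal.mem_span_singleton_self _)))
  have d1 : b0 ⋖ k0 := ⟨show ⊥ < K0 from bot_lt_iff_ne_bot.2 hK0ne, fun z h1 h2 => h2.ne
    (PrimeSpectrum.ext (eq_ker_aeval_of_le (bot_lt_iff_ne_bot.1 (show ⊥ < z.asIdeal from h1))
      (show z.asIdeal ≤ K0 from h2.le)))⟩
  have d2 : k0 ⋖ b3 := ⟨hKN, fun z h1 h2 => h2.ne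
    (PrimeSpectrum.ext (hbetween z.asIdeal z.2 h1 h2.le))⟩
  -- The saturated chains 0 ⊂ K0 ⊂ N1 and 0 ⊂ p1[X] ⊂ 𝔪[X] ⊂ N1 have lengths 2 and 3.
  have := hcat ⟨2, ![b0, k0, b3], fun i => by fin_cases i <;> assumption⟩
    ⟨3, ![b0, b1, b2, b3], fun i => by fin_cases i <;> assumption⟩ rfl rfl
  simp at this

/-! ### The x-adic completion as A⟦X⟧/(X − x). -/

namespace PowerSeries

open Polynomial (eval)

variable {A : Type u} [CommRing A]

lemma eval_trunc_succ (x : A) (n : ℕ) (f : A⟦X⟧) :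
    (trunc (n + 1) f).eval x = (trunc n f).eval x + coeff n f * x ^ n := by
  rw [trunc_succ, Polynomial.eval_add, Polynomial.eval_monomial]

/-- In A⟦X⟧/(X − x), the truncation of f evaluated at x represents f modulo xⁿ. -/
lemma sub_C_eval_trunc_mem (x : A) (n : ℕ) (f : A⟦X⟧) :
    f - C ((trunc n f).eval x) ∈ Ideal.span {X - C x} ⊔ Ideal.span {(X : A⟦X⟧) ^ n} := by
  have h1 : f - (trunc n f : A⟦X⟧) ∈ Ideal.span {(X : A⟦X⟧) ^ n} := by
    rw [Ideal.mem_span_singleton, X_pow_dvd_iff]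
    intro m hm
    rw [map_sub, Polynomial.coeff_coe, coeff_trunc, if_pos hm, sub_self]
  have h2 : (trunc n f : A⟦X⟧) - C ((trunc n f).eval x) ∈ Ideal.span {X - C x} := by
    obtain ⟨g, hg⟩ := Polynomial.X_sub_C_dvd_sub_C_eval (p := trunc n f) (a := x)
    rw [Ideal.mem_span_singleton]
    refine ⟨(g : A⟦X⟧), ?_⟩
    have := congrArg (fun q : Polynomial A => (q : A⟦X⟧)) hg
    simpa using this
  have := add_mem (Ideal.mem_sup_left (T := Ideal.span {(X : A⟦X⟧) ^ n}) h2)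
    (Ideal.mem_sup_right (S := Ideal.span {X - C x}) h1)
  simpa using this

/-- In a = (X − x) g + Xⁿ k, comparing coefficients gives a = −x g₀ and gₘ = x gₘ₊₁ for m + 1 < n,
so each degree contributes a factor x. -/
lemma pow_dvd_of_C_mem {x a : A} {n : ℕ}
    (h : (C a : A⟦X⟧) ∈ Ideal.span {X - C x} ⊔ Ideal.span {(X : A⟦X⟧) ^ n}) : x ^ n ∣ a := by
  obtain ⟨u, hu, v, hv, huv⟩ := Submodule.mem_sup.1 h
  obtain ⟨g, rfl⟩ := Ideal.mem_span_singleton.1 hu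
  obtain ⟨k, rfl⟩ := Ideal.mem_span_singleton.1 hv
  cases n with
  | zero => simp
  | succ n =>
    have hX : ∀ m < n + 1, coeff m ((X : A⟦X⟧) ^ (n + 1) * k) = 0 :=
      X_pow_dvd_iff.1 (Dvd.intro _ rfl)
    have h0 : a = -(x * coeff 0 g) := by
      have := congrArg (coeff 0) huv
      rw [map_add, hX 0 (by omega)] at this
      simpa [sub_mul] using this.symm
    have hs : ∀ m < n, coeff m g = x * coeff (m + 1) g := by
      intro m hm
      have := congrArg (coeff (m + 1)) huv
      rw [map_add, hX (m + 1) (by omega)] at this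
      simpa [sub_mul, coeff_C, coeff_succ_X_mul, sub_eq_zero] using this
    have hp : ∀ m ≤ n, coeff 0 g = x ^ m * coeff m g := by
      intro m
      induction m with
      | zero => simp
      | succ m ih => intro hm; rw [ih (by omega), hs m (by omega)]; ring
    exact ⟨-coeff n g, by rw [h0, hp n le_rfl]; ring⟩

variable [IsDomain A]

/-- Membership in the ideal `(X - x)` of `A⟦X⟧` is detected modulo all powers of `x`. -/
lemma mem_span_X_sub_C_iff {x : A} (hx : x ≠ 0) {f : A⟦X⟧} :
    f ∈ Ideal.span {X - C x} ↔ ∀ n, x ^ n ∣ (trunc n f).eval x := by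
  constructor
  · intro h n
    refine pow_dvd_of_C_mem ?_
    have := sub_mem (Ideal.mem_sup_left (T := Ideal.span {(X : A⟦X⟧) ^ n}) h)
      (sub_C_eval_trunc_mem x n f)
    simpa using this
  · intro h
    choose q hq using fun n => h (n + 1)
    rw [Ideal.mem_span_singleton]
    -- Writing f = (X − x) G and solving degree by degree forces the coefficients of G to be −q n.
    refine ⟨PowerSeries.mk fun n => -q n, ?_⟩
    ext n
    cases n with
    | zero =>
      have := hq 0
      rw [eval_trunc_succ] at this
      simpa [sub_mul] using this
    | succ n =>
      have h1 := hq (n + 1)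
      rw [eval_trunc_succ, hq n] at h1
      have h2 : x ^ (n + 1) * (q n + coeff (n + 1) f) = x ^ (n + 1) * (x * q (n + 1)) := by
        linear_combination h1
      have h3 := mul_left_cancel₀ (pow_ne_zero _ hx) h2
      rw [sub_mul, map_sub, coeff_succ_X_mul, coeff_C_mul, coeff_mk, coeff_mk]
      linear_combination h3

/-- Truncating one degree further pays for the cancelled factor x. -/
lemma mem_span_X_sub_C_of_C_mul_mem {x : A} (hx : x ≠ 0) {f : A⟦X⟧}
    (h : C x * f ∈ Ideal.span {X - C x}) : f ∈ Ideal.span {X - C x} := by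
  rw [mem_span_X_sub_C_iff hx]
  intro n
  have h1 : (C (x * (trunc (n + 1) f).eval x) : A⟦X⟧) ∈
      Ideal.span {X - C x} ⊔ Ideal.span {(X : A⟦X⟧) ^ (n + 1)} := by
    have := sub_mem (Ideal.mem_sup_left (T := Ideal.span {(X : A⟦X⟧) ^ (n + 1)}) h)
      (Ideal.mul_mem_left _ (C x) (sub_C_eval_trunc_mem x (n + 1) f))
    rw [map_mul]
    convert this using 1
    ring
  have h2 := pow_dvd_of_C_mem h1
  rw [pow_succ', mul_dvd_mul_iff_left hx, eval_trunc_succ] at h2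
  exact (dvd_add_left (Dvd.intro_left _ rfl)).1 h2

variable [IsLocalRing A] [IsNoetherianRing A]

/-- `hred` says that the 𝔪-adic completion is reduced. It passes to the x-adic one: if wₙ ∈ 𝔪ⁿ for
all n and w is x-adically Cauchy, then wₙ ∈ xⁿA + 𝔪ⁿ⁺ᵏ for all k, and Krull's intersection theorem
in A/(xⁿ) gives xⁿ ∣ wₙ. -/
lemma isRadical_span_X_sub_C {x : A} (hx : x ≠ 0) (hxm : x ∈ maximalIdeal A)
    (hred : ∀ w : ℕ → A, (∀ n, w (n + 1) - w n ∈ maximalIdeal A ^ n) →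
      (∀ n, w n ^ 2 ∈ maximalIdeal A ^ n) → ∀ n, w n ∈ maximalIdeal A ^ n) :
    (Ideal.span {(X : A⟦X⟧) - C x}).IsRadical := by
  rw [Ideal.isRadical_iff_pow_one_lt 2 one_lt_two]
  intro f hf
  rw [mem_span_X_sub_C_iff hx]
  set w : ℕ → A := fun n => (trunc n f).eval x with hw
  have hstep : ∀ n, w (n + 1) - w n = coeff n f * x ^ n := fun n => by
    rw [hw]; simp only; rw [eval_trunc_succ]; ring
  have hsq : ∀ n, x ^ n ∣ w n ^ 2 := by
    intro n
    refine pow_dvd_of_C_mem ?_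
    have h1 := sub_C_eval_trunc_mem x n f
    have := sub_mem (Ideal.mem_sup_left (T := Ideal.span {(X : A⟦X⟧) ^ n}) hf)
      (Ideal.mul_mem_left _ (f + C (w n)) h1)
    rw [map_pow]
    convert this using 1
    ring
  have hwm : ∀ n, w n ∈ maximalIdeal A ^ n :=
    hred w (fun n => by rw [hstep]; exact Ideal.mul_mem_left _ _ (Ideal.pow_mem_pow hxm n))
      fun n => (Ideal.mem_of_dvd _ (hsq n) (Ideal.pow_mem_pow hxm n))
  intro n
  have hdiff : ∀ k, x ^ n ∣ w (n + k) - w n := by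
    intro k
    induction k with
    | zero => simp
    | succ k ih =>
      have : w (n + (k + 1)) - w n = (w (n + k + 1) - w (n + k)) + (w (n + k) - w n) := by
        rw [← add_assoc]; ring
      rw [this, hstep]
      exact dvd_add (Dvd.dvd.mul_left (pow_dvd_pow _ (by omega)) _) ih
  have hH : IsHausdorff (maximalIdeal A) (A ⧸ Ideal.span {x ^ n}) := inferInstance
  rw [← Ideal.mem_span_singleton, ← Ideal.Quotient.eq_zero_iff_mem]
  refine hH.haus _ fun k => ?_
  rw [SModEq.zero]
  have h1 : Ideal.Quotient.mk (Ideal.span {x ^ n}) (w n) =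
      Ideal.Quotient.mk (Ideal.span {x ^ n}) (w (n + k)) := by
    rw [eq_comm, Ideal.Quotient.eq, Ideal.mem_span_singleton]
    exact hdiff k
  rw [h1]
  have h2 : w (n + k) • (1 : A ⧸ Ideal.span {x ^ n}) ∈
      (maximalIdeal A ^ k • ⊤ : Submodule A (A ⧸ Ideal.span {x ^ n})) :=
    Submodule.smul_mem_smul (Ideal.pow_le_pow_right (by omega) (hwm (n + k))) trivial
  rwa [Algebra.smul_def, mul_one] at h2

end PowerSeries

/-! ### Divisible chains of integral fractions. -/

namespace Polynomial

/-- φ need not be injective: the integral equation, cleared of denominators, already holds in A and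
can be pushed along φ. -/
lemma isIntegralElem_div_of_isIntegral {A : Type*} [CommRing A] {K : Type*} [Field K]
    [Algebra A K] [FaithfulSMul A K] {L : Type*} [Field L] (φ : A →+* L) {a b : A} (hb : φ b ≠ 0)
    (hbK : algebraMap A K b ≠ 0)
    (h : IsIntegral A (algebraMap A K a / algebraMap A K b)) : φ.IsIntegralElem (φ a / φ b) := by
  obtain ⟨p, hp, hp0⟩ := h
  refine ⟨p, hp, ?_⟩
  have h1 := scaleRoots_eval₂_mul (p := p) (algebraMap A K)
    (algebraMap A K a / algebraMap A K b) b
  rw [hp0, mul_zero, mul_div_cancel₀ _ hbK, eval₂_at_apply,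
    FaithfulSMul.algebraMap_eq_zero_iff] at h1
  have h2 := scaleRoots_eval₂_mul (p := p) φ (φ a / φ b) b
  rw [mul_div_cancel₀ _ hb, eval₂_at_apply, h1, map_zero] at h2
  exact (mul_eq_zero.1 h2.symm).resolve_left (pow_ne_zero _ hb)

/-- Once denominators are cleared in the monic equation, every term but the leading one is divisible
by x. -/
lemma exists_dvd_pow_of_isIntegral_div {D : Type*} [CommRing D] {L : Type*} [Field L]
    [Algebra D L] [FaithfulSMul D L] {t x : D} (hx : algebraMap D L x ≠ 0)
    (h : IsIntegral D (algebraMap D L t / algebraMap D L x)) : ∃ n, x ∣ t ^ n := by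
  obtain ⟨p, hp, hp0⟩ := h
  have h1 := scaleRoots_eval₂_mul (p := p) (algebraMap D L)
    (algebraMap D L t / algebraMap D L x) x
  rw [hp0, mul_zero, mul_div_cancel₀ _ hx, eval₂_at_apply,
    FaithfulSMul.algebraMap_eq_zero_iff, eval_eq_sum_range, natDegree_scaleRoots,
    Finset.sum_range_succ, coeff_scaleRoots_natDegree, hp.leadingCoeff, one_mul] at h1
  refine ⟨p.natDegree, (dvd_add_right (Finset.dvd_sum fun i hi => ?_)).1 (h1 ▸ dvd_zero x)⟩
  rw [coeff_scaleRoots]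
  have : p.natDegree - i ≠ 0 := by have := Finset.mem_range.1 hi; omega
  exact Dvd.dvd.mul_right (Dvd.dvd.mul_left (dvd_pow_self x this) _) _

end Polynomial

/-- In a Noetherian domain, localised at a prime minimal over a principal ideal `(x)`, every
nonzero element divides a power of `x`. -/
lemma Ideal.exists_mul_pow_mem_span_of_mem_minimalPrimes {D : Type*} [CommRing D] [IsDomain D]
    [IsNoetherianRing D] {x c : D} (hc : c ≠ 0) {q : Ideal D}
    (hq : q ∈ (Ideal.span {x}).minimalPrimes) : ∃ t ∉ q, ∃ n, c ∣ t * x ^ n := by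
  have hqp : q.IsPrime := hq.1.1
  -- Otherwise some prime P contains c and avoids both x and the complement of q. Then P ⊊ q, and
  -- Krull's theorem forces P = 0, against c ≠ 0.
  by_contra! hcon
  have hdis : Disjoint (Ideal.span {c} : Set D)
      (q.primeCompl ⊔ Submonoid.powers x : Submonoid D) := by
    rw [Set.disjoint_left]
    intro z hz hz2
    obtain ⟨t, ht, _, ⟨n, rfl⟩, rfl⟩ := Submonoid.mem_sup.1 hz2
    exact hcon t ht n (Ideal.mem_span_singleton.1 hz)
  obtain ⟨P, hP, hcP, hPd⟩ := Ideal.exists_le_prime_disjoint _ _ hdis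
  rw [Set.disjoint_left] at hPd
  have hPq : P < q := by
    refine lt_of_le_of_ne (fun z hz => ?_) ?_
    · by_contra hzq
      exact hPd hz (Submonoid.mem_sup_left (show z ∈ q.primeCompl from hzq))
    · rintro rfl
      exact hPd (hq.1.2 (Ideal.mem_span_singleton_self x))
        (Submonoid.mem_sup_right (Submonoid.mem_powers x))
  have h0 := (Ideal.height_le_iff (n := 1)).1
    (Ideal.height_le_one_of_isPrincipal_of_mem_minimalPrimes _ _ hq) P hP hPq
  rw [Nat.cast_one, Order.lt_one_iff, Ideal.height_eq_zero_iff,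
    IsDomain.minimalPrimes_eq_singleton_bot, Set.mem_singleton_iff] at h0
  subst h0
  exact hc (by simpa using hcP)

/-- A Mittag-Leffler argument: if the kernel of multiplication by `x` is Artinian on an `x`-power
torsion module that is not killed by a power of `x`, there is a nontrivial `x`-divisible chain. -/
lemma exists_divisible_chain {R : Type u} [CommRing R] {H : Type v} [AddCommGroup H] [Module R H]
    (x : R) [IsArtinian R (LinearMap.ker (LinearMap.lsmul R H x))]
    (htors : ∀ h : H, ∃ n, x ^ n • h = 0) (hne : ∀ n, ∃ h : H, x ^ n • h ≠ 0) :
    ∃ g : ℕ → H, g 0 ≠ 0 ∧ x • g 0 = 0 ∧ ∀ i, x • g (i + 1) = g i := by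
  set D : ℕ → Submodule R H := fun n => LinearMap.range (LinearMap.lsmul R H (x ^ n)) with hD
  have hanti : ∀ {i j : ℕ}, i ≤ j → D j ≤ D i := by
    rintro i j hij _ ⟨g, rfl⟩
    refine ⟨x ^ (j - i) • g, ?_⟩
    simp only [LinearMap.lsmul_apply, smul_smul, ← pow_add]
    rw [Nat.add_sub_cancel' hij]
  set E := LinearMap.ker (LinearMap.lsmul R H x) with hE
  -- The submodules xⁿH ∩ ker x stabilise, so their elements at stage i₀ are divisible by every
  -- power of x.
  obtain ⟨i₀, hi₀⟩ := IsArtinian.monotone_stabilizes (R := R) (M := E)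
    ⟨fun n => OrderDual.toDual ((D n).comap E.subtype),
      fun i j hij => OrderDual.toDual_le_toDual.2 (Submodule.comap_mono (hanti hij))⟩
  have hstab : ∀ j, i₀ ≤ j → ∀ h, x • h = 0 → h ∈ D i₀ → h ∈ D j := by
    intro j hj h hx hh
    have h1 : (D i₀).comap E.subtype = (D j).comap E.subtype := hi₀ j hj
    have h2 : (⟨h, hx⟩ : E) ∈ (D i₀).comap E.subtype := hh
    rw [h1] at h2
    exact h2
  have hstart : ∃ h, h ≠ 0 ∧ x • h = 0 ∧ ∀ j, h ∈ D j := by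
    obtain ⟨h, hh⟩ := hne i₀
    classical
    have hex : ∃ n, x ^ n • (x ^ i₀ • h) = 0 := htors _
    obtain ⟨k, hk⟩ : ∃ k, Nat.find hex = k + 1 := by
      refine Nat.exists_eq_succ_of_ne_zero fun h0 => hh ?_
      have := Nat.find_spec hex
      rwa [h0, pow_zero, one_smul] at this
    have hx0 : x • x ^ k • x ^ i₀ • h = 0 := by
      have := Nat.find_spec hex
      rwa [hk, pow_succ', mul_smul] at this
    refine ⟨x ^ k • x ^ i₀ • h, Nat.find_min hex (by omega), hx0, fun j => ?_⟩
    have hi : x ^ k • x ^ i₀ • h ∈ D i₀ := Submodule.smul_mem _ _ ⟨h, rfl⟩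
    rcases le_total i₀ j with hj | hj
    · exact hstab j hj _ hx0 hi
    · exact hanti hj hi
  have hnext : ∀ h : {h : H // ∀ j, h ∈ D j}, ∃ g : {h : H // ∀ j, h ∈ D j}, x • g.1 = h.1 := by
    rintro ⟨h, hh⟩
    have hlift : ∀ j, ∃ t ∈ D j, x • t = h := by
      intro j
      obtain ⟨g, hg⟩ := hh (j + 1)
      refine ⟨x ^ j • g, ⟨g, rfl⟩, ?_⟩
      rw [smul_smul, ← pow_succ']
      exact hg
    obtain ⟨t, ht, hxt⟩ := hlift i₀
    refine ⟨⟨t, fun j => ?_⟩, hxt⟩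
    rcases le_total i₀ j with hj | hj
    · obtain ⟨t', ht', hxt'⟩ := hlift j
      have := hstab j hj (t - t') (by rw [smul_sub, hxt, hxt', sub_self])
        (sub_mem ht (hanti hj ht'))
      simpa using add_mem this ht'
    · exact hanti hj ht
  choose nx hnx using hnext
  obtain ⟨h₀, hh₀, hxh₀, hDh₀⟩ := hstart
  exact ⟨fun n => (nx^[n] ⟨h₀, hDh₀⟩).1, hh₀, hxh₀, fun i => by
    beta_reduce; rw [Function.iterate_succ_apply']; exact hnx _⟩

open PowerSeries in
/-- Over an analytically unramified local domain, a sequence of fractions `aₙ / xⁿ⁺¹` that is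
compatible under multiplication by `x` cannot consist of integral elements, unless the first one
is zero modulo `A`. -/
lemma dvd_of_isIntegral_div {A : Type u} [CommRing A] [IsDomain A] [IsLocalRing A]
    [IsNoetherianRing A]
    (hred : ∀ w : ℕ → A, (∀ n, w (n + 1) - w n ∈ maximalIdeal A ^ n) →
      (∀ n, w n ^ 2 ∈ maximalIdeal A ^ n) → ∀ n, w n ∈ maximalIdeal A ^ n)
    {K : Type v} [Field K] [Algebra A K] [IsFractionRing A K] {x : A} (hx : x ≠ 0)
    (hxm : x ∈ maximalIdeal A) (a r : ℕ → A) (ha : ∀ n, a (n + 1) = a n + x ^ (n + 1) * r n)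
    (hint : ∀ n, IsIntegral A (algebraMap A K (a n) / algebraMap A K (x ^ (n + 1)))) :
    x ∣ a 0 := by
  by_contra hdvd
  -- f is the x-adic limit of the sequence a: evaluating its truncations at x recovers every `a n`.
  set f : A⟦X⟧ := PowerSeries.mk fun n => Nat.casesOn n (a 0) r with hf
  have hfa : ∀ n, (trunc (n + 1) f).eval x = a n := by
    intro n
    induction n with
    | zero => rw [eval_trunc_succ]; simp [hf]
    | succ n ih =>
      rw [eval_trunc_succ, ih, ha, hf, coeff_mk, mul_comm]
  set I : Ideal A⟦X⟧ := Ideal.span {X - C x} with hI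
  have hfI : f ∉ I := fun h => hdvd (by
    have := (mem_span_X_sub_C_iff hx).1 h 1
    rwa [hfa 0, pow_one] at this)
  -- Reducedness of the completion and regularity of x on it give a prime P over X − x that contains
  -- neither x nor f.
  have hxf : C x * f ∉ I.radical := by
    rw [(isRadical_span_X_sub_C hx hxm hred).radical]
    exact fun h => hfI (mem_span_X_sub_C_of_C_mul_mem hx h)
  obtain ⟨P, ⟨hIP, hP⟩, hxfP⟩ : ∃ P : Ideal A⟦X⟧, (I ≤ P ∧ P.IsPrime) ∧ C x * f ∉ P := by
    rw [Ideal.radical_eq_sInf, Submodule.mem_sInf] at hxf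
    push Not at hxf
    obtain ⟨P, hP, h⟩ := hxf
    exact ⟨P, hP, h⟩
  let π := Ideal.Quotient.mk P
  have hπX : π X = π (C x) := by
    rw [← sub_eq_zero, ← map_sub, Ideal.Quotient.eq_zero_iff_mem]
    exact hIP (Ideal.mem_span_singleton_self _)
  have hc0 : π f ≠ 0 := fun h => hxfP (P.mul_mem_left _ (Ideal.Quotient.eq_zero_iff_mem.1 h))
  have hx0 : π (C x) ≠ 0 := fun h => hxfP (P.mul_mem_right _ (Ideal.Quotient.eq_zero_iff_mem.1 h))
  have hnu : Ideal.span {π (C x)} ≠ ⊤ := by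
    intro h
    obtain ⟨g, hg⟩ := Ideal.mem_span_singleton.1 ((Ideal.eq_top_iff_one _).1 h)
    obtain ⟨g, rfl⟩ := Ideal.Quotient.mk_surjective g
    have hmem : (1 : A⟦X⟧) - X * g ∈ P := by
      rw [← Ideal.Quotient.eq_zero_iff_mem, map_sub, map_mul, sub_eq_zero, map_one, hg]
      exact congrArg (· * π g) hπX.symm
    refine hP.ne_top (Ideal.eq_top_of_isUnit_mem _ hmem ?_)
    rw [isUnit_iff_constantCoeff]
    simp
  obtain ⟨M, hM, hxM⟩ := Ideal.exists_le_maximal _ hnu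
  have := hM.isPrime
  obtain ⟨q, hq, -⟩ := Ideal.exists_minimalPrimes_le hxM
  obtain ⟨t, ht, n, e, hte⟩ := Ideal.exists_mul_pow_mem_span_of_mem_minimalPrimes hc0 hq
  let L := FractionRing (A⟦X⟧ ⧸ P)
  have hxL : algebraMap (A⟦X⟧ ⧸ P) L (π (C x)) ≠ 0 := by
    rwa [Ne, FaithfulSMul.algebraMap_eq_zero_iff]
  obtain ⟨d, hd⟩ : ∃ d, π f = π (C (a n)) + π (C x) ^ (n + 1) * d := by
    obtain ⟨u, hu, v, hv, huv⟩ := Submodule.mem_sup.1 (sub_C_eval_trunc_mem x (n + 1) f)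
    obtain ⟨d, rfl⟩ := Ideal.mem_span_singleton.1 hv
    refine ⟨π d, ?_⟩
    have h1 := congrArg π huv
    rw [hfa, map_add, map_sub, Ideal.Quotient.eq_zero_iff_mem.2 (hIP hu), map_mul, map_pow, hπX,
      zero_add] at h1
    rw [h1]
    ring
  have hAL : IsIntegral (A⟦X⟧ ⧸ P) (algebraMap (A⟦X⟧ ⧸ P) L (π (C (a n))) /
      algebraMap (A⟦X⟧ ⧸ P) L (π (C x)) ^ (n + 1)) := by
    let φ : A →+* L := (algebraMap (A⟦X⟧ ⧸ P) L).comp (π.comp (C : A →+* A⟦X⟧))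
    have hφ := Polynomial.isIntegralElem_div_of_isIntegral φ (b := x ^ (n + 1))
      (by rw [map_pow]; exact pow_ne_zero _ hxL)
      (by
        rw [Ne, FaithfulSMul.algebraMap_eq_zero_iff]
        exact pow_ne_zero _ hx) (hint n)
    obtain ⟨p, hp, hp0⟩ := hφ
    refine ⟨p.map (π.comp C), hp.map _, ?_⟩
    rw [Polynomial.eval₂_map]
    rw [map_pow] at hp0
    exact hp0
  -- f/xⁿ⁺¹ = aₙ/xⁿ⁺¹ + d is integral modulo P, and t xⁿ = f e makes t/x a multiple of it. Hence x
  -- divides a power of t, contradicting t ∉ q.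
  have hfL : IsIntegral (A⟦X⟧ ⧸ P) (algebraMap (A⟦X⟧ ⧸ P) L t /
      algebraMap (A⟦X⟧ ⧸ P) L (π (C x))) := by
    have heq : algebraMap (A⟦X⟧ ⧸ P) L t / algebraMap (A⟦X⟧ ⧸ P) L (π (C x)) =
        algebraMap (A⟦X⟧ ⧸ P) L e * (algebraMap (A⟦X⟧ ⧸ P) L (π (C (a n))) /
          algebraMap (A⟦X⟧ ⧸ P) L (π (C x)) ^ (n + 1) + algebraMap (A⟦X⟧ ⧸ P) L d) := by
      have h1 := congrArg (algebraMap (A⟦X⟧ ⧸ P) L) hte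
      rw [hd] at h1
      simp only [map_mul, map_add, map_pow] at h1
      rw [div_eq_iff hxL, mul_assoc, add_mul, pow_succ, ← div_div, div_mul_cancel₀ _ hxL]
      refine mul_right_cancel₀ (pow_ne_zero n hxL) (h1.trans ?_)
      rw [mul_assoc, add_mul (_ / _), div_mul_cancel₀ _ (pow_ne_zero n hxL)]
      ring
    rw [heq]
    exact isIntegral_algebraMap.mul (hAL.add isIntegral_algebraMap)
  obtain ⟨k, hk⟩ := Polynomial.exists_dvd_pow_of_isIntegral_div hxL hfL
  have hqp : q.IsPrime := hq.1.1
  exact ht (hqp.mem_of_pow_mem k (hq.1.2 (Ideal.mem_span_singleton.2 hk)))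

/-- If every element of a finite module is killed by a power of `y`, a single power of `y`
kills the module. -/
lemma Module.Finite.exists_pow_smul_eq_zero {R : Type*} [CommRing R] {M : Type*} [AddCommGroup M]
    [Module R M] [Module.Finite R M] {y : R} (h : ∀ m : M, ∃ k, y ^ k • m = 0) :
    ∃ k, ∀ m : M, y ^ k • m = 0 := by
  obtain ⟨s, hs⟩ := Module.Finite.fg_top (R := R) (M := M)
  choose k hk using h
  refine ⟨s.sup k, fun m => ?_⟩
  have hm : m ∈ Submodule.span R (s : Set M) := hs ▸ trivial
  induction hm using Submodule.span_induction with
  | mem z hz =>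
    obtain ⟨j, hj⟩ := Nat.exists_eq_add_of_le (Finset.le_sup (f := k) hz)
    rw [hj, pow_add, mul_comm, mul_smul, hk, smul_zero]
  | zero => rw [smul_zero]
  | add a b _ _ ha hb => rw [smul_add, ha, hb, add_zero]
  | smul r a _ ha => rw [smul_comm, ha, smul_zero]

/-! ### Boundedness of the ideal transform over a domain. -/

namespace ParameterPair

open LocalCohomologyOne

lemma isArtinian_ker_lsmul_transformQuotient {R : Type u} [CommRing R] [IsLocalRing R]
    [IsNoetherianRing R] {x y : R} (hx : x ∈ nonZeroDivisors R)
    (hrad : (Ideal.span {x, y}).radical = maximalIdeal R) :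
    IsArtinian R (LinearMap.ker (LinearMap.lsmul R (TransformQuotient x y) x)) := by
  set E := LinearMap.ker (LinearMap.lsmul R (TransformQuotient x y) x) with hE
  let π := ((1 : Submodule R (FractionRing R)).submoduleOf (idealTransform x y)).mkQ
  let T : Submodule R (idealTransform x y) := E.comap π
  have hT : ∀ s : T, (LinearMap.lsmul R (FractionRing R) x ∘ₗ (idealTransform x y).subtype ∘ₗ
      T.subtype) s ∈ (1 : Submodule R (FractionRing R)) := by
    rintro ⟨s, hs⟩
    have : (Submodule.Quotient.mk (x • s) : TransformQuotient x y) = 0 := hs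
    rw [transformQuotient_mk_eq_zero] at this
    exact this
  have hone : IsNoetherian R (1 : Submodule R (FractionRing R)) := by
    rw [Submodule.one_eq_range]
    infer_instance
  -- Multiplication by x embeds the preimage of the kernel in the ideal transform into R.
  have hTN : IsNoetherian R T := by
    refine isNoetherian_of_injective (LinearMap.codRestrict _ _ hT) ?_
    exact fun s t h =>
      Subtype.ext (Subtype.ext (smul_fractionRing_injective hx (congrArg Subtype.val h)))
  have hEN : IsNoetherian R E := by
    refine isNoetherian_of_surjective (LinearMap.restrict π (p := T) (q := E) fun s hs => hs) ?_
    rw [LinearMap.range_eq_top]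
    rintro ⟨h, hh⟩
    obtain ⟨s, rfl⟩ := Submodule.mkQ_surjective _ h
    exact ⟨⟨s, hh⟩, rfl⟩
  obtain ⟨k, hk⟩ := Module.Finite.exists_pow_smul_eq_zero (R := R) (M := E) (y := y) (by
    rintro ⟨h, hh⟩
    obtain ⟨s, rfl⟩ := Submodule.mkQ_surjective _ h
    obtain ⟨n, -, hn⟩ := s.2
    refine ⟨n, Subtype.ext ?_⟩
    exact (transformQuotient_mk_eq_zero (y ^ n • s)).2 hn)
  obtain ⟨t, ht⟩ : ∃ t, maximalIdeal R ^ t ≤ Ideal.span {x, y ^ k} := by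
    refine Ideal.exists_pow_le_of_le_radical_of_fg ?_ (IsNoetherian.noetherian _)
    rw [← hrad]
    refine Ideal.radical_le_radical_iff.2 (Ideal.span_le.2 ?_)
    rintro z (rfl | rfl)
    · exact Ideal.le_radical (Ideal.subset_span (by simp))
    · exact ⟨k, Ideal.subset_span (by simp)⟩
  have hlen := length_ne_top_of_smul_eq_zero (isFiniteLength_quotient_of_pow_le ht) (M := E) (by
    intro a ha m
    obtain ⟨b, c, rfl⟩ := Ideal.mem_span_pair.1 ha
    have hxm : x • m = 0 := Subtype.ext m.2
    rw [add_smul, mul_smul, mul_smul, hk, hxm, smul_zero, smul_zero, add_zero])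
  exact (isFiniteLength_iff_isNoetherian_isArtinian.1 (Module.length_ne_top_iff.1 hlen)).2

/-- The ideal transform of an analytically unramified local domain of dimension two with catenary
polynomial ring is bounded. -/
lemma exists_pow_smul_mem_range_toTransform {A : Type u} [CommRing A] [IsDomain A] [IsLocalRing A]
    [IsNoetherianRing A] (hdim : ringKrullDim A = 2) (hcat : IsCatenaryRing (Polynomial A))
    (hred : ∀ w : ℕ → A, (∀ n, w (n + 1) - w n ∈ maximalIdeal A ^ n) →
      (∀ n, w n ^ 2 ∈ maximalIdeal A ^ n) → ∀ n, w n ∈ maximalIdeal A ^ n)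
    {x y : A} (hrad : (Ideal.span {x, y}).radical = maximalIdeal A) (hx : x ≠ 0) :
    ∃ k, ∀ s : idealTransform x y, x ^ k • s ∈ LinearMap.range (toTransform x y) := by
  by_contra! hcon
  have hx' : x ∈ nonZeroDivisors A := mem_nonZeroDivisors_of_ne_zero hx
  have hxm : x ∈ maximalIdeal A := hrad ▸ Ideal.le_radical (Ideal.subset_span (by simp))
  have := isArtinian_ker_lsmul_transformQuotient hx' hrad
  -- If no power of x worked, S/A would contain a divisible chain. Its lifts sₙ are integral
  -- fractions aₙ/xⁿ⁺¹.
  obtain ⟨g, hg0, hxg0, hg⟩ := exists_divisible_chain (H := TransformQuotient x y) x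
    (by
      intro h
      obtain ⟨s, rfl⟩ := Submodule.mkQ_surjective _ h
      obtain ⟨n, hn, -⟩ := s.2
      exact ⟨n, (transformQuotient_mk_eq_zero (x ^ n • s)).2 hn⟩)
    (by
      intro n
      obtain ⟨s, hs⟩ := hcon n
      refine ⟨Submodule.Quotient.mk s, fun h => hs ?_⟩
      rw [mem_range_toTransform]
      exact (transformQuotient_mk_eq_zero (x ^ n • s)).1 h)
  choose s hs using fun i => Submodule.mkQ_surjective _ (g i)
  have hs' : ∀ i, Submodule.Quotient.mk (s i) = g i := hs
  have h0 : ((x • s 0 : idealTransform x y) : FractionRing A) ∈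
      (1 : Submodule A (FractionRing A)) := by
    rw [← transformQuotient_mk_eq_zero, Submodule.Quotient.mk_smul, hs', hxg0]
  have hr : ∀ i, ((x • s (i + 1) - s i : idealTransform x y) : FractionRing A) ∈
      (1 : Submodule A (FractionRing A)) := by
    intro i
    rw [← transformQuotient_mk_eq_zero, Submodule.Quotient.mk_sub, Submodule.Quotient.mk_smul,
      hs', hs', hg, sub_self]
  choose r hr using fun i => Submodule.mem_one.1 (hr i)
  have hinj := IsFractionRing.injective A (FractionRing A)
  have hxK : algebraMap A (FractionRing A) x ≠ 0 := (map_ne_zero_iff _ hinj).2 hx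
  have hr' : ∀ i, algebraMap A (FractionRing A) (r i) =
      algebraMap A (FractionRing A) x * (s (i + 1) : FractionRing A) - s i := by
    intro i
    rw [hr, Submodule.coe_sub, Submodule.coe_smul, Algebra.smul_def]
  have ha : ∀ n, ∃ a : A, algebraMap A (FractionRing A) a =
      algebraMap A (FractionRing A) x ^ (n + 1) * (s n : FractionRing A) := by
    intro n
    induction n with
    | zero =>
      obtain ⟨a, ha⟩ := Submodule.mem_one.1 h0
      refine ⟨a, ?_⟩
      rw [ha, Submodule.coe_smul, Algebra.smul_def, zero_add, pow_one]
    | succ n ih =>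
      obtain ⟨a, ha⟩ := ih
      refine ⟨a + x ^ (n + 1) * r n, ?_⟩
      rw [map_add, map_mul, map_pow, ha, hr']
      ring
  choose a ha using ha
  have hstep : ∀ n, a (n + 1) = a n + x ^ (n + 1) * r n := by
    intro n
    apply hinj
    rw [map_add, map_mul, map_pow, ha, ha, hr']
    ring
  have hint : ∀ n, IsIntegral A (algebraMap A (FractionRing A) (a n) /
      algebraMap A (FractionRing A) (x ^ (n + 1))) := by
    intro n
    have hsn : algebraMap A (FractionRing A) (a n) / algebraMap A (FractionRing A) (x ^ (n + 1)) =
        (s n : FractionRing A) := by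
      rw [ha, map_pow, mul_div_cancel_left₀ _ (pow_ne_zero _ hxK)]
    rw [hsn]
    obtain ⟨k, hk1, hk2⟩ := (s n).2
    obtain ⟨b, hb⟩ := Submodule.mem_one.1 hk1
    obtain ⟨c, hc⟩ := Submodule.mem_one.1 hk2
    refine isIntegral_of_pow_smul_mem hdim hcat hrad (n := k) (a := b) (b := c) ?_ ?_
    · rw [hb, Algebra.smul_def, map_pow]
    · rw [hc, Algebra.smul_def, map_pow]
  -- Since a₀ = x s₀, divisibility of a₀ by x puts s₀ in A, contradicting g₀ ≠ 0.
  obtain ⟨b, hb⟩ := dvd_of_isIntegral_div hred hx hxm a r hstep hint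
  refine hg0 ?_
  rw [← hs', transformQuotient_mk_eq_zero, Submodule.mem_one]
  refine ⟨b, ?_⟩
  have h1 := ha 0
  rw [hb, map_mul, zero_add, pow_one] at h1
  exact mul_left_cancel₀ hxK h1

end ParameterPair

/-! ### Uniform saturation bounds and their dévissage. -/

namespace ParameterPair

open LocalCohomologyOne

section Saturation

variable {R : Type u} [CommRing R]

/-- A uniform power of `x` kills the `y`-power torsion of `M / xⁿ M` for all `n`. -/
def SaturationBounded (x y : R) (M : Type v) [AddCommGroup M] [Module R M] : Prop :=
  ∃ N : ℕ, ∀ (n k : ℕ) (m m' : M), y ^ k • m = x ^ n • m' → ∃ m'', x ^ N • m = x ^ n • m''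

variable {x y : R} {M M' T : Type*} [AddCommGroup M] [Module R M] [AddCommGroup M'] [Module R M']
  [AddCommGroup T] [Module R T]

lemma SaturationBounded.of_linearEquiv (e : M ≃ₗ[R] M') (h : SaturationBounded x y M) :
    SaturationBounded x y M' := by
  obtain ⟨N, hN⟩ := h
  refine ⟨N, fun n k m m' hm => ?_⟩
  obtain ⟨m'', hm''⟩ := hN n k (e.symm m) (e.symm m') (by rw [← map_smul, hm, map_smul])
  exact ⟨e m'', by rw [← map_smul, ← hm'', map_smul, e.apply_symm_apply]⟩

/-- xⁿM' ∩ M may exceed xⁿM, but the x-power torsion of the Noetherian module M'/M is killed by one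
power of x, which is added to the bound. -/
lemma SaturationBounded.of_injective [IsNoetherian R M']
    (f : M →ₗ[R] M') (hf : Function.Injective f) (h : SaturationBounded x y M') :
    SaturationBounded x y M := by
  obtain ⟨N, hN⟩ := h
  let G : Submodule R (M' ⧸ LinearMap.range f) :=
    { carrier := {u | ∃ n, x ^ n • u = 0}
      add_mem' := by
        rintro a b ⟨n, hn⟩ ⟨k, hk⟩
        refine ⟨n + k, ?_⟩
        rw [smul_add, pow_add, mul_smul (x ^ n) _ b, hk, mul_comm, mul_smul, hn, smul_zero,
          smul_zero, add_zero]
      zero_mem' := ⟨0, smul_zero _⟩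
      smul_mem' := by
        rintro r a ⟨n, hn⟩
        exact ⟨n, by rw [smul_comm, hn, smul_zero]⟩ }
  obtain ⟨N', hN'⟩ := Module.Finite.exists_pow_smul_eq_zero (R := R) (M := G) (y := x) (by
    rintro ⟨u, n, hn⟩
    exact ⟨n, Subtype.ext hn⟩)
  refine ⟨N' + N, fun n k m m' hm => ?_⟩
  obtain ⟨u, hu⟩ := hN n k (f m) (f m') (by rw [← map_smul, hm, map_smul])
  have hG : (LinearMap.range f).mkQ u ∈ G := by
    refine ⟨n, ?_⟩
    rw [← map_smul, ← hu, ← map_smul]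
    exact (Submodule.Quotient.mk_eq_zero _).2 ⟨_, rfl⟩
  have h0 : (LinearMap.range f).mkQ (x ^ N' • u) = 0 := congrArg Subtype.val (hN' ⟨_, hG⟩)
  obtain ⟨m'', hm''⟩ := (Submodule.Quotient.mk_eq_zero _).1 h0
  refine ⟨m'', hf ?_⟩
  rw [map_smul, map_smul, hm'', pow_add, mul_smul, hu, smul_comm]

/-- As x is injective on M/T, xⁿM ∩ T = xⁿT. The bound for M/T moves the problem into T, and the two
exponents add. -/
lemma SaturationBounded.of_submodule_quotient (T : Submodule R M)
    (hx : ∀ m : M ⧸ T, x • m = 0 → m = 0) (h : SaturationBounded x y T)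
    (h' : SaturationBounded x y (M ⧸ T)) : SaturationBounded x y M := by
  obtain ⟨N, hN⟩ := h
  obtain ⟨N', hN'⟩ := h'
  have hxn : ∀ n, ∀ m : M, x ^ n • m ∈ T → m ∈ T := by
    intro n
    induction n with
    | zero => simp
    | succ n ih =>
      intro m hm
      rw [pow_succ, mul_smul] at hm
      exact (Submodule.Quotient.mk_eq_zero T).1 (hx _ ((Submodule.Quotient.mk_eq_zero T).2 (ih _ hm)))
  refine ⟨N + N', fun n k m m' hm => ?_⟩
  obtain ⟨u, hu⟩ := hN' n k (T.mkQ m) (T.mkQ m') (by rw [← map_smul, hm, map_smul])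
  obtain ⟨u, rfl⟩ := T.mkQ_surjective u
  have ht : x ^ N' • m - x ^ n • u ∈ T := by
    rw [← Submodule.Quotient.mk_eq_zero]
    exact sub_eq_zero.2 hu
  have heq : y ^ k • (x ^ N' • m - x ^ n • u) = x ^ n • (x ^ N' • m' - y ^ k • u) := by
    rw [smul_sub, smul_sub, smul_comm (y ^ k), hm, smul_comm (x ^ N') (x ^ n),
      smul_comm (y ^ k) (x ^ n)]
  have hz : x ^ N' • m' - y ^ k • u ∈ T := hxn n _ (heq ▸ T.smul_mem _ ht)
  obtain ⟨w, hw⟩ := hN n k ⟨_, ht⟩ ⟨_, hz⟩ (Subtype.ext heq)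
  refine ⟨w + x ^ N • u, ?_⟩
  have := congrArg Subtype.val hw
  simp only [Submodule.coe_smul, smul_sub] at this
  rw [smul_add, ← this, pow_add, mul_smul, smul_comm (x ^ N) (x ^ n), sub_add_cancel]

end Saturation

/-! ### Rank-one submodules attached to an associated prime. -/

section RankOne

variable {R : Type u} [CommRing R] {M : Type v} [AddCommGroup M] [Module R M]

/-- For an element `m` with prime annihilator `p`, the elements killed by `p` that are torsion
modulo `R m` over `R / p`. -/
def rankOneSubmodule (m : M) [hp : (Ideal.torsionOf R M m).IsPrime] :
    Submodule R M where
  carrier := {t | (∀ a ∈ Ideal.torsionOf R M m, a • t = 0) ∧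
    ∃ a ∉ Ideal.torsionOf R M m, a • t ∈ Submodule.span R {m}}
  add_mem' := by
    rintro s t ⟨hs, a, ha, has⟩ ⟨ht, b, hb, hbt⟩
    refine ⟨fun c hc => by rw [smul_add, hs c hc, ht c hc, add_zero], a * b,
      fun h => (hp.mem_or_mem h).elim ha hb, ?_⟩
    rw [smul_add, mul_smul a b t, mul_comm, mul_smul]
    exact add_mem (Submodule.smul_mem _ _ has) (Submodule.smul_mem _ _ hbt)
  zero_mem' := ⟨fun _ _ => smul_zero _, 1, hp.one_notMem, by simp⟩
  smul_mem' := by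
    rintro r t ⟨ht, a, ha, hat⟩
    refine ⟨fun c hc => by rw [smul_comm, ht c hc, smul_zero], a, ha, ?_⟩
    rw [smul_comm]
    exact Submodule.smul_mem _ _ hat

variable (m : M) [hp : (Ideal.torsionOf R M m).IsPrime]

lemma self_mem_rankOneSubmodule : m ∈ rankOneSubmodule (R := R) m :=
  ⟨fun _ ha => ha, 1, hp.one_notMem, by simp⟩

/-- The product of the denominators of finitely many generators multiplies the submodule into R m ≅
R/p, injectively by torsion-freeness. -/
lemma exists_injective_rankOneSubmodule [IsNoetherian R M]
    (htf : ∀ t ∈ rankOneSubmodule (R := R) m,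
      ∀ a ∉ Ideal.torsionOf R M m, a • t = 0 → t = 0) :
    ∃ f : rankOneSubmodule (R := R) m →ₗ[R] R ⧸ Ideal.torsionOf R M m,
      Function.Injective f := by
  obtain ⟨G, hG⟩ := (IsNoetherian.noetherian (rankOneSubmodule (R := R) m) : Submodule.FG _)
  have hGm : ∀ g : G, (g : M) ∈ rankOneSubmodule (R := R) m := fun g =>
    hG ▸ Submodule.subset_span g.2
  choose c hc hcm using fun g => (hGm g).2
  have ha : (∏ g, c g) ∉ Ideal.torsionOf R M m := by
    intro h
    obtain ⟨g, -, hg⟩ := hp.prod_mem_iff.1 h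
    exact hc g hg
  have hmem : ∀ t ∈ rankOneSubmodule (R := R) m, (∏ g, c g) • t ∈ Submodule.span R {m} := by
    intro t ht
    rw [← hG] at ht
    induction ht using Submodule.span_induction with
    | mem z hz =>
      obtain ⟨d, hd⟩ := Finset.dvd_prod_of_mem c (Finset.mem_univ (⟨z, hz⟩ : G))
      rw [hd, mul_comm, mul_smul]
      exact Submodule.smul_mem _ _ (hcm ⟨z, hz⟩)
    | zero => simp
    | add s t _ _ hs ht => rw [smul_add]; exact add_mem hs ht
    | smul r t _ ht => rw [smul_comm]; exact Submodule.smul_mem _ _ ht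
  let e := Ideal.quotTorsionOfEquivSpanSingleton R M m
  let f₀ : rankOneSubmodule (R := R) m →ₗ[R] Submodule.span R {m} :=
    LinearMap.codRestrict _ ((LinearMap.lsmul R M (∏ g, c g)) ∘ₗ Submodule.subtype _)
      fun t => hmem _ t.2
  refine ⟨e.symm.toLinearMap ∘ₗ f₀, e.symm.injective.comp ?_⟩
  rw [injective_iff_map_eq_zero]
  intro t ht
  exact Subtype.ext (htf _ t.2 _ ha (congrArg Subtype.val ht))

/-- Dividing by R m alone could create new associated primes; the saturated submodule does not. Let
q be the annihilator of v modulo it and p that of m. If p r v = 0 for some r ∉ q, then q = p.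
Otherwise some generator g of p has Ann(g v) ⊆ q, with equality because p kills the submodule. -/
lemma mem_associatedPrimes_quotient_rankOneSubmodule [IsNoetherianRing R] {q : Ideal R}
    (hq : q ∈ associatedPrimes R (M ⧸ rankOneSubmodule (R := R) m)) :
    q = Ideal.torsionOf R M m ∨ q ∈ associatedPrimes R M := by
  rw [AssociatedPrimes.mem_iff, isAssociatedPrime_iff] at hq ⊢
  obtain ⟨hqp, v, hv⟩ := hq
  obtain ⟨v, rfl⟩ := Submodule.mkQ_surjective _ v
  have hmem : ∀ r, r ∈ q ↔ r • v ∈ rankOneSubmodule (R := R) m := by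
    intro r
    rw [hv, Submodule.mem_colon_singleton, Submodule.mem_bot, ← map_smul]
    exact Submodule.Quotient.mk_eq_zero _
  by_cases h : ∃ r ∉ q, ∀ a ∈ Ideal.torsionOf R M m, a • r • v = 0
  · left
    obtain ⟨r, hr, hrv⟩ := h
    refine le_antisymm (fun s hs => ?_) fun a ha => ?_
    · by_contra hsp
      have h1 : (s * r) • v ∈ rankOneSubmodule (R := R) m := (hmem _).1 (q.mul_mem_right r hs)
      obtain ⟨b, hb, hbs⟩ := h1.2
      refine hr ((hmem r).2 ⟨hrv, b * s, fun h => (hp.mem_or_mem h).elim hb hsp, ?_⟩)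
      rwa [mul_smul, ← mul_smul s r v]
    · refine (hqp.mem_or_mem ((hmem (a * r)).2 ?_)).resolve_right hr
      rw [mul_smul, hrv a ha]
      exact zero_mem _
  · right
    push Not at h
    refine ⟨hqp, ?_⟩
    obtain ⟨G, hG⟩ := (IsNoetherian.noetherian
      (Ideal.torsionOf R M m) : Submodule.FG _)
    have hle : G.inf (fun g => (⊥ : Submodule R M).colon {g • v}) ≤ q := by
      intro r hr
      by_contra hrq
      obtain ⟨a, ha, hav⟩ := h r hrq
      refine hav ?_
      clear hav
      rw [← hG] at ha
      induction ha using Submodule.span_induction with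
      | mem g hg =>
        have := (Finset.inf_le (f := fun g => (⊥ : Submodule R M).colon {g • v}) hg) hr
        rw [Submodule.mem_colon_singleton, Submodule.mem_bot] at this
        rwa [smul_comm]
      | zero => rw [zero_smul]
      | add a b _ _ ha hb => rw [add_smul, ha, hb, add_zero]
      | smul s a _ ha => rw [smul_assoc, ha, smul_zero]
    obtain ⟨g, hg, hgq⟩ := (Ideal.IsPrime.inf_le' hqp).1 hle
    refine ⟨g • v, le_antisymm (fun r hr => ?_) hgq⟩
    rw [Submodule.mem_colon_singleton, Submodule.mem_bot, smul_comm]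
    exact ((hmem r).1 hr).1 g (hG ▸ Submodule.subset_span hg)

end RankOne

end ParameterPair

/-! ### From excellent domains to unmixed excellent rings. -/

namespace ParameterPair

open LocalCohomologyOne

lemma eq_of_le_of_ringKrullDim_quotient_eq {R : Type u} [CommRing R] {n : ℕ}
    {p q : Ideal R} [p.IsPrime] (hpq : p ≤ q)
    (hp : ringKrullDim (R ⧸ p) = n) (hq : ringKrullDim (R ⧸ q) = n) : p = q := by
  refine le_antisymm hpq fun r hr => ?_
  by_contra hrp
  have h0 : Ideal.Quotient.mk p r ∈ nonZeroDivisors (R ⧸ p) :=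
    mem_nonZeroDivisors_of_ne_zero fun h => hrp (Ideal.Quotient.eq_zero_iff_mem.1 h)
  have h1 := ringKrullDim_quotient_succ_le_of_nonZeroDivisor h0
  have h2 : ringKrullDim (R ⧸ q) ≤
      ringKrullDim ((R ⧸ p) ⧸ Ideal.span {Ideal.Quotient.mk p r}) := by
    refine ringKrullDim_le_of_surjective
      (Ideal.Quotient.lift _ (Ideal.Quotient.factor hpq) ?_) ?_
    · intro a ha
      obtain ⟨b, rfl⟩ := Ideal.mem_span_singleton.1 ha
      rw [map_mul, Ideal.Quotient.factor_mk, Ideal.Quotient.eq_zero_iff_mem.2 hr, zero_mul]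
    · exact Ideal.Quotient.lift_surjective_of_surjective _ _
        (Ideal.Quotient.factor_surjective hpq)
  rw [hp] at h1
  rw [hq] at h2
  have h3 : ((n + 1 : ℕ) : WithBot ℕ∞) ≤ n := by
    push_cast
    exact (add_le_add_left h2 1).trans h1
  have : n + 1 ≤ n := by exact_mod_cast h3
  omega

lemma SaturationBounded.of_algebraMap {R A : Type*} [CommRing R] [CommRing A] [Algebra R A]
    {x y : R} (h : SaturationBounded (algebraMap R A x) (algebraMap R A y) A) :
    SaturationBounded x y A := by
  obtain ⟨N, hN⟩ := h
  have hsm : ∀ (r : R) (j : ℕ) (z : A), algebraMap R A r ^ j • z = r ^ j • z := fun r j z => by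
    rw [← map_pow, algebraMap_smul]
  refine ⟨N, fun n k m m' hm => ?_⟩
  obtain ⟨c, hc⟩ := hN n k m m' (by rw [hsm, hsm, hm])
  exact ⟨c, by rw [← hsm, hc, hsm]⟩

/-- The relation bᵏ m = aⁿ m' places the fraction m/aⁿ in the ideal transform. -/
lemma saturationBounded_of_transform {A : Type u} [CommRing A] {a b : A}
    (ha : a ∈ nonZeroDivisors A) {N : ℕ}
    (hN : ∀ s : idealTransform a b, a ^ N • s ∈ LinearMap.range (toTransform a b)) :
    SaturationBounded a b A := by
  refine ⟨N, fun n k m m' hm => ?_⟩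
  rw [smul_eq_mul, smul_eq_mul] at hm
  obtain ⟨s, hs⟩ := exists_smul_eq (pow_mem ha n) (algebraMap A (FractionRing A) m)
  have hs' : b ^ k • s = algebraMap A (FractionRing A) m' := by
    apply smul_fractionRing_injective (pow_mem ha n)
    rw [smul_comm, hs, Algebra.smul_def, Algebra.smul_def, ← map_mul, ← map_mul, hm]
  have hsT : s ∈ idealTransform a b := by
    refine ⟨n + k, ?_, ?_⟩
    · rw [add_comm, pow_add, mul_smul, hs]
      exact Submodule.smul_mem _ _ (Submodule.algebraMap_mem m)
    · rw [pow_add, mul_smul, hs']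
      exact Submodule.smul_mem _ _ (Submodule.algebraMap_mem m')
  obtain ⟨c, hc⟩ := hN ⟨s, hsT⟩
  have hc' : algebraMap A (FractionRing A) c = a ^ N • s := congrArg Subtype.val hc
  refine ⟨c, IsFractionRing.injective A (FractionRing A) ?_⟩
  have h1 : algebraMap A (FractionRing A) (a ^ N * m) = a ^ N • a ^ n • s := by
    rw [map_mul, hs, Algebra.smul_def]
  have h2 : algebraMap A (FractionRing A) (a ^ n * c) = a ^ n • a ^ N • s := by
    rw [map_mul, ← hc', Algebra.smul_def]
  exact h1.trans ((smul_comm (a ^ N) (a ^ n) s).trans h2.symm)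

section Local

variable {R : Type u} [CommRing R] [IsLocalRing R]

instance isLocalRing_quotient_prime (p : Ideal R) [p.IsPrime] : IsLocalRing (R ⧸ p) :=
  IsLocalRing.of_surjective' (Ideal.Quotient.mk p) Ideal.Quotient.mk_surjective

lemma mk_mem_maximalIdeal_pow_iff (p : Ideal R) [p.IsPrime] {n : ℕ} {r : R} :
    Ideal.Quotient.mk p r ∈ maximalIdeal (R ⧸ p) ^ n ↔ r ∈ p ⊔ maximalIdeal R ^ n := by
  rw [← map_maximalIdeal_of_surjective _ (Ideal.Quotient.mk_surjective (I := p)), ← Ideal.map_pow,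
    Ideal.mem_quotient_iff_mem_sup, sup_comm]

variable {x y : R}

lemma radical_span_mk_eq (hrad : (Ideal.span {x, y}).radical = maximalIdeal R) (p : Ideal R)
    [p.IsPrime] :
    (Ideal.span {Ideal.Quotient.mk p x, Ideal.Quotient.mk p y}).radical =
      maximalIdeal (R ⧸ p) := by
  have hxy : Ideal.span {Ideal.Quotient.mk p x, Ideal.Quotient.mk p y} =
      (Ideal.span {x, y}).map (Ideal.Quotient.mk p) := by
    rw [Ideal.map_span, Set.image_pair]
  have hmap := map_maximalIdeal_of_surjective _ (Ideal.Quotient.mk_surjective (I := p))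
  rw [hxy]
  apply le_antisymm
  · rw [Ideal.IsPrime.radical_le_iff inferInstance, ← hmap, ← hrad]
    exact Ideal.map_mono Ideal.le_radical
  · rw [← hmap, ← hrad]
    exact Ideal.map_radical_le _

variable [IsNoetherianRing R]

/-- If x ∈ p, the maximal ideal of R/p is the radical of (y), and Krull's theorem bounds the
dimension by one. -/
lemma notMem_of_ringKrullDim_quotient_eq_two
    (hrad : (Ideal.span {x, y}).radical = maximalIdeal R) {p : Ideal R} [p.IsPrime]
    (hdim : ringKrullDim (R ⧸ p) = 2) : x ∉ p := by
  intro hx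
  have hr := radical_span_mk_eq hrad p
  rw [Ideal.Quotient.eq_zero_iff_mem.2 hx, Ideal.span_insert_zero] at hr
  have hmin : maximalIdeal (R ⧸ p) ∈ (Ideal.span {Ideal.Quotient.mk p y}).minimalPrimes := by
    refine ⟨⟨inferInstance, hr ▸ Ideal.le_radical⟩, ?_⟩
    rintro q ⟨hq, hyq⟩ -
    rw [← hr]
    exact (hq.radical_le_iff).2 hyq
  have h1 := Ideal.height_le_one_of_isPrincipal_of_mem_minimalPrimes _ _ hmin
  have h2 := maximalIdeal_height_eq_ringKrullDim (R := R ⧸ p)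
  have h3 : ((maximalIdeal (R ⧸ p)).height : WithBot ℕ∞) ≤ 1 := by exact_mod_cast h1
  rw [h2, hdim] at h3
  norm_num at h3

lemma smul_eq_zero_of_associatedPrimes {M : Type v} [AddCommGroup M] [Module R M]
    (hrad : (Ideal.span {x, y}).radical = maximalIdeal R)
    (hM : ∀ q ∈ associatedPrimes R M, ringKrullDim (R ⧸ q) = 2) (m : M) (hm : x • m = 0) :
    m = 0 := by
  by_contra hm0
  have : x ∈ ⋃ p ∈ associatedPrimes R M, (p : Set R) := by
    rw [biUnion_associatedPrimes_eq_zero_divisors]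
    exact ⟨m, hm0, hm⟩
  obtain ⟨p, hp, hxp⟩ := Set.mem_iUnion₂.1 this
  have := hp.1
  exact notMem_of_ringKrullDim_quotient_eq_two hrad (hM p hp) hxp

/-- This is reducedness of the completion of R/p. The sequence is lifted to a Cauchy sequence in R
and transported to the localization at the maximal ideal, where the G-ring condition is stated. -/
lemma mem_maximalIdeal_pow_of_isExcellentRing (hexc : IsExcellentRing R) (p : Ideal R) [p.IsPrime]
    (w : ℕ → R ⧸ p) (hw : ∀ n, w (n + 1) - w n ∈ maximalIdeal (R ⧸ p) ^ n)
    (hsq : ∀ n, w n ^ 2 ∈ maximalIdeal (R ⧸ p) ^ n) (n : ℕ) :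
    w n ∈ maximalIdeal (R ⧸ p) ^ n := by
  have hlift : ∀ n, ∃ d ∈ maximalIdeal R ^ n, Ideal.Quotient.mk p d = w (n + 1) - w n := by
    intro n
    have := hw n
    rw [← map_maximalIdeal_of_surjective _ (Ideal.Quotient.mk_surjective (I := p)),
      ← Ideal.map_pow] at this
    obtain ⟨d, hd, hdw⟩ := (Ideal.mem_map_iff_of_surjective _ Ideal.Quotient.mk_surjective).1 this
    exact ⟨d, hd, hdw⟩
  choose d hd hdw using hlift
  obtain ⟨v₀, hv₀⟩ := Ideal.Quotient.mk_surjective (w 0)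
  let v : ℕ → R := fun n => v₀ + ∑ i ∈ Finset.range n, d i
  have hv : ∀ n, Ideal.Quotient.mk p (v n) = w n := by
    intro n
    simp only [v, map_add, map_sum, hdw, hv₀, Finset.sum_range_sub]
    ring
  let e : R ≃+* Localization.AtPrime (maximalIdeal R) :=
    (IsLocalization.atUnits R (maximalIdeal R).primeCompl (fun _ hx =>
      notMem_maximalIdeal.1 hx)).toRingEquiv
  have hmem : ∀ (r : R) (n : ℕ), e r ∈ p.map e ⊔
      maximalIdeal (Localization.AtPrime (maximalIdeal R)) ^ n ↔ r ∈ p ⊔ maximalIdeal R ^ n := by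
    intro r n
    rw [← map_ringEquiv_maximalIdeal e, ← Ideal.map_pow, ← Ideal.map_sup]
    refine ⟨fun h => ?_, fun h => Ideal.mem_map_of_mem _ h⟩
    obtain ⟨s, hs, hse⟩ := (Ideal.mem_map_of_equiv e _).1 h
    rwa [← e.injective hse]
  have hpe : (p.map e).IsPrime := Ideal.map_isPrime_of_equiv e
  have key := IsRegularAlgebra.mem_sup_pow_of_sq_mem (hexc.gRing (maximalIdeal R)) (p.map e)
    (fun n => e (v n)) (fun n => by
      have h1 : v (n + 1) - v n = d n := by
        simp only [v, Finset.sum_range_succ]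
        ring
      rw [← map_sub, h1, ← map_ringEquiv_maximalIdeal e, ← Ideal.map_pow]
      exact Ideal.mem_map_of_mem _ (hd n))
    (fun n => by
      rw [← map_pow, hmem, ← mk_mem_maximalIdeal_pow_iff, map_pow, hv]
      exact hsq n) n
  rw [hmem, ← mk_mem_maximalIdeal_pow_iff, hv] at key
  exact key

lemma saturationBounded_quotient_prime (hexc : IsExcellentRing R)
    (hrad : (Ideal.span {x, y}).radical = maximalIdeal R) (p : Ideal R) [p.IsPrime]
    (hdim : ringKrullDim (R ⧸ p) = 2) : SaturationBounded x y (R ⧸ p) := by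
  have hxp := notMem_of_ringKrullDim_quotient_eq_two hrad hdim
  have hx0 : Ideal.Quotient.mk p x ≠ 0 := fun h => hxp (Ideal.Quotient.eq_zero_iff_mem.1 h)
  obtain ⟨N, hN⟩ := exists_pow_smul_mem_range_toTransform hdim
    (hexc.universallyCatenary (Polynomial (R ⧸ p)))
    (mem_maximalIdeal_pow_of_isExcellentRing hexc p) (radical_span_mk_eq hrad p) hx0
  refine SaturationBounded.of_algebraMap (A := R ⧸ p) ?_
  exact saturationBounded_of_transform (mem_nonZeroDivisors_of_ne_zero hx0) hN

/-- Over an excellent local ring, the saturations of `(xⁿ)` in a cyclic module of pure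
dimension two are uniformly bounded. -/
lemma saturationBounded_quotient (hexc : IsExcellentRing R)
    (hrad : (Ideal.span {x, y}).radical = maximalIdeal R) (N : Submodule R R)
    (hN : ∀ q ∈ associatedPrimes R (R ⧸ N), ringKrullDim (R ⧸ q) = 2) :
    SaturationBounded x y (R ⧸ N) := by
  induction N using WellFoundedGT.induction with
  | _ N ih =>
    rcases subsingleton_or_nontrivial (R ⧸ N) with hsub | hnt
    · exact ⟨0, fun n k m m' _ => ⟨0, Subsingleton.elim _ _⟩⟩
    obtain ⟨p, hp⟩ := associatedPrimes.nonempty R (R ⧸ N)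
    have hpdim := hN p hp
    obtain ⟨hpp, m, hm⟩ := isAssociatedPrime_iff.1 hp
    obtain rfl : p = Ideal.torsionOf R (R ⧸ N) m := by
      rw [hm]
      ext r
      rw [Submodule.mem_colon_singleton, Submodule.mem_bot, Ideal.mem_torsionOf_iff]
    have hm0 : m ≠ 0 := by
      rintro rfl
      exact hpp.ne_top (Ideal.torsionOf_zero R (R ⧸ N))
    have htf : ∀ t ∈ rankOneSubmodule (R := R) m,
        ∀ a ∉ Ideal.torsionOf R (R ⧸ N) m, a • t = 0 → t = 0 := by
      intro t ht a ha hat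
      by_contra ht0
      -- An associated prime P ⊇ Ann t contains p; both quotients have dimension two, so P = p,
      -- although a ∈ P.
      obtain ⟨P, hP, htP⟩ := exists_le_isAssociatedPrime_of_isNoetherianRing R t ht0
      have hle : ∀ r : R, r • t = 0 → r ∈ P := fun r hr => htP (by
        rw [Submodule.mem_colon_singleton, Submodule.mem_bot, hr])
      refine ha ?_
      rw [eq_of_le_of_ringKrullDim_quotient_eq (n := 2) (q := P)
        (fun r hr => hle r (ht.1 r hr)) hpdim (hN P hP)]
      exact hle a hat
    obtain ⟨f, hf⟩ := exists_injective_rankOneSubmodule m htf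
    have hT : SaturationBounded x y (rankOneSubmodule (R := R) m) :=
      (saturationBounded_quotient_prime hexc hrad _ hpdim).of_injective f hf
    have hQ : ∀ q ∈ associatedPrimes R ((R ⧸ N) ⧸ rankOneSubmodule (R := R) m),
        ringKrullDim (R ⧸ q) = 2 := by
      intro q hq
      rcases mem_associatedPrimes_quotient_rankOneSubmodule m hq with rfl | hq
      · exact hpdim
      · exact hN q hq
    -- The quotient by the rank-one submodule is again cyclic, with kernel strictly above N because
    -- m ≠ 0, so Noetherian induction applies.
    let g : R →ₗ[R] (R ⧸ N) ⧸ rankOneSubmodule (R := R) m := Submodule.mkQ _ ∘ₗ N.mkQ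
    have hg : Function.Surjective g := (Submodule.mkQ_surjective _).comp (Submodule.mkQ_surjective _)
    let e := g.quotKerEquivOfSurjective hg
    refine SaturationBounded.of_submodule_quotient (rankOneSubmodule (R := R) m)
      (smul_eq_zero_of_associatedPrimes hrad hQ) hT ((ih (LinearMap.ker g) ?_ ?_).of_linearEquiv e)
    · refine lt_of_le_of_ne (fun r hr => ?_) fun h => ?_
      · have h0 : N.mkQ r = 0 := (Submodule.Quotient.mk_eq_zero N).2 hr
        rw [LinearMap.mem_ker, LinearMap.comp_apply, h0, map_zero]
      · obtain ⟨r, rfl⟩ := N.mkQ_surjective m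
        have hr : r ∈ LinearMap.ker g :=
          (Submodule.Quotient.mk_eq_zero _).2 (self_mem_rankOneSubmodule (N.mkQ r))
        rw [← h] at hr
        exact hm0 ((Submodule.Quotient.mk_eq_zero N).2 hr)
    · rwa [LinearEquiv.AssociatedPrimes.eq e]

end Local

end ParameterPair

end

theorem proposition3p5 {R : Type*} [CommRing R] [IsLocalRing R]
    (hexc : IsExcellentRing R) (hunm : IsUnmixedRing R) (hdim : ringKrullDim R = 2)
    (x y : R) (hxy : IsSystemOfParameters ![x, y])
    (Q : Ideal R) (hQ : Q = Ideal.span {x, y}) :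
    -- the Hilbert coefficients exist and all lengths involved are finite
    HasHilbertCoeffs Q 2 (hilbertCoeff Q) ∧
    IsFiniteLength R (R ⧸ limitClosure ![x, y]) ∧
    IsFiniteLength R (H1mQuot R Q) ∧
    -- (1)
    hilbertCoeff Q 0 - lengthInt R (R ⧸ limitClosure ![x, y]) = lengthInt R (H1mQuot R Q) ∧
    -- (2)
    (IsSuperficial Q x →
      IsFiniteLength R (H1mQuot R (Ideal.span {x})) ∧
      hilbertCoeff Q 0 - lengthInt R (R ⧸ limitClosure ![x, y]) + hilbertCoeff Q 1 =
        lengthInt R (H1mQuot R Q) - lengthInt R (H1mQuot R (Ideal.span {x}))) ∧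
    hilbertCoeff Q 0 - lengthInt R (R ⧸ limitClosure ![x, y]) + hilbertCoeff Q 1 ≤ 0 ∧
    (Q • (⊤ : Submodule R (H1m R)) = ⊥ →
      IsStandardParameters ![x, y] ∧
      hilbertCoeff Q 0 - lengthInt R (R ⧸ limitClosure ![x, y]) + hilbertCoeff Q 1 = 0) := by
  have := hexc.noetherian
  have hrad : (Ideal.span {x, y}).radical = IsLocalRing.maximalIdeal R := by
    rw [← ParameterPair.range_pair]
    exact hxy.2
  have hass : ∀ q ∈ associatedPrimes R R, ringKrullDim (R ⧸ q) = 2 := fun q hq =>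
    (hunm q hq).trans hdim
  have hreg : ∀ r : R, x • r = 0 → r = 0 :=
    ParameterPair.smul_eq_zero_of_associatedPrimes hrad hass
  have hx : x ∈ nonZeroDivisors R := mem_nonZeroDivisors_iff_left.2 hreg
  have hsat : ParameterPair.SaturationBounded x y R := by
    let e := Submodule.quotEquivOfEqBot (⊥ : Submodule R R) rfl
    refine ParameterPair.SaturationBounded.of_linearEquiv e
      (ParameterPair.saturationBounded_quotient hexc hrad ⊥ ?_)
    rwa [LinearEquiv.AssociatedPrimes.eq e]
  refine ParameterPair.main_of_finite hdim hrad hx ?_ Q hQ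
  obtain ⟨N, hN⟩ := hsat
  refine ⟨N, fun s => ?_⟩
  obtain ⟨n, h1, h2⟩ := s.2
  obtain ⟨a, ha⟩ := Submodule.mem_one.1 h1
  obtain ⟨b, hb⟩ := Submodule.mem_one.1 h2
  have hinj := IsFractionRing.injective R (FractionRing R)
  -- With a = xⁿ s and b = yⁿ s one has yⁿ a = xⁿ b, and the saturation bound returns x^N a = xⁿ c,
  -- that is, x^N s = c ∈ R.
  obtain ⟨c, hc⟩ := hN n n a b (by
    apply hinj
    rw [smul_eq_mul, smul_eq_mul, map_mul, map_mul, ha, hb, ← Algebra.smul_def,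
      ← Algebra.smul_def, smul_comm])
  rw [ParameterPair.mem_range_toTransform, Submodule.mem_one]
  refine ⟨c, ?_⟩
  apply LocalCohomologyOne.smul_fractionRing_injective (pow_mem hx n)
  have h3 := congrArg (algebraMap R (FractionRing R)) hc
  rw [smul_eq_mul, smul_eq_mul, map_mul, map_mul, ha, ← Algebra.smul_def,
    ← Algebra.smul_def] at h3
  rw [← h3]
  exact smul_comm _ _ _
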